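/- Let $M$ be a connected Hausdorff $C^\infty$ manifold of dimension $n$ and let $F:TM\to\mathbb R$ be a reversible Finsler metric: $F$ is continuous, and $C^\infty$ at every $(x,y)$ with $y\neq 0$; $F(x,y)>0$ for $y\ne 0$; $F(x,\lambda y)=|\lambda|F(x,y)$ for all $\lambda\in\mathbb R$; and $g_{ij}(x,y)=\frac12\frac{\partial^2F^2}{\partial y^i\partial y^j}$ is positive definite for $y\neq0$. Let $x_0,x_1\in M$ (possibly equal), let $\Omega$ be the set of piecewise $C^\infty$ regular curves $c:[0,1]\to M$ with $c(0)=x_0$, $c(1)=x_1$, and for $p\in\mathbb R\setminus\{0,1\}$ put $$E_p(c)=\int_0^1\|\dot c\|^p\,dt,\qquad \|\dot c\|=\sqrt{g(\dot c,\dot c)}=F(c,\dot c).$$ Let $\Gamma^i_{jk}$ be the formal Christoffel symbols of $g_{ij}(x,y)$ with respect to $x$, $N^i_j=\frac12\frac{\partial}{\partial y^j}(\Gamma^i_{kl}y^ky^l)$, $\frac{\delta}{\delta x^i}=\frac{\partial}{\partial x^i}-N^j_i\frac{\partial}{\partial y^j}$, and let $$L^i_{jk}=\tfrac12g^{im}\Big(\tfrac{\delta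 g_{mk}}{\delta x^j}+\tfrac{\delta g_{jm}}{\delta x^k}-\tfrac{\delta g_{jk}}{\delta x^m}\Big),\qquad C^i_{jk}=\tfrac12g^{im}\Big(\tfrac{\partial g_{mk}}{\partial y^j}+\tfrac{\partial g_{jm}}{\partial y^k}-\tfrac{\partial g_{jk}}{\partial y^m}\Big)$$ be the coefficients of the Cartan connection. Along a curve $c$ the covariant derivative of a vector field $X$ is $$\Big(\frac{\nabla X}{dt}\Big)^i=\dot X^i+X^m\Big(L^i_{mk}(c,\dot c)\,\dot c^k+C^i_{mk}(c,\dot c)\big(\ddot c^k+N^k_l(c,\dot c)\,\dot c^l\big)\Big).$$ A geodesic is a $C^\infty$ curve with $\frac{\nabla\dot c}{dt}=0$. A Jacobi field along a geodesic $c$ is a $C^\infty$ vector field $X$ along $c$ with $\frac{\nabla}{dt}\frac{\nabla X}{dt}+R^2(X,\dot c)\dot c=0$, where $(R^2(X,\dot c)\dot c)^i=R^i_{jk}(c,\dot c)\,\dot c^jX^k$ and $R^i_{jk}=\frac{\delta N^i_j}{\delta x^k}-\frac{\delta N^i_k}{\delta x^j}$. For $0\le a<b<1$, the point $c(b)$ is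 a conjugate point of $c(a)$ along $c$ if some nonzero Jacobi field along $c$ vanishes at $t=a$ and $t=b$. A variation of $c\in\Omega$ is a family $(c_s)_{s\in(-\varepsilon,\varepsilon)}\subset\Omega$ with $\varepsilon>0$, $c_0=c$, for which there is a partition $0=\tau_0<\dots<\tau_k=1$ such that $(s,t)\mapsto c_s(t)$ is $C^\infty$ on each $(-\varepsilon,\varepsilon)\times[\tau_{i},\tau_{i+1}]$. Call $c$ a minimum (maximum) of $E_p$ if for every variation $(c_s)$ of $c$ one has $E_p(c_s)\ge E_p(c)$ (respectively $E_p(c_s)\le E_p(c)$) for all $s$ close enough to $0$. In particular every global minimum (maximum) of $E_p$ on $\Omega$ is a minimum (maximum) in this sense. Let $p\in\mathbb R\setminus\{0,1\}$ and let $c\in\Omega$ be a geodesic. A) Suppose that $c$ has no conjugate points to $c(0)$. (i) If $p<0$, then $c$ is not a maximum of $E_p$ and, if $n\ge2$, it is not a minimum of $E_p$ either; if $0<p<1$, then $c$ is not a minimum of $E_p$ and, if $n\geq 2$, it is not a maximum of $E_p$ either. (ii) If $p>1$, then $c$ is not a maximum of $E_p$. B) Suppose that $c$ has conjugate points to $c(0)$.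 (i) If $p<0$, then $c$ is not a maximum of $E_p$. (ii) If $0<p<1$, then $c$ is not a minimum of $E_p$. (iii) If $p>1$, then $c$ is neither a minimum nor a maximum of $E_p$. -/

import Mathlib

open Set Filter Topology
open scoped Manifold ContDiff

noncomputable section

namespace Finsler

/-- Coordinate vectors `(x¹, …, xⁿ)` or `(y¹, …, yⁿ)`. -/
abbrev Vec (n : ℕ) : Type := EuclideanSpace ℝ (Fin n)

/-! ### Finsler geometry in local coordinates

In this part `F x y` is the coordinate expression of a fundamental function. -/

/-- The partial derivative `∂f/∂xⁱ` of a function `f (x, y)`. -/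
def pdx {n : ℕ} (i : Fin n) (f : Vec n → Vec n → ℝ) (x y : Vec n) : ℝ :=
  fderiv ℝ (fun z => f z y) x (EuclideanSpace.single i 1)

/-- The partial derivative `∂f/∂yⁱ` of a function `f (x, y)`. -/
def pdy {n : ℕ} (i : Fin n) (f : Vec n → Vec n → ℝ) (x y : Vec n) : ℝ :=
  fderiv ℝ (fun z => f x z) y (EuclideanSpace.single i 1)

/-- The fundamental tensor `g_{ij} = ½ ∂²F²/∂yⁱ∂yʲ`. -/
def fundTensor {n : ℕ} (F : Vec n → Vec n → ℝ) (i j : Fin n) (x y : Vec n) : ℝ :=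
  (1 / 2 : ℝ) * pdy i (pdy j (fun x y => F x y ^ 2)) x y

/-- The matrix `(g_{ij}(x, y))`. -/
def fundMatrix {n : ℕ} (F : Vec n → Vec n → ℝ) (x y : Vec n) : Matrix (Fin n) (Fin n) ℝ :=
  Matrix.of fun i j => fundTensor F i j x y

/-- The entries `g^{ij}` of the inverse of the matrix of the fundamental tensor. -/
def fundInv {n : ℕ} (F : Vec n → Vec n → ℝ) (i j : Fin n) (x y : Vec n) : ℝ :=
  (fundMatrix F x y)⁻¹ i j

/-- The formal Christoffel symbols
`Γⁱ_{jk} = ½ gⁱᵐ (∂g_{mk}/∂xʲ + ∂g_{jm}/∂xᵏ - ∂g_{jk}/∂xᵐ)`. -/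
def formalChristoffel {n : ℕ} (F : Vec n → Vec n → ℝ) (i j k : Fin n) (x y : Vec n) : ℝ :=
  (1 / 2 : ℝ) * ∑ m, fundInv F i m x y *
    (pdx j (fundTensor F m k) x y + pdx k (fundTensor F j m) x y - pdx m (fundTensor F j k) x y)

/-- `Γⁱ_{00} = Γⁱ_{kl} yᵏ yˡ`. -/
def spray {n : ℕ} (F : Vec n → Vec n → ℝ) (i : Fin n) (x y : Vec n) : ℝ :=
  ∑ k, ∑ l, formalChristoffel F i k l x y * y k * y l

/-- The canonical nonlinear connection `Nⁱ_j = ½ ∂Γⁱ_{00}/∂yʲ`. -/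
def nonlinConn {n : ℕ} (F : Vec n → Vec n → ℝ) (i j : Fin n) (x y : Vec n) : ℝ :=
  (1 / 2 : ℝ) * pdy j (spray F i) x y

/-- The horizontal derivative `δf/δxⁱ = ∂f/∂xⁱ - Nʲ_i ∂f/∂yʲ`. -/
def pdh {n : ℕ} (F : Vec n → Vec n → ℝ) (i : Fin n) (f : Vec n → Vec n → ℝ) (x y : Vec n) : ℝ :=
  pdx i f x y - ∑ j, nonlinConn F j i x y * pdy j f x y

/-- The horizontal coefficients of the Cartan connection,
`Lⁱ_{jk} = ½ gⁱᵐ (δg_{mk}/δxʲ + δg_{jm}/δxᵏ - δg_{jk}/δxᵐ)`. -/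
def cartanL {n : ℕ} (F : Vec n → Vec n → ℝ) (i j k : Fin n) (x y : Vec n) : ℝ :=
  (1 / 2 : ℝ) * ∑ m, fundInv F i m x y *
    (pdh F j (fundTensor F m k) x y + pdh F k (fundTensor F j m) x y
      - pdh F m (fundTensor F j k) x y)

/-- The vertical coefficients of the Cartan connection,
`Cⁱ_{jk} = ½ gⁱᵐ (∂g_{mk}/∂yʲ + ∂g_{jm}/∂yᵏ - ∂g_{jk}/∂yᵐ)`. -/
def cartanC {n : ℕ} (F : Vec n → Vec n → ℝ) (i j k : Fin n) (x y : Vec n) : ℝ :=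
  (1 / 2 : ℝ) * ∑ m, fundInv F i m x y *
    (pdy j (fundTensor F m k) x y + pdy k (fundTensor F j m) x y - pdy m (fundTensor F j k) x y)

/-- The curvature `Rⁱ_{jk} = δNⁱ_j/δxᵏ - δNⁱ_k/δxʲ` of the nonlinear connection. It is the
`h`-curvature of the Cartan connection contracted with `y`, that is `Rⁱ_{0jk}`. -/
def hCurvature {n : ℕ} (F : Vec n → Vec n → ℝ) (i j k : Fin n) (x y : Vec n) : ℝ :=
  pdh F k (nonlinConn F i j) x y - pdh F j (nonlinConn F i k) x y

/-- The derivative of a coordinate curve defined on `[0, 1]` (one-sided at `0` and `1`). -/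
def dot {n : ℕ} (u : ℝ → Vec n) (t : ℝ) : Vec n :=
  derivWithin u (Icc 0 1) t

/-- The covariant derivative, with respect to the Cartan connection, of a vector field with
components `ξ` along the curve with coordinates `u`:
`(∇ξ/dt)ⁱ = dξⁱ/dt + ξᵐ (Lⁱ_{mk}(u, u̇) u̇ᵏ + Cⁱ_{mk}(u, u̇) δu̇ᵏ/dt)`,
where `δu̇ᵏ/dt = üᵏ + Nᵏ_l(u, u̇) u̇ˡ`. -/
def covDeriv {n : ℕ} (F : Vec n → Vec n → ℝ) (u ξ : ℝ → Vec n) (t : ℝ) : Vec n :=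
  WithLp.toLp 2 fun i =>
    dot ξ t i + ∑ m, ξ t m * ∑ k,
      (cartanL F i m k (u t) (dot u t) * dot u t k
        + cartanC F i m k (u t) (dot u t) *
            (dot (dot u) t k + ∑ l, nonlinConn F k l (u t) (dot u t) * dot u t l))

/-- The vector `R²(ξ, u̇)u̇ = Rˡ_{jk}(u, u̇) u̇ʲ ξᵏ ∂/∂xˡ` along the curve with coordinates `u`. -/
def curvTerm {n : ℕ} (F : Vec n → Vec n → ℝ) (u ξ : ℝ → Vec n) (t : ℝ) : Vec n :=
  WithLp.toLp 2 fun l =>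
    ∑ j, ∑ k, hCurvature F l j k (u t) (dot u t) * dot u t j * ξ t k

/-! ### Finsler manifolds -/

section Manifold

variable {n : ℕ} {M : Type*} [TopologicalSpace M] [ChartedSpace (Vec n) M]

/-- The expression of a function on the tangent bundle in the coordinates `(xⁱ, yⁱ)` which the
preferred chart `φ` at `q` induces: `(x, y) ↦ F(φ⁻¹ x, yⁱ ∂/∂xⁱ)`. Meaningful for `x` in the
target of the chart. -/
def localExpr (F : TangentBundle (𝓡 n) M → ℝ) (q : M) (x y : Vec n) : ℝ :=
  F ⟨(extChartAt (𝓡 n) q).symm x,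
    mfderiv 𝓘(ℝ, Vec n) (𝓡 n) (extChartAt (𝓡 n) q).symm x y⟩

variable (n M) in
/-- A (reversible) Finsler structure on the manifold `M`. -/
structure FinslerMetric [IsManifold (𝓡 n) ∞ M] where
  /-- The fundamental function. -/
  toFun : TangentBundle (𝓡 n) M → ℝ
  pos : ∀ (x : M) (y : TangentSpace (𝓡 n) x), y ≠ 0 → 0 < toFun ⟨x, y⟩
  homog : ∀ (x : M) (a : ℝ) (y : TangentSpace (𝓡 n) x),
    toFun ⟨x, a • y⟩ = |a| * toFun ⟨x, y⟩
  posDef : ∀ (q : M), ∀ x ∈ (extChartAt (𝓡 n) q).target, ∀ y : Vec n, y ≠ 0 →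
    (fundMatrix (localExpr toFun q) x y).PosDef
  smooth : ContMDiffOn (𝓡 n).tangent 𝓘(ℝ, ℝ) ∞ toFun {v | v.2 ≠ 0}
  cont : Continuous toFun

/-- Partitions `0 = τ₀ < τ₁ < … < τ_k = 1` of the unit interval. -/
def IsPartition {k : ℕ} (τ : Fin (k + 1) → ℝ) : Prop :=
  StrictMono τ ∧ τ 0 = 0 ∧ τ (Fin.last k) = 1

/-- The set `Ω` of piecewise smooth regular curves `[0, 1] → M` from `x₀` to `x₁`. Curves are
represented by functions on `ℝ`, whose values outside `[0, 1]` play no role. -/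
def pathSpace (x₀ x₁ : M) : Set (ℝ → M) :=
  {c | c 0 = x₀ ∧ c 1 = x₁ ∧ ∃ (k : ℕ) (τ : Fin (k + 1) → ℝ), IsPartition τ ∧
    ∀ i : Fin k,
      ContMDiffOn 𝓘(ℝ, ℝ) (𝓡 n) ∞ c (Icc (τ i.castSucc) (τ i.succ)) ∧
      ∀ t ∈ Icc (τ i.castSucc) (τ i.succ),
        mfderivWithin 𝓘(ℝ, ℝ) (𝓡 n) c (Icc (τ i.castSucc) (τ i.succ)) t (1 : ℝ) ≠ 0}

/-- A one-parameter variation `(c_s)`, `s ∈ (-ε, ε)`, of `c` in `Ω`: all `c_s` belong to `Ω`,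
`c_0 = c`, and `(s, t) ↦ c_s(t)` is smooth on each `(-ε, ε) × [τ_i, τ_{i+1}]` for some
partition of `[0, 1]`. -/
def IsVariation (x₀ x₁ : M) (c : ℝ → M) (ε : ℝ) (γ : ℝ → ℝ → M) : Prop :=
  (∀ s ∈ Ioo (-ε) ε, γ s ∈ pathSpace (n := n) x₀ x₁) ∧
  (∀ t ∈ Icc (0 : ℝ) 1, γ 0 t = c t) ∧
  ∃ (k : ℕ) (τ : Fin (k + 1) → ℝ), IsPartition τ ∧
    ∀ i : Fin k, ContMDiffOn 𝓘(ℝ, ℝ × ℝ) (𝓡 n) ∞ (fun z : ℝ × ℝ => γ z.1 z.2)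
      (Ioo (-ε) ε ×ˢ Icc (τ i.castSucc) (τ i.succ))

/-- The coordinates, in the preferred chart at `q`, of a curve in `M`. -/
def coordCurve (q : M) (c : ℝ → M) (t : ℝ) : Vec n :=
  extChartAt (𝓡 n) q (c t)

/-- The components, in the preferred chart at `q`, of a vector field along a curve in `M`. -/
def coordField (q : M) (c : ℝ → M) (X : (t : ℝ) → TangentSpace (𝓡 n) (c t)) (t : ℝ) : Vec n :=
  mfderiv (𝓡 n) 𝓘(ℝ, Vec n) (extChartAt (𝓡 n) q) (c t) (X t)

variable [IsManifold (𝓡 n) ∞ M]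

/-- The `p`-energy `E_p(c) = ∫₀¹ ‖ċ‖ᵖ dt`, where `‖ċ‖ = g(ċ, ċ)^{1/2} = F(c, ċ)`. -/
def pEnergy (F : FinslerMetric n M) (p : ℝ) (c : ℝ → M) : ℝ :=
  ∫ t in (0 : ℝ)..1, F.toFun ⟨c t, mfderiv 𝓘(ℝ, ℝ) (𝓡 n) c t (1 : ℝ)⟩ ^ p

/-- The smooth curve `c : [0, 1] → M` is a geodesic: `∇ċ/dt = 0`, in all local coordinates. -/
def IsGeodesic (F : FinslerMetric n M) (c : ℝ → M) : Prop :=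
  ContMDiffOn 𝓘(ℝ, ℝ) (𝓡 n) ∞ c (Icc 0 1) ∧
  ∀ q : M, ∀ t ∈ Icc (0 : ℝ) 1, c t ∈ (extChartAt (𝓡 n) q).source →
    covDeriv (localExpr F.toFun q) (coordCurve q c) (dot (coordCurve q c)) t = 0

/-- The smooth vector field `X` along `c` is a Jacobi field: `∇/dt ∇X/dt + R²(X, ċ)ċ = 0`, in all
local coordinates. -/
def IsJacobi (F : FinslerMetric n M) (c : ℝ → M)
    (X : (t : ℝ) → TangentSpace (𝓡 n) (c t)) : Prop :=
  ContMDiffOn 𝓘(ℝ, ℝ) (𝓡 n).tangent ∞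
    (fun t => (⟨c t, X t⟩ : TangentBundle (𝓡 n) M)) (Icc 0 1) ∧
  ∀ q : M, ∀ t ∈ Icc (0 : ℝ) 1, c t ∈ (extChartAt (𝓡 n) q).source →
    covDeriv (localExpr F.toFun q) (coordCurve q c)
        (covDeriv (localExpr F.toFun q) (coordCurve q c) (coordField q c X)) t
      + curvTerm (localExpr F.toFun q) (coordCurve q c) (coordField q c X) t = 0

/-- `c(b)` is a conjugate point of `c(a)` along `c`, where `0 ≤ a < b < 1`. -/
def IsConjugate (F : FinslerMetric n M) (c : ℝ → M) (a b : ℝ) : Prop :=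
  0 ≤ a ∧ a < b ∧ b < 1 ∧ ∃ X : (t : ℝ) → TangentSpace (𝓡 n) (c t),
    IsJacobi F c X ∧ (∃ t ∈ Icc (0 : ℝ) 1, X t ≠ 0) ∧ X a = 0 ∧ X b = 0

/-- `c` has conjugate points to `c(0)`. -/
def HasConjugatePoints (F : FinslerMetric n M) (c : ℝ → M) : Prop :=
  ∃ b, IsConjugate F c 0 b

/-- `c` is a local minimum of `E_p` on `Ω`: along each variation `(c_s)` of `c` in `Ω` one has
`E_p(c) ≤ E_p(c_s)` for all small `s`. Every global minimum of `E_p` on `Ω` is one. -/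
def IsMinimum (F : FinslerMetric n M) (p : ℝ) (x₀ x₁ : M) (c : ℝ → M) : Prop :=
  ∀ (ε : ℝ) (γ : ℝ → ℝ → M), 0 < ε → IsVariation (n := n) x₀ x₁ c ε γ →
    ∀ᶠ s in 𝓝 (0 : ℝ), pEnergy F p c ≤ pEnergy F p (γ s)

/-- `c` is a local maximum of `E_p` on `Ω`: along each variation `(c_s)` of `c` in `Ω` one has
`E_p(c_s) ≤ E_p(c)` for all small `s`. Every global maximum of `E_p` on `Ω` is one. -/
def IsMaximum (F : FinslerMetric n M) (p : ℝ) (x₀ x₁ : M) (c : ℝ → M) : Prop :=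
  ∀ (ε : ℝ) (γ : ℝ → ℝ → M), 0 < ε → IsVariation (n := n) x₀ x₁ c ε γ →
    ∀ᶠ s in 𝓝 (0 : ℝ), pEnergy F p (γ s) ≤ pEnergy F p c

end Manifold

end Finsler

end

noncomputable section

namespace Finsler

variable {n : ℕ}

/-! The Lagrangian is `L = F ^ p`. Its Hessian in the fibre variable, in a direction `e` over `(x,
y)`, is a positive multiple of `p (F² g(e,e) + (p - 2) g(y,e)²)`. In the direction of the velocity
this gives `p (p - 1) F ^ p`. On a nonzero vector that is `g`-orthogonal to the velocity, which
exists once `n ≥ 2`, it is `p` times a positive number.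

Legendre's necessary condition (`legendre_condition`) says that this Hessian is positive
semidefinite along a minimum and negative semidefinite along a maximum. Indeed, a variation
concentrated on an interval of radius `r` contributes a term of order `1 / r` through its time
derivative, and this term dominates the other terms of the second variation as `r` tends to `0`.
Comparing signs in the two directions settles every claim except one: for `p > 1`, a geodesic with a
conjugate point is not a minimum.

That claim is Jacobi's argument (`not_isMinimum_of_hasConjugatePoints`). Let `X` be a nonzero Jacobi
field with `X 0 = 0` and `X b = 0`. Deform `c` along `X` on `[0, b]` and keep it fixed on `[b, 1]`;
the second variation is `0`. Now add a field `δ v` supported near `b`, with `v b = -X' b`. The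
second variation becomes `2 δ B + δ² Λ`, where `B = L_yy(X' b, v b) = -L_yy(X' b, X' b)`. Uniqueness
for the Jacobi equation gives `X' b ≠ 0`, and `L` is strongly convex in the fibres for `p > 1`
(`legendre_pos`), so `B < 0`. A small `δ > 0` makes the second variation negative.

The link with the Cartan connection is made in coordinates. Homogeneity reduces the geodesic
equation to `ü + Γ(u, u̇) = 0` (`spray_of_covDeriv`) and the Jacobi equation to its linearization
(`linearized_spray`). Solutions of the first satisfy the Euler–Lagrange equation of `F ^ p` for
every `p`, since `F` is constant along them (`euler_lagrange`). No global index form is needed: the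
second variation is the second derivative of the energy along an actual family of curves, and its
density is integrated by differentiating the momentum paired with a variation field
(`hasDerivAt_deriv_momentum`). -/

theorem minSmoothness_two_le : minSmoothness ℝ 2 ≤ (∞ : ℕ∞ω) := by
  rw [minSmoothness_of_isRCLikeNormedField]
  exact WithTop.coe_le_coe.2 (le_top : (2 : ℕ∞) ≤ ⊤)

/-- Smoothness of `f (x, y)` for `x ∈ U` and `y ≠ 0`. -/
def SmoothOff (U : Set (Vec n)) (f : Vec n → Vec n → ℝ) : Prop :=
  ContDiffOn ℝ ∞ (fun z : Vec n × Vec n => f z.1 z.2) (U ×ˢ {0}ᶜ)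

theorem isOpen_slit {U : Set (Vec n)} (hU : IsOpen U) :
    IsOpen (U ×ˢ ({0}ᶜ : Set (Vec n))) := hU.prod isOpen_compl_singleton

/-! ### Calculus of functions of position and nonzero direction -/

section Calculus

variable {U : Set (Vec n)} {f g : Vec n → Vec n → ℝ} {x y : Vec n}

theorem SmoothOff.contDiffAt (hU : IsOpen U) (hf : SmoothOff U f) (hx : x ∈ U) (hy : y ≠ 0) :
    ContDiffAt ℝ ∞ (fun z : Vec n × Vec n => f z.1 z.2) (x, y) :=
  ContDiffOn.contDiffAt hf ((isOpen_slit hU).mem_nhds ⟨hx, hy⟩)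

theorem SmoothOff.differentiableAt (hU : IsOpen U) (hf : SmoothOff U f) (hx : x ∈ U)
    (hy : y ≠ 0) : DifferentiableAt ℝ (fun z : Vec n × Vec n => f z.1 z.2) (x, y) :=
  (hf.contDiffAt hU hx hy).differentiableAt (by simp)

/-- Reading coordinate partials off the Fréchet derivative on the product makes smoothness, the
product rule and the symmetry of second derivatives available for them. -/
theorem pdx_eq_fderiv (i : Fin n)
    (hf : DifferentiableAt ℝ (fun z : Vec n × Vec n => f z.1 z.2) (x, y)) :
    pdx i f x y = fderiv ℝ (fun z : Vec n × Vec n => f z.1 z.2) (x, y)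
      (EuclideanSpace.single i 1, 0) := by
  have h : HasFDerivAt (fun z => f z y) _ x :=
    HasFDerivAt.comp x (f := fun z : Vec n => (z, y)) hf.hasFDerivAt
      (hasFDerivAt_prodMk_left x y)
  simp [pdx, h.fderiv]

theorem pdy_eq_fderiv (i : Fin n)
    (hf : DifferentiableAt ℝ (fun z : Vec n × Vec n => f z.1 z.2) (x, y)) :
    pdy i f x y = fderiv ℝ (fun z : Vec n × Vec n => f z.1 z.2) (x, y)
      (0, EuclideanSpace.single i 1) := by
  have h : HasFDerivAt (fun z => f x z) _ y :=
    HasFDerivAt.comp y (f := fun z : Vec n => (x, z)) hf.hasFDerivAt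
      (hasFDerivAt_prodMk_right x y)
  simp [pdy, h.fderiv]

theorem vec_eq_sum (v : Vec n) : v = ∑ i, v i • EuclideanSpace.single i (1 : ℝ) := by
  ext j; simp [Finset.sum_apply, Pi.single_apply]

theorem fderiv_eq_sum (hf : DifferentiableAt ℝ (fun z : Vec n × Vec n => f z.1 z.2) (x, y))
    (v w : Vec n) :
    fderiv ℝ (fun z : Vec n × Vec n => f z.1 z.2) (x, y) (v, w)
      = ∑ i, v i * pdx i f x y + ∑ i, w i * pdy i f x y := by
  have hv : (v, w) = ∑ i, v i • ((EuclideanSpace.single i (1 : ℝ), 0) : Vec n × Vec n)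
      + ∑ i, w i • ((0, EuclideanSpace.single i (1 : ℝ)) : Vec n × Vec n) := by
    refine Prod.ext ?_ ?_
    · simpa [Prod.fst_sum] using vec_eq_sum v
    · simpa [Prod.snd_sum] using vec_eq_sum w
  rw [hv, map_add, map_sum, map_sum]
  simp only [map_smul, smul_eq_mul, pdx_eq_fderiv _ hf, pdy_eq_fderiv _ hf]

theorem SmoothOff.congr (hf : SmoothOff U f) (h : ∀ x ∈ U, ∀ y ≠ 0, g x y = f x y) :
    SmoothOff U g := ContDiffOn.congr hf fun z hz => h z.1 hz.1 z.2 hz.2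

theorem SmoothOff.pdx (hU : IsOpen U) (hf : SmoothOff U f) (i : Fin n) : SmoothOff U (pdx i f) :=
  ContDiffOn.congr (f := fun z => fderiv ℝ (fun z : Vec n × Vec n => f z.1 z.2) z
    (EuclideanSpace.single i 1, 0))
    ((ContDiffOn.fderiv_of_isOpen hf (isOpen_slit hU) (by simp)).clm_apply contDiffOn_const)
    fun z hz => pdx_eq_fderiv i (hf.differentiableAt hU hz.1 hz.2)

theorem SmoothOff.pdy (hU : IsOpen U) (hf : SmoothOff U f) (i : Fin n) : SmoothOff U (pdy i f) :=
  ContDiffOn.congr (f := fun z => fderiv ℝ (fun z : Vec n × Vec n => f z.1 z.2) z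
    (0, EuclideanSpace.single i 1))
    ((ContDiffOn.fderiv_of_isOpen hf (isOpen_slit hU) (by simp)).clm_apply contDiffOn_const)
    fun z hz => pdy_eq_fderiv i (hf.differentiableAt hU hz.1 hz.2)

theorem SmoothOff.mul (hf : SmoothOff U f) (hg : SmoothOff U g) :
    SmoothOff U (fun x y => f x y * g x y) := ContDiffOn.mul hf hg

theorem SmoothOff.add (hf : SmoothOff U f) (hg : SmoothOff U g) :
    SmoothOff U (fun x y => f x y + g x y) := ContDiffOn.add hf hg

theorem SmoothOff.sub (hf : SmoothOff U f) (hg : SmoothOff U g) :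
    SmoothOff U (fun x y => f x y - g x y) := ContDiffOn.sub hf hg

theorem SmoothOff.const (U : Set (Vec n)) (a : ℝ) : SmoothOff U (fun _ _ => a) := contDiffOn_const

theorem SmoothOff.sum {ι : Type*} {s : Finset ι} {f : ι → Vec n → Vec n → ℝ}
    (hf : ∀ i ∈ s, SmoothOff U (f i)) : SmoothOff U (fun x y => ∑ i ∈ s, f i x y) :=
  ContDiffOn.sum (f := fun i (z : Vec n × Vec n) => f i z.1 z.2) hf

theorem contDiff_coord (k : Fin n) : ContDiff ℝ ∞ (fun y : Vec n => y k) :=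
  (EuclideanSpace.proj (𝕜 := ℝ) k).contDiff

theorem SmoothOff.coord (U : Set (Vec n)) (k : Fin n) : SmoothOff U (fun _ y => y k) :=
  ((contDiff_coord k).comp contDiff_snd).contDiffOn

theorem pdx_congr (hU : IsOpen U) (h : ∀ x ∈ U, ∀ y ≠ 0, f x y = g x y) (i : Fin n)
    (hx : x ∈ U) (hy : y ≠ 0) : pdx i f x y = pdx i g x y := by
  have : (fun z => f z y) =ᶠ[𝓝 x] fun z => g z y := by
    filter_upwards [hU.mem_nhds hx] with z hz using h z hz y hy
  simp only [Finsler.pdx, this.fderiv_eq]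

theorem pdy_congr (h : ∀ x ∈ U, ∀ y ≠ 0, f x y = g x y) (i : Fin n)
    (hx : x ∈ U) (hy : y ≠ 0) : pdy i f x y = pdy i g x y := by
  have : (fun z => f x z) =ᶠ[𝓝 y] fun z => g x z := by
    filter_upwards [isOpen_compl_singleton.mem_nhds hy] with z hz using h x hx z hz
  simp only [Finsler.pdy, this.fderiv_eq]

theorem pdx_mul (hU : IsOpen U) (hf : SmoothOff U f) (hg : SmoothOff U g) (i : Fin n)
    (hx : x ∈ U) (hy : y ≠ 0) :
    pdx i (fun x y => f x y * g x y) x y = pdx i f x y * g x y + f x y * pdx i g x y := by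
  have h1 := hf.differentiableAt hU hx hy
  have h2 := hg.differentiableAt hU hx hy
  rw [pdx_eq_fderiv i (h1.mul h2), pdx_eq_fderiv i h1, pdx_eq_fderiv i h2, fderiv_fun_mul h1 h2]
  simp; ring

theorem pdy_mul (hU : IsOpen U) (hf : SmoothOff U f) (hg : SmoothOff U g) (i : Fin n)
    (hx : x ∈ U) (hy : y ≠ 0) :
    pdy i (fun x y => f x y * g x y) x y = pdy i f x y * g x y + f x y * pdy i g x y := by
  have h1 := hf.differentiableAt hU hx hy
  have h2 := hg.differentiableAt hU hx hy
  rw [pdy_eq_fderiv i (h1.mul h2), pdy_eq_fderiv i h1, pdy_eq_fderiv i h2, fderiv_fun_mul h1 h2]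
  simp; ring

theorem pdx_const_mul (a : ℝ) (i : Fin n) (x y : Vec n) :
    pdx i (fun x y => a * f x y) x y = a * pdx i f x y := by
  simp only [Finsler.pdx]; erw [fderiv_const_smul_field a]; rfl

theorem pdy_const_mul (a : ℝ) (i : Fin n) (x y : Vec n) :
    pdy i (fun x y => a * f x y) x y = a * pdy i f x y := by
  simp only [Finsler.pdy]; erw [fderiv_const_smul_field a]; rfl

theorem pdy_sub (hU : IsOpen U) (hf : SmoothOff U f) (hg : SmoothOff U g) (i : Fin n)
    (hx : x ∈ U) (hy : y ≠ 0) :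
    pdy i (fun x y => f x y - g x y) x y = pdy i f x y - pdy i g x y := by
  have h1 := hf.differentiableAt hU hx hy
  have h2 := hg.differentiableAt hU hx hy
  rw [pdy_eq_fderiv i (h1.sub h2), pdy_eq_fderiv i h1, pdy_eq_fderiv i h2, fderiv_fun_sub h1 h2]
  rfl

theorem pdx_sum {ι : Type*} (s : Finset ι) {f : ι → Vec n → Vec n → ℝ} (hU : IsOpen U)
    (hf : ∀ i ∈ s, SmoothOff U (f i)) (i : Fin n) (hx : x ∈ U) (hy : y ≠ 0) :
    pdx i (fun x y => ∑ k ∈ s, f k x y) x y = ∑ k ∈ s, pdx i (f k) x y := by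
  have h : ∀ k ∈ s, _ := fun k hk => (hf k hk).differentiableAt hU hx hy
  rw [pdx_eq_fderiv i (DifferentiableAt.fun_sum h), fderiv_fun_sum h, sum_apply]
  exact Finset.sum_congr rfl fun k hk => (pdx_eq_fderiv i (h k hk)).symm

theorem pdy_sum {ι : Type*} (s : Finset ι) {f : ι → Vec n → Vec n → ℝ} (hU : IsOpen U)
    (hf : ∀ i ∈ s, SmoothOff U (f i)) (i : Fin n) (hx : x ∈ U) (hy : y ≠ 0) :
    pdy i (fun x y => ∑ k ∈ s, f k x y) x y = ∑ k ∈ s, pdy i (f k) x y := by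
  have h : ∀ k ∈ s, _ := fun k hk => (hf k hk).differentiableAt hU hx hy
  rw [pdy_eq_fderiv i (DifferentiableAt.fun_sum h), fderiv_fun_sum h, sum_apply]
  exact Finset.sum_congr rfl fun k hk => (pdy_eq_fderiv i (h k hk)).symm

theorem pdx_coord (i k : Fin n) (x y : Vec n) : pdx i (fun _ y => y k) x y = 0 := by
  simp [Finsler.pdx]

theorem pdy_coord (i k : Fin n) (x y : Vec n) :
    pdy i (fun _ y => y k) x y = if k = i then 1 else 0 := by
  have : fderiv ℝ (fun y : Vec n => y k) y = EuclideanSpace.proj (𝕜 := ℝ) k :=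
    (EuclideanSpace.proj (𝕜 := ℝ) k).fderiv
  simp [Finsler.pdy, this]

theorem fderiv_fderiv_apply {E : Type*} [NormedAddCommGroup E] [NormedSpace ℝ E] {f : E → ℝ}
    {z : E} (hf : ContDiffAt ℝ ∞ f z) (v w : E) :
    fderiv ℝ (fun z => fderiv ℝ f z w) z v = fderiv ℝ (fderiv ℝ f) z v w := by
  have : DifferentiableAt ℝ (fderiv ℝ f) z :=
    (hf.fderiv_right (m := ∞) (by simp)).differentiableAt (by simp)
  have h := this.hasFDerivAt.clm_apply (hasFDerivAt_const w z)
  rw [h.fderiv]; simp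

theorem pdy_congr_fderiv (hU : IsOpen U) (hf : SmoothOff U f) (i j : Fin n) (hx : x ∈ U)
    (hy : y ≠ 0) : pdy i (pdy j f) x y
      = fderiv ℝ (fderiv ℝ (fun z : Vec n × Vec n => f z.1 z.2)) (x, y)
        (0, EuclideanSpace.single i 1) (0, EuclideanSpace.single j 1) := by
  rw [pdy_eq_fderiv i ((hf.pdy hU j).differentiableAt hU hx hy),
    ← fderiv_fderiv_apply (hf.contDiffAt hU hx hy)]
  congr 1
  refine Filter.EventuallyEq.fderiv_eq ?_
  filter_upwards [(isOpen_slit hU).mem_nhds ⟨hx, hy⟩] with z hz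
  exact pdy_eq_fderiv j (hf.differentiableAt hU hz.1 hz.2)

theorem pdy_comm (hU : IsOpen U) (hf : SmoothOff U f) (i j : Fin n) (hx : x ∈ U)
    (hy : y ≠ 0) : pdy i (pdy j f) x y = pdy j (pdy i f) x y := by
  rw [pdy_congr_fderiv hU hf i j hx hy, pdy_congr_fderiv hU hf j i hx hy]
  exact (hf.contDiffAt hU hx hy).isSymmSndFDerivAt minSmoothness_two_le _ _

theorem pdx_pdy_comm (hU : IsOpen U) (hf : SmoothOff U f) (i j : Fin n) (hx : x ∈ U)
    (hy : y ≠ 0) : pdx i (pdy j f) x y = pdy j (pdx i f) x y := by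
  have hz := (isOpen_slit hU).mem_nhds (⟨hx, hy⟩ : (x, y) ∈ U ×ˢ ({0}ᶜ : Set (Vec n)))
  have hd := hf.contDiffAt hU hx hy
  rw [pdx_eq_fderiv i ((hf.pdy hU j).differentiableAt hU hx hy),
    pdy_eq_fderiv j ((hf.pdx hU i).differentiableAt hU hx hy)]
  have e1 : (fun z : Vec n × Vec n => pdy j f z.1 z.2) =ᶠ[𝓝 (x, y)] fun z =>
      fderiv ℝ (fun z : Vec n × Vec n => f z.1 z.2) z (0, EuclideanSpace.single j 1) := by
    filter_upwards [hz] with z hz using pdy_eq_fderiv j (hf.differentiableAt hU hz.1 hz.2)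
  have e2 : (fun z : Vec n × Vec n => pdx i f z.1 z.2) =ᶠ[𝓝 (x, y)] fun z =>
      fderiv ℝ (fun z : Vec n × Vec n => f z.1 z.2) z (EuclideanSpace.single i 1, 0) := by
    filter_upwards [hz] with z hz using pdx_eq_fderiv i (hf.differentiableAt hU hz.1 hz.2)
  rw [e1.fderiv_eq, e2.fderiv_eq, fderiv_fderiv_apply hd, fderiv_fderiv_apply hd]
  exact hd.isSymmSndFDerivAt minSmoothness_two_le _ _

/-- Positive homogeneity of degree `k` in `y`. -/
def HomogOff (U : Set (Vec n)) (k : ℕ) (f : Vec n → Vec n → ℝ) : Prop :=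
  ∀ x ∈ U, ∀ y ≠ 0, ∀ a : ℝ, 0 < a → f x (a • y) = a ^ k * f x y

theorem HomogOff.pdy {k : ℕ} (hU : IsOpen U) (hf : SmoothOff U f) (h : HomogOff U (k + 1) f)
    (i : Fin n) : HomogOff U k (pdy i f) := by
  intro x hx y hy a ha
  have hay : a • y ≠ 0 := smul_ne_zero ha.ne' hy
  have h1 : DifferentiableAt ℝ (fun z => f x z) (a • y) :=
    DifferentiableAt.comp (a • y) (f := fun z : Vec n => (x, z)) (hf.differentiableAt hU hx hay)
      (by fun_prop)
  have h2 : HasFDerivAt (fun z => f x (a • z)) _ y :=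
    HasFDerivAt.comp y (f := fun z : Vec n => a • z) h1.hasFDerivAt
      ((hasFDerivAt_id y).const_smul a)
  have h3 : (fun z => f x (a • z)) =ᶠ[𝓝 y] fun z => a ^ (k + 1) * f x z := by
    filter_upwards [isOpen_compl_singleton.mem_nhds hy] with z hz using h x hx z hz a ha
  have h4 := congrArg (fun T => T (EuclideanSpace.single i 1)) (h3.fderiv_eq (𝕜 := ℝ))
  have h5 := pdy_const_mul (f := f) (a ^ (k + 1)) i x y
  simp only [h2.fderiv] at h4
  simp only [Finsler.pdy] at h5 ⊢
  rw [h5] at h4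
  simp at h4
  have : a * (fderiv ℝ (fun z => f x z) (a • y)) (EuclideanSpace.single i 1)
    = a * (a ^ k * (fderiv ℝ (fun z => f x z) y) (EuclideanSpace.single i 1)) := by
    rw [h4]; ring
  exact mul_left_cancel₀ ha.ne' this

theorem HomogOff.pdx {k : ℕ} (hU : IsOpen U) (h : HomogOff U k f)
    (i : Fin n) : HomogOff U k (pdx i f) := by
  intro x hx y hy a ha
  have h3 : (fun z => f z (a • y)) =ᶠ[𝓝 x] fun z => a ^ k * f z y := by
    filter_upwards [hU.mem_nhds hx] with z hz using h z hz y hy a ha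
  rw [← pdx_const_mul]
  simp only [Finsler.pdx, h3.fderiv_eq]

/-- Euler's relation. -/
theorem HomogOff.euler {k : ℕ} (hU : IsOpen U) (hf : SmoothOff U f) (h : HomogOff U k f)
    (hx : x ∈ U) (hy : y ≠ 0) : ∑ i, y i * Finsler.pdy i f x y = k * f x y := by
  have h0 := hf.differentiableAt hU hx hy
  have h1 := fderiv_eq_sum h0 0 y
  simp only [PiLp.zero_apply, zero_mul, Finset.sum_const_zero, zero_add] at h1
  rw [← h1]
  have h2 : HasDerivAt (fun a : ℝ => ((x, a • y) : Vec n × Vec n)) (0, (1 : ℝ) • y) 1 :=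
    (hasDerivAt_const _ _).prodMk ((hasDerivAt_id (1 : ℝ)).smul_const y)
  have h3 : HasDerivAt (fun a : ℝ => f x (a • y))
      (fderiv ℝ (fun z : Vec n × Vec n => f z.1 z.2) (x, y) (0, (1 : ℝ) • y)) 1 :=
    HasFDerivAt.comp_hasDerivAt_of_eq (f := fun a : ℝ => ((x, a • y) : Vec n × Vec n)) (1 : ℝ)
      h0.hasFDerivAt h2 (by simp)
  have h4 : HasDerivAt (fun a : ℝ => a ^ k * f x y) (k * f x y) 1 := by
    simpa using (hasDerivAt_pow k (1 : ℝ)).mul_const (f x y)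
  have h5 : (fun a : ℝ => f x (a • y)) =ᶠ[𝓝 1] fun a => a ^ k * f x y := by
    filter_upwards [lt_mem_nhds (zero_lt_one' ℝ)] with a ha using h x hx y hy a ha
  simpa using h3.unique (h4.congr_of_eventuallyEq h5)

end Calculus

end Finsler
end

/-! ### Fundamental tensor, spray and connection coefficients in coordinates -/

noncomputable section

namespace Finsler

variable {n : ℕ}

/-- The properties of a Finsler metric on the domain of a coordinate system. -/
structure IsLocalFinsler (F : Vec n → Vec n → ℝ) (U : Set (Vec n)) : Prop where
  isOpen : IsOpen U
  smooth : SmoothOff U F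
  pos : ∀ x ∈ U, ∀ y ≠ 0, 0 < F x y
  homog : ∀ x ∈ U, ∀ (a : ℝ) (y : Vec n), F x (a • y) = |a| * F x y
  posDef : ∀ x ∈ U, ∀ y ≠ 0, (fundMatrix F x y).PosDef

/-- The momentum `½ ∂F²/∂yⁱ = g_{ij} yʲ`. -/
def momentum (F : Vec n → Vec n → ℝ) (i : Fin n) (x y : Vec n) : ℝ :=
  (1 / 2 : ℝ) * pdy i (fun x y => F x y ^ 2) x y

theorem fundTensor_eq_pdy_momentum (F : Vec n → Vec n → ℝ) (i j : Fin n) (x y : Vec n) :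
    fundTensor F i j x y = pdy i (momentum F j) x y :=
  (pdy_const_mul _ _ _ _).symm

theorem pdy_spray (F : Vec n → Vec n → ℝ) (i j : Fin n) (x y : Vec n) :
    pdy j (spray F i) x y = 2 * nonlinConn F i j x y := by
  simp only [nonlinConn]; ring

namespace IsLocalFinsler

variable {F : Vec n → Vec n → ℝ} {U : Set (Vec n)} {x y : Vec n}

section

variable (h : IsLocalFinsler F U)
include h

theorem smooth_sq : SmoothOff U (fun x y => F x y ^ 2) := by
  simpa only [pow_two] using h.smooth.mul h.smooth

theorem smooth_momentum (i : Fin n) : SmoothOff U (momentum F i) :=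
  (SmoothOff.const U _).mul (h.smooth_sq.pdy h.isOpen i)

theorem smooth_fundTensor (i j : Fin n) : SmoothOff U (fundTensor F i j) :=
  (SmoothOff.const U _).mul ((h.smooth_sq.pdy h.isOpen j).pdy h.isOpen i)

theorem homog_sq : HomogOff U 2 (fun x y => F x y ^ 2) := by
  intro x hx y _ a _
  simp only [h.homog x hx, mul_pow, sq_abs]

theorem homog_momentum (i : Fin n) : HomogOff U 1 (momentum F i) := by
  intro x hx y hy a ha
  simp only [momentum, h.homog_sq.pdy h.isOpen h.smooth_sq i x hx y hy a ha]
  ring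

theorem homog_fundTensor (i j : Fin n) : HomogOff U 0 (fundTensor F i j) := by
  intro x hx y hy a ha
  simp only [fundTensor_eq_pdy_momentum,
    (h.homog_momentum j).pdy h.isOpen (h.smooth_momentum j) i x hx y hy a ha]

theorem fundTensor_symm (hx : x ∈ U) (hy : y ≠ 0) (i j : Fin n) :
    fundTensor F i j x y = fundTensor F j i x y := by
  simp only [fundTensor, pdy_comm h.isOpen h.smooth_sq i j hx hy]

theorem sum_fundTensor (hx : x ∈ U) (hy : y ≠ 0) (i : Fin n) :
    ∑ j, y j * fundTensor F i j x y = momentum F i x y := by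
  have := (h.homog_momentum i).euler h.isOpen (h.smooth_momentum i) hx hy
  simp only [← fundTensor_eq_pdy_momentum] at this
  simp only [h.fundTensor_symm hx hy i]
  simpa using this

theorem sum_momentum (hx : x ∈ U) (hy : y ≠ 0) :
    ∑ i, y i * momentum F i x y = F x y ^ 2 := by
  have := h.homog_sq.euler h.isOpen h.smooth_sq hx hy
  simp only [momentum, mul_left_comm _ (1 / 2 : ℝ), ← Finset.mul_sum, this]
  push_cast; ring

/-- Up to a constant these are third fibre derivatives of `F²`, hence symmetric in all three
indices. Together with degree-zero homogeneity this is what makes the Cartan tensor vanish on `y`.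
-/
theorem pdy_fundTensor_symm (hx : x ∈ U) (hy : y ≠ 0) (i j k : Fin n) :
    pdy k (fundTensor F i j) x y = pdy i (fundTensor F k j) x y := by
  have e : ∀ i j, fundTensor F i j = pdy i (momentum F j) := fun i j => by
    ext x y; exact fundTensor_eq_pdy_momentum F i j x y
  rw [e, e]
  exact pdy_comm h.isOpen (h.smooth_momentum j) k i hx hy

theorem pdy_fundTensor_symm' (hx : x ∈ U) (hy : y ≠ 0) (i j k : Fin n) :
    pdy k (fundTensor F i j) x y = pdy k (fundTensor F j i) x y :=
  pdy_congr (fun _ hx _ hy => h.fundTensor_symm hx hy i j) k hx hy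

theorem pdx_fundTensor_symm (hx : x ∈ U) (hy : y ≠ 0) (i j k : Fin n) :
    pdx k (fundTensor F i j) x y = pdx k (fundTensor F j i) x y :=
  pdx_congr h.isOpen (fun _ hx _ hy => h.fundTensor_symm hx hy i j) k hx hy

theorem sum_pdy_fundTensor (hx : x ∈ U) (hy : y ≠ 0) (i j : Fin n) :
    ∑ k, y k * pdy k (fundTensor F i j) x y = 0 := by
  simpa using (h.homog_fundTensor i j).euler h.isOpen (h.smooth_fundTensor i j) hx hy

theorem sum_pdy_fundTensor' (hx : x ∈ U) (hy : y ≠ 0) (i j : Fin n) :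
    ∑ k, y k * pdy j (fundTensor F i k) x y = 0 := by
  rw [← h.sum_pdy_fundTensor hx hy j i]
  refine Finset.sum_congr rfl fun k _ => ?_
  rw [h.pdy_fundTensor_symm' hx hy i k j, h.pdy_fundTensor_symm hx hy k i j]

theorem sum_pdx_fundTensor (hx : x ∈ U) (hy : y ≠ 0) (i j : Fin n) :
    ∑ k, y k * pdx j (fundTensor F i k) x y = pdx j (momentum F i) x y := by
  rw [← pdx_congr h.isOpen (fun _ hx _ hy => h.sum_fundTensor hx hy i) j hx hy,
    pdx_sum _ h.isOpen (fun k _ => (SmoothOff.coord U k).mul (h.smooth_fundTensor i k)) j hx hy]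
  refine Finset.sum_congr rfl fun k _ => ?_
  rw [pdx_mul h.isOpen (SmoothOff.coord U k) (h.smooth_fundTensor i k) j hx hy, pdx_coord]
  ring

theorem sum_pdx_momentum (hx : x ∈ U) (hy : y ≠ 0) (j : Fin n) :
    ∑ k, y k * pdx j (momentum F k) x y = pdx j (fun x y => F x y ^ 2) x y := by
  rw [← pdx_congr h.isOpen (fun _ hx _ hy => h.sum_momentum hx hy) j hx hy,
    pdx_sum _ h.isOpen (fun k _ => (SmoothOff.coord U k).mul (h.smooth_momentum k)) j hx hy]
  refine Finset.sum_congr rfl fun k _ => ?_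
  rw [pdx_mul h.isOpen (SmoothOff.coord U k) (h.smooth_momentum k) j hx hy, pdx_coord]
  ring

theorem det_ne_zero (hx : x ∈ U) (hy : y ≠ 0) : (fundMatrix F x y).det ≠ 0 :=
  (h.posDef x hx y hy).det_pos.ne'

/-- Lowering an index removes the inverse matrix from the connection coefficients. Identities
between them are proved in lowered form and raised again by `eq_of_fundTensor`. -/
theorem fundTensor_fundInv (hx : x ∈ U) (hy : y ≠ 0) (T : Fin n → ℝ) (i : Fin n) :
    ∑ m, fundTensor F i m x y * ∑ r, fundInv F m r x y * T r = T i := by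
  have := Matrix.mul_nonsing_inv _ (h.det_ne_zero hx hy).isUnit
  have h2 := congrFun (congrArg (Matrix.mulVec · T) this) i
  simp only [← Matrix.mulVec_mulVec, Matrix.one_mulVec] at h2
  simpa [Matrix.mulVec, dotProduct, fundMatrix, fundInv] using h2

theorem eq_of_fundTensor (hx : x ∈ U) (hy : y ≠ 0) {S T : Fin n → ℝ}
    (hST : ∀ i, ∑ m, fundTensor F i m x y * S m = ∑ m, fundTensor F i m x y * T m) : S = T := by
  have hi : Function.Injective (fundMatrix F x y).mulVec :=
    Matrix.mulVec_injective_of_isUnit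
      ((Matrix.isUnit_iff_isUnit_det _).2 (h.det_ne_zero hx hy).isUnit)
  refine hi (funext fun i => ?_)
  simpa [Matrix.mulVec, dotProduct, fundMatrix] using hST i

/-- By Cramer's rule the inverse is the adjugate divided by the determinant, both polynomial in the
entries. -/
theorem smooth_fundInv (i j : Fin n) : SmoothOff U (fundInv F i j) := by
  have hdet : ∀ (A : Vec n → Vec n → Matrix (Fin n) (Fin n) ℝ),
      (∀ i j, SmoothOff U (fun x y => A x y i j)) → SmoothOff U (fun x y => (A x y).det) := by
    intro A hA
    simp only [Matrix.det_apply']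
    exact SmoothOff.sum fun σ _ => (SmoothOff.const U _).mul
      (contDiffOn_prod (f := fun i (z : Vec n × Vec n) => A z.1 z.2 (σ i) i)
        fun i _ => hA (σ i) i)
  have hd := hdet (fundMatrix F) fun i j => h.smooth_fundTensor i j
  have ha : SmoothOff U (fun x y => (fundMatrix F x y).adjugate i j) := by
    simp only [Matrix.adjugate_apply]
    refine hdet _ fun k l => ?_
    by_cases hk : k = j
    · subst hk; simpa using SmoothOff.const U _
    · simpa [Matrix.updateRow_ne hk, fundMatrix] using h.smooth_fundTensor k l
  have hi : SmoothOff U (fun x y => (fundMatrix F x y).det⁻¹) :=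
    ContDiffOn.inv hd fun z hz => h.det_ne_zero hz.1 hz.2
  refine (hi.mul ha).congr fun x _ y _ => ?_
  simp [fundInv, Matrix.inv_def]

theorem smooth_formalChristoffel (i j k : Fin n) : SmoothOff U (formalChristoffel F i j k) :=
  (SmoothOff.const U _).mul <| SmoothOff.sum fun m _ => (h.smooth_fundInv i m).mul
    ((((h.smooth_fundTensor _ _).pdx h.isOpen _).add ((h.smooth_fundTensor _ _).pdx h.isOpen _)).sub
      ((h.smooth_fundTensor _ _).pdx h.isOpen _))

theorem smooth_spray (i : Fin n) : SmoothOff U (spray F i) :=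
  SmoothOff.sum fun k _ => SmoothOff.sum fun l _ =>
    ((h.smooth_formalChristoffel i k l).mul (SmoothOff.coord U k)).mul (SmoothOff.coord U l)

theorem smooth_nonlinConn (i j : Fin n) : SmoothOff U (nonlinConn F i j) :=
  (SmoothOff.const U _).mul ((h.smooth_spray i).pdy h.isOpen j)

/-- The fundamental tensor has degree `0` in `y`, and neither inversion nor `x`-derivatives change
the degree. -/
theorem homog_formalChristoffel (i j k : Fin n) : HomogOff U 0 (formalChristoffel F i j k) := by
  intro x hx y hy a ha
  have e : fundMatrix F x (a • y) = fundMatrix F x y := by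
    ext i j; simpa [fundMatrix] using h.homog_fundTensor i j x hx y hy a ha
  have e2 : ∀ i j k, pdx k (fundTensor F i j) x (a • y) = pdx k (fundTensor F i j) x y :=
    fun i j k => by simpa using (h.homog_fundTensor i j).pdx h.isOpen k x hx y hy a ha
  simp only [formalChristoffel, fundInv, e, e2, pow_zero, one_mul]

theorem homog_spray (i : Fin n) : HomogOff U 2 (spray F i) := by
  intro x hx y hy a ha
  simp only [spray, Finset.mul_sum]
  refine Finset.sum_congr rfl fun k _ => Finset.sum_congr rfl fun l _ => ?_
  rw [h.homog_formalChristoffel i k l x hx y hy a ha]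
  simp; ring

theorem sum_nonlinConn (hx : x ∈ U) (hy : y ≠ 0) (i : Fin n) :
    ∑ j, y j * nonlinConn F i j x y = spray F i x y := by
  have := (h.homog_spray i).euler h.isOpen (h.smooth_spray i) hx hy
  simp only [nonlinConn, mul_left_comm _ (1 / 2 : ℝ), ← Finset.mul_sum, this]
  push_cast; ring

/-- The Euler–Lagrange form of the spray coefficients. -/
theorem sum_fundTensor_spray (hx : x ∈ U) (hy : y ≠ 0) (i : Fin n) :
    ∑ m, fundTensor F i m x y * spray F m x y
      = ∑ k, y k * pdx k (momentum F i) x y - 1 / 2 * pdx i (fun x y => F x y ^ 2) x y := by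
  -- `T` is twice the Christoffel symbol of the first kind. Contracted with `y` twice, its first two
  -- terms agree, and each gives a derivative of the momentum; the third gives the derivative of
  -- `F²`.
  set T : Fin n → Fin n → Fin n → ℝ := fun r k l => pdx k (fundTensor F r l) x y
    + pdx l (fundTensor F k r) x y - pdx r (fundTensor F k l) x y with hT
  have e1 : ∀ m, spray F m x y
      = ∑ r, fundInv F m r x y * (1 / 2 * ∑ k, ∑ l, T r k l * (y k * y l)) := by
    intro m
    simp only [spray, formalChristoffel, Finset.mul_sum, Finset.sum_mul]
    conv_rhs => rw [Finset.sum_comm]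
    refine Finset.sum_congr rfl fun k _ => ?_
    conv_rhs => rw [Finset.sum_comm]
    refine Finset.sum_congr rfl fun l _ => Finset.sum_congr rfl fun r _ => ?_
    simp only [hT]; ring
  simp only [e1, h.fundTensor_fundInv hx hy]
  have a1 : ∑ k, ∑ l, pdx k (fundTensor F i l) x y * (y k * y l)
      = ∑ k, y k * pdx k (momentum F i) x y := by
    refine Finset.sum_congr rfl fun k _ => ?_
    rw [← h.sum_pdx_fundTensor hx hy i k, Finset.mul_sum]
    exact Finset.sum_congr rfl fun l _ => by ring
  have a2 : ∑ k, ∑ l, pdx l (fundTensor F k i) x y * (y k * y l)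
      = ∑ k, y k * pdx k (momentum F i) x y := by
    rw [Finset.sum_comm]
    refine Finset.sum_congr rfl fun k _ => ?_
    rw [← h.sum_pdx_fundTensor hx hy i k, Finset.mul_sum]
    exact Finset.sum_congr rfl fun l _ => by rw [h.pdx_fundTensor_symm hx hy l i]; ring
  have a3 : ∑ k, ∑ l, pdx i (fundTensor F k l) x y * (y k * y l)
      = pdx i (fun x y => F x y ^ 2) x y := by
    rw [← h.sum_pdx_momentum hx hy i]
    refine Finset.sum_congr rfl fun k _ => ?_
    rw [← h.sum_pdx_fundTensor hx hy k i, Finset.mul_sum]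
    exact Finset.sum_congr rfl fun l _ => by ring
  simp only [hT, add_mul, sub_mul, Finset.sum_add_distrib, Finset.sum_sub_distrib, a1, a2, a3]
  ring

/-- This is `sum_fundTensor_spray` differentiated with respect to `y j`, since the fibre derivative
of the spray is twice the nonlinear connection. -/
theorem sum_fundTensor_nonlinConn (hx : x ∈ U) (hy : y ≠ 0) (i j : Fin n) :
    ∑ m, fundTensor F i m x y * nonlinConn F m j x y
      = 1 / 2 * (pdx j (momentum F i) x y + ∑ k, y k * pdx k (fundTensor F i j) x y
        - pdx i (momentum F j) x y - ∑ m, spray F m x y * pdy m (fundTensor F i j) x y) := by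
  have key := pdy_congr (fun _ hx _ hy => h.sum_fundTensor_spray hx hy i) j hx hy
  have s1 := fun m => h.smooth_fundTensor i m
  have s3 := fun k => (h.smooth_momentum i).pdx h.isOpen k
  rw [pdy_sum _ h.isOpen (fun m _ => (s1 m).mul (h.smooth_spray m)) j hx hy,
    pdy_sub h.isOpen (SmoothOff.sum fun k _ => (SmoothOff.coord U k).mul (s3 k))
      ((SmoothOff.const U _).mul (h.smooth_sq.pdx h.isOpen i)) j hx hy,
    pdy_sum _ h.isOpen (fun k _ => (SmoothOff.coord U k).mul (s3 k)) j hx hy,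
    pdy_const_mul, ← pdx_pdy_comm h.isOpen h.smooth_sq i j hx hy, ← pdx_const_mul] at key
  have e1 : ∀ m, pdy j (fun x y => fundTensor F i m x y * spray F m x y) x y
      = spray F m x y * pdy m (fundTensor F i j) x y
        + 2 * (fundTensor F i m x y * nonlinConn F m j x y) := fun m => by
    rw [pdy_mul h.isOpen (s1 m) (h.smooth_spray m) j hx hy, pdy_spray,
      h.pdy_fundTensor_symm' hx hy i m j, h.pdy_fundTensor_symm hx hy m i j,
      h.pdy_fundTensor_symm' hx hy j i m]
    ring
  have e2 : ∀ k, pdy j (fun x y => y k * pdx k (momentum F i) x y) x y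
      = (if k = j then pdx k (momentum F i) x y else 0)
        + y k * pdx k (fundTensor F i j) x y := fun k => by
    have e : ∀ i j, fundTensor F i j = pdy i (momentum F j) := fun i j => by
      ext x y; exact fundTensor_eq_pdy_momentum F i j x y
    rw [pdy_mul h.isOpen (SmoothOff.coord U k) (s3 k) j hx hy, pdy_coord,
      ← pdx_pdy_comm h.isOpen (h.smooth_momentum i) k j hx hy, ← e,
      h.pdx_fundTensor_symm hx hy j i]
    split_ifs <;> ring
  simp only [e1, e2, Finset.sum_add_distrib, ← Finset.mul_sum, Finset.sum_ite_eq',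
    Finset.mem_univ, if_true] at key
  change _ = _ - pdx i (momentum F j) x y at key
  linarith

/-- After lowering an index, the vertical corrections in two of the three horizontal derivatives
vanish, because a fibre derivative of the fundamental tensor contracted with `y` is zero. In the
remaining one `N` contracts with `y` to the spray. What is left is the expression of
`sum_fundTensor_nonlinConn`. -/
theorem sum_cartanL (hx : x ∈ U) (hy : y ≠ 0) (i m : Fin n) :
    ∑ k, cartanL F i m k x y * y k = nonlinConn F i m x y := by
  set T : Fin n → ℝ := fun r => ∑ k, (pdh F m (fundTensor F r k) x y
    + pdh F k (fundTensor F m r) x y - pdh F r (fundTensor F m k) x y) * y k with hT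
  have e1 : ∀ i, ∑ k, cartanL F i m k x y * y k = ∑ r, fundInv F i r x y * (1 / 2 * T r) := by
    intro i
    simp only [cartanL, hT, Finset.mul_sum, Finset.sum_mul]
    conv_rhs => rw [Finset.sum_comm]
    refine Finset.sum_congr rfl fun k _ => Finset.sum_congr rfl fun r _ => ?_
    ring
  refine congrFun (h.eq_of_fundTensor hx hy (S := fun i => ∑ k, cartanL F i m k x y * y k)
    (T := fun i => nonlinConn F i m x y) fun a => ?_) i
  simp only [e1, h.fundTensor_fundInv hx hy, h.sum_fundTensor_nonlinConn hx hy a m]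
  have b1 : ∀ r s, ∑ k, pdh F s (fundTensor F r k) x y * y k = pdx s (momentum F r) x y := by
    intro r s
    simp only [pdh, sub_mul, Finset.sum_sub_distrib]
    rw [← h.sum_pdx_fundTensor hx hy r s]
    have : ∑ k, (∑ j, nonlinConn F j s x y * pdy j (fundTensor F r k) x y) * y k = 0 := by
      simp only [Finset.sum_mul]
      rw [Finset.sum_comm]
      refine Finset.sum_eq_zero fun j _ => ?_
      rw [← mul_zero (nonlinConn F j s x y), ← h.sum_pdy_fundTensor' hx hy r j, Finset.mul_sum]
      exact Finset.sum_congr rfl fun k _ => by ring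
    rw [this, sub_zero]
    exact Finset.sum_congr rfl fun k _ => by ring
  have b2 : ∑ k, pdh F k (fundTensor F m a) x y * y k
      = ∑ k, y k * pdx k (fundTensor F a m) x y
        - ∑ j, spray F j x y * pdy j (fundTensor F a m) x y := by
    simp only [pdh, sub_mul, Finset.sum_sub_distrib]
    congr 1
    · exact Finset.sum_congr rfl fun k _ => by rw [h.pdx_fundTensor_symm hx hy m a]; ring
    · simp only [Finset.sum_mul]
      rw [Finset.sum_comm]
      refine Finset.sum_congr rfl fun j _ => ?_
      rw [← h.sum_nonlinConn hx hy j, Finset.sum_mul, h.pdy_fundTensor_symm' hx hy m a]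
      exact Finset.sum_congr rfl fun k _ => by ring
  simp only [hT, add_mul, sub_mul, Finset.sum_add_distrib, Finset.sum_sub_distrib, b1, b2]
  ring

theorem sum_cartanC (hx : x ∈ U) (hy : y ≠ 0) (i k : Fin n) :
    ∑ m, y m * cartanC F i m k x y = 0 := by
  simp only [cartanC, Finset.mul_sum]
  rw [Finset.sum_comm]
  refine Finset.sum_eq_zero fun r _ => ?_
  have e : ∀ m, y m * (1 / 2 * (fundInv F i r x y * (pdy m (fundTensor F r k) x y
      + pdy k (fundTensor F m r) x y - pdy r (fundTensor F m k) x y)))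
      = 1 / 2 * fundInv F i r x y * (y m * pdy m (fundTensor F r k) x y) := fun m => by
    rw [h.pdy_fundTensor_symm hx hy m r k, h.pdy_fundTensor_symm hx hy m k r,
      h.pdy_fundTensor_symm' hx hy k r m]
    ring
  simp only [e, ← Finset.mul_sum, h.sum_pdy_fundTensor hx hy, mul_zero]

end

end IsLocalFinsler

end Finsler
end

/-! ### Geodesic and Jacobi equations in terms of the spray -/

noncomputable section

namespace Finsler

variable {n : ℕ}

theorem dot_eq_deriv {u : ℝ → Vec n} {t : ℝ} (ht : t ∈ Ioo (0 : ℝ) 1) : dot u t = deriv u t :=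
  derivWithin_of_mem_nhds (Icc_mem_nhds ht.1 ht.2)

theorem dot_congr {u v : ℝ → Vec n} {t : ℝ} (h : u =ᶠ[𝓝 t] v) : dot u t = dot v t :=
  Filter.EventuallyEq.derivWithin_eq (h.filter_mono nhdsWithin_le_nhds) h.self_of_nhds

theorem dot_dot_eq {u : ℝ → Vec n} {t : ℝ} (ht : t ∈ Ioo (0 : ℝ) 1) :
    dot (dot u) t = deriv (deriv u) t := by
  rw [← dot_eq_deriv ht]
  refine dot_congr ?_
  filter_upwards [isOpen_Ioo.mem_nhds ht] with s hs using dot_eq_deriv hs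

/-- The vector with components `Γⁱ_{kl} yᵏ yˡ`. -/
def sprayVec (F : Vec n → Vec n → ℝ) (z : Vec n × Vec n) : Vec n :=
  WithLp.toLp 2 fun i => spray F i z.1 z.2

theorem deriv_apply_coord {u : ℝ → Vec n} {t : ℝ} (hu : DifferentiableAt ℝ u t) (i : Fin n) :
    HasDerivAt (fun t => u t i) (deriv u t i) t :=
  ((EuclideanSpace.proj (𝕜 := ℝ) i).hasFDerivAt.comp_hasDerivAt t hu.hasDerivAt)

theorem hasDerivAt_comp_curve {U : Set (Vec n)} {f : Vec n → Vec n → ℝ} {u w : ℝ → Vec n} {t : ℝ}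
    (hU : IsOpen U) (hf : SmoothOff U f) (hx : u t ∈ U) (hy : w t ≠ 0)
    (hu : DifferentiableAt ℝ u t) (hw : DifferentiableAt ℝ w t) :
    HasDerivAt (fun t => f (u t) (w t))
      (∑ k, deriv u t k * pdx k f (u t) (w t) + ∑ k, deriv w t k * pdy k f (u t) (w t)) t := by
  have h0 := hf.differentiableAt hU hx hy
  rw [← fderiv_eq_sum h0]
  exact HasFDerivAt.comp_hasDerivAt (f := fun t => (u t, w t)) t h0.hasFDerivAt
    (hu.hasDerivAt.prodMk hw.hasDerivAt)

namespace IsLocalFinsler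

variable {F : Vec n → Vec n → ℝ} {U : Set (Vec n)} {x y : Vec n}

theorem contDiffOn_sprayVec (h : IsLocalFinsler F U) :
    ContDiffOn ℝ ∞ (sprayVec F) (U ×ˢ {0}ᶜ) :=
  contDiffOn_piLp' 2 fun i => h.smooth_spray i

theorem fderiv_sprayVec_apply (h : IsLocalFinsler F U) (hx : x ∈ U) (hy : y ≠ 0) (v w : Vec n)
    (i : Fin n) : fderiv ℝ (sprayVec F) (x, y) (v, w) i
      = ∑ k, v k * pdx k (spray F i) x y + ∑ k, w k * pdy k (spray F i) x y := by
  rw [← fderiv_eq_sum ((h.smooth_spray i).differentiableAt h.isOpen hx hy)]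
  have h1 : DifferentiableAt ℝ (sprayVec F) (x, y) :=
    (h.contDiffOn_sprayVec.contDiffAt (x := (x, y)) ((isOpen_slit h.isOpen).mem_nhds ⟨hx, hy⟩)).differentiableAt
      (by simp)
  have h2 : HasFDerivAt (fun z : Vec n × Vec n => spray F i z.1 z.2) _ (x, y) :=
    (EuclideanSpace.proj (𝕜 := ℝ) i).hasFDerivAt.comp (x, y) h1.hasFDerivAt
  rw [h2.fderiv]; rfl

/-- Along a solution of the spray equation the covariant acceleration `ü + N u̇` is zero. The
vertical coefficients therefore drop out, and the horizontal ones contract to `N`. -/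
theorem covDeriv_of_spray (h : IsLocalFinsler F U) {u ξ : ℝ → Vec n} {t : ℝ} (hx : u t ∈ U)
    (hy : dot u t ≠ 0) (hu : dot (dot u) t = -sprayVec F (u t, dot u t)) (i : Fin n) :
    covDeriv F u ξ t i = dot ξ t i + ∑ m, ξ t m * nonlinConn F i m (u t) (dot u t) := by
  have e : ∀ k, dot (dot u) t k + ∑ l, nonlinConn F k l (u t) (dot u t) * dot u t l = 0 := by
    intro k
    rw [hu]
    simp only [mul_comm (nonlinConn F _ _ _ _), h.sum_nonlinConn hx hy, sprayVec, PiLp.neg_apply,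
      neg_add_cancel]
  simp only [covDeriv, e, mul_zero, add_zero, h.sum_cartanL hx hy]

/-- Here the differentiated field is the velocity itself. The vertical term vanishes because `C`
contracted with the velocity is zero, whatever the acceleration is. -/
theorem spray_of_covDeriv (h : IsLocalFinsler F U) {u : ℝ → Vec n} {t : ℝ} (hx : u t ∈ U)
    (hy : dot u t ≠ 0) (hu : covDeriv F u (dot u) t = 0) :
    dot (dot u) t = -sprayVec F (u t, dot u t) := by
  ext i
  have hi := congrArg (· i) hu
  simp only [covDeriv, Finset.sum_add_distrib, h.sum_cartanL hx hy, mul_add, Finset.mul_sum] at hi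
  have e : ∑ m, ∑ k, dot u t m * (cartanC F i m k (u t) (dot u t) *
      (dot (dot u) t k + ∑ l, nonlinConn F k l (u t) (dot u t) * dot u t l)) = 0 := by
    rw [Finset.sum_comm]
    refine Finset.sum_eq_zero fun k _ => ?_
    simp only [← mul_assoc, ← Finset.sum_mul, h.sum_cartanC hx hy, zero_mul]
  simp only [mul_add, Finset.mul_sum, Finset.sum_add_distrib] at e
  simp only [h.sum_nonlinConn hx hy, PiLp.zero_apply] at hi
  simp only [PiLp.neg_apply, sprayVec]
  linarith

/-- In local coordinates the equation of geodesics is `ü + Γ(u, u̇) = 0`, and the equation of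
Jacobi fields is its linearization. -/
theorem linearized_spray (h : IsLocalFinsler F U) {u ξ : ℝ → Vec n} {s : Set ℝ} (hs : IsOpen s)
    (hs01 : s ⊆ Ioo 0 1) (hu : ContDiffOn ℝ ∞ u s) (hξ : ContDiffOn ℝ ∞ ξ s)
    (hx : ∀ t ∈ s, u t ∈ U) (hy : ∀ t ∈ s, deriv u t ≠ 0)
    (hgeo : ∀ t ∈ s, covDeriv F u (dot u) t = 0)
    (hjac : ∀ t ∈ s, covDeriv F u (covDeriv F u ξ) t + curvTerm F u ξ t = 0) {t : ℝ}
    (ht : t ∈ s) :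
    deriv (deriv ξ) t = -fderiv ℝ (sprayVec F) (u t, deriv u t) (ξ t, deriv ξ t) := by
  have hy' : ∀ t ∈ s, dot u t ≠ 0 := fun t ht => by rw [dot_eq_deriv (hs01 ht)]; exact hy t ht
  have hsp : ∀ t ∈ s, dot (dot u) t = -sprayVec F (u t, dot u t) := fun t ht =>
    h.spray_of_covDeriv (hx t ht) (hy' t ht) (hgeo t ht)
  have hu1 : DifferentiableAt ℝ u t :=
    ((hu t ht).contDiffAt (hs.mem_nhds ht)).differentiableAt (by simp)
  have hξ1 : DifferentiableAt ℝ ξ t :=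
    ((hξ t ht).contDiffAt (hs.mem_nhds ht)).differentiableAt (by simp)
  have hu2 : DifferentiableAt ℝ (deriv u) t :=
    (((hu.deriv_of_isOpen hs (m := ∞) (by simp)) t ht).contDiffAt
      (hs.mem_nhds ht)).differentiableAt (by simp)
  have hξ2 : DifferentiableAt ℝ (deriv ξ) t :=
    (((hξ.deriv_of_isOpen hs (m := ∞) (by simp)) t ht).contDiffAt
      (hs.mem_nhds ht)).differentiableAt (by simp)
  have hxt := hx t ht
  have hyt := hy t ht
  have hdd : deriv (deriv u) t = -sprayVec F (u t, deriv u t) := by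
    rw [← dot_dot_eq (hs01 ht), hsp t ht, dot_eq_deriv (hs01 ht)]
  ext i
  have hcov : (fun t => covDeriv F u ξ t i) =ᶠ[𝓝 t]
      fun t => deriv ξ t i + ∑ m, ξ t m * nonlinConn F i m (u t) (deriv u t) := by
    filter_upwards [hs.mem_nhds ht] with r hr
    rw [h.covDeriv_of_spray (hx r hr) (hy' r hr) (hsp r hr), dot_eq_deriv (hs01 hr),
      dot_eq_deriv (hs01 hr)]
  have hcovv : covDeriv F u ξ =ᶠ[𝓝 t] fun t => WithLp.toLp 2 fun i =>
      deriv ξ t i + ∑ m, ξ t m * nonlinConn F i m (u t) (deriv u t) := by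
    filter_upwards [hs.mem_nhds ht] with r hr
    ext i
    rw [h.covDeriv_of_spray (hx r hr) (hy' r hr) (hsp r hr), dot_eq_deriv (hs01 hr),
      dot_eq_deriv (hs01 hr)]
  have hder : ∀ i, HasDerivAt (fun t => deriv ξ t i
      + ∑ m, ξ t m * nonlinConn F i m (u t) (deriv u t))
      (deriv (deriv ξ) t i + ∑ m, (deriv ξ t m * nonlinConn F i m (u t) (deriv u t)
        + ξ t m * (∑ k, deriv u t k * pdx k (nonlinConn F i m) (u t) (deriv u t)
          + ∑ k, deriv (deriv u) t k * pdy k (nonlinConn F i m) (u t) (deriv u t)))) t := by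
    intro i
    refine (deriv_apply_coord hξ2 i).add (HasDerivAt.fun_sum fun m _ => ?_)
    exact (deriv_apply_coord hξ1 m).mul
      (hasDerivAt_comp_curve h.isOpen (h.smooth_nonlinConn i m) hxt hyt hu1 hu2)
  have hdot : dot (covDeriv F u ξ) t i = deriv (deriv ξ) t i
      + ∑ m, (deriv ξ t m * nonlinConn F i m (u t) (deriv u t)
        + ξ t m * (∑ k, deriv u t k * pdx k (nonlinConn F i m) (u t) (deriv u t)
          + ∑ k, deriv (deriv u) t k * pdy k (nonlinConn F i m) (u t) (deriv u t))) := by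
    have hd : DifferentiableAt ℝ (covDeriv F u ξ) t := by
      refine DifferentiableAt.congr_of_eventuallyEq ?_ hcovv
      exact (differentiableAt_piLp (𝕜 := ℝ) 2).2 fun i => (hder i).differentiableAt
    rw [dot_eq_deriv (hs01 ht)]
    exact (deriv_apply_coord hd i).unique ((hder i).congr_of_eventuallyEq hcov)
  have hj := congrArg (· i) (hjac t ht)
  simp only [PiLp.add_apply, PiLp.zero_apply] at hj
  rw [h.covDeriv_of_spray hxt (hy' t ht) (hsp t ht), hdot] at hj
  simp only [curvTerm, dot_eq_deriv (hs01 ht)] at hj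
  have hcv : ∀ m, covDeriv F u ξ t m
      = deriv ξ t m + ∑ k, ξ t k * nonlinConn F m k (u t) (deriv u t) := fun m => by
    rw [h.covDeriv_of_spray hxt (hy' t ht) (hsp t ht), dot_eq_deriv (hs01 ht),
      dot_eq_deriv (hs01 ht)]
  simp only [hcv, hdd, PiLp.neg_apply, sprayVec] at hj
  simp only [PiLp.neg_apply, h.fderiv_sprayVec_apply hxt hyt]
  set x := u t
  set y := deriv u t
  set a := ξ t
  set b := deriv ξ t
  have hN : ∀ i m, ∑ k, y k * pdx m (nonlinConn F i k) x y = pdx m (spray F i) x y := by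
    intro i m
    rw [← pdx_congr h.isOpen (fun _ hx _ hy => h.sum_nonlinConn hx hy i) m hxt hyt,
      pdx_sum _ h.isOpen (fun k _ => (SmoothOff.coord U k).mul (h.smooth_nonlinConn i k)) m hxt hyt]
    refine Finset.sum_congr rfl fun k _ => ?_
    rw [pdx_mul h.isOpen (SmoothOff.coord U k) (h.smooth_nonlinConn i k) m hxt hyt, pdx_coord]
    ring
  -- Differentiate `N y = Γ` in `y m`: the right side gives `2 N`, and one `N` comes from
  -- differentiating the factor `y`.
  have hN2 : ∀ m, ∑ k, y k * pdy m (nonlinConn F i k) x y = nonlinConn F i m x y := by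
    intro m
    have := pdy_congr (fun _ hx _ hy => h.sum_nonlinConn hx hy i) m hxt hyt
    rw [pdy_sum _ h.isOpen (fun k _ => (SmoothOff.coord U k).mul (h.smooth_nonlinConn i k)) m
      hxt hyt, pdy_spray] at this
    have e : ∀ k, pdy m (fun x y => y k * nonlinConn F i k x y) x y
      = (if k = m then nonlinConn F i k x y else 0) + y k * pdy m (nonlinConn F i k) x y := by
      intro k
      rw [pdy_mul h.isOpen (SmoothOff.coord U k) (h.smooth_nonlinConn i k) m hxt hyt, pdy_coord]
      split_ifs <;> ring
    simp only [e, Finset.sum_add_distrib, Finset.sum_ite_eq', Finset.mem_univ, if_true] at this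
    linarith
  -- The second sum is `ξ` times the derivative of `N` along the geodesic, whose acceleration is
  -- minus the spray. It cancels the derivative of `N` produced by the outer covariant derivative,
  -- while the products `N N` cancel those produced by its connection term (`hNN`). There remains
  -- `ξ̈ + 2 N ξ̇ + (∂Γ/∂x) ξ = 0`.
  have hcurv : ∑ j, ∑ k, hCurvature F i j k x y * y j * a k
      = ∑ k, a k * (pdx k (spray F i) x y - ∑ l, nonlinConn F l k x y * nonlinConn F i l x y)
        - ∑ m, a m * (∑ k, y k * pdx k (nonlinConn F i m) x y
          - ∑ l, spray F l x y * pdy l (nonlinConn F i m) x y) := by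
    rw [Finset.sum_comm, ← Finset.sum_sub_distrib]
    refine Finset.sum_congr rfl fun k _ => ?_
    have e1 : ∑ j, hCurvature F i j k x y * y j * a k
        = a k * (∑ j, y j * pdh F k (nonlinConn F i j) x y)
          - a k * ∑ j, y j * pdh F j (nonlinConn F i k) x y := by
      simp only [hCurvature, Finset.mul_sum, ← Finset.sum_sub_distrib]
      exact Finset.sum_congr rfl fun j _ => by ring
    have e2 : ∑ j, y j * pdh F k (nonlinConn F i j) x y
        = pdx k (spray F i) x y - ∑ l, nonlinConn F l k x y * nonlinConn F i l x y := by
      simp only [pdh, mul_sub, Finset.sum_sub_distrib, hN, Finset.mul_sum]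
      rw [Finset.sum_comm]
      congr 1
      refine Finset.sum_congr rfl fun l _ => ?_
      rw [← hN2, Finset.mul_sum]
      exact Finset.sum_congr rfl fun j _ => by ring
    have e3 : ∑ j, y j * pdh F j (nonlinConn F i k) x y
        = ∑ j, y j * pdx j (nonlinConn F i k) x y
          - ∑ l, spray F l x y * pdy l (nonlinConn F i k) x y := by
      simp only [pdh, mul_sub, Finset.sum_sub_distrib, Finset.mul_sum]
      rw [Finset.sum_comm]
      congr 1
      refine Finset.sum_congr rfl fun l _ => ?_
      rw [← h.sum_nonlinConn hxt hyt l, Finset.sum_mul]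
      exact Finset.sum_congr rfl fun j _ => by ring
    rw [e1, e2, e3]
  rw [hcurv] at hj
  have hNN : ∑ m, (∑ k, a k * nonlinConn F m k x y) * nonlinConn F i m x y
      = ∑ k, a k * ∑ l, nonlinConn F l k x y * nonlinConn F i l x y := by
    simp only [Finset.sum_mul, Finset.mul_sum]
    rw [Finset.sum_comm]
    exact Finset.sum_congr rfl fun k _ => Finset.sum_congr rfl fun l _ => by ring
  have hbN : ∑ k, b k * pdy k (spray F i) x y = 2 * ∑ k, b k * nonlinConn F i k x y := by
    rw [Finset.mul_sum]
    exact Finset.sum_congr rfl fun k _ => by rw [pdy_spray]; ring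
  simp only [add_mul, mul_sub, mul_add, neg_mul, Finset.sum_add_distrib, Finset.sum_sub_distrib,
    Finset.sum_neg_distrib, mul_neg, hNN] at hj
  rw [hbN]
  linarith

end IsLocalFinsler

end Finsler
end

/-! ### The Lagrangian of the p-energy: Euler–Lagrange equation and fibre Hessian -/

noncomputable section

namespace Finsler

variable {n : ℕ}

theorem fderiv_rpow {E : Type*} [NormedAddCommGroup E] [NormedSpace ℝ E] {f : E → ℝ}
    {z : E} (hf : DifferentiableAt ℝ f z) (hpos : 0 < f z) (q : ℝ) :
    fderiv ℝ (fun z => f z ^ q) z = (q * f z ^ (q - 1)) • fderiv ℝ f z :=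
  (hf.hasFDerivAt.rpow_const (Or.inl hpos.ne')).fderiv

/-- The second derivative of a power of a positive function. -/
theorem fderiv_fderiv_rpow {E : Type*} [NormedAddCommGroup E] [NormedSpace ℝ E] {f : E → ℝ}
    {z : E} (hf : ContDiffAt ℝ ∞ f z) (hpos : 0 < f z) (q : ℝ) (v w : E) :
    fderiv ℝ (fderiv ℝ (fun z => f z ^ q)) z v w
      = q * f z ^ (q - 1) * fderiv ℝ (fderiv ℝ f) z v w
        + q * (q - 1) * f z ^ (q - 2) * (fderiv ℝ f z v * fderiv ℝ f z w) := by
  have hd : (fderiv ℝ fun z => f z ^ q) =ᶠ[𝓝 z] fun z => (q * f z ^ (q - 1)) • fderiv ℝ f z := by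
    filter_upwards [(hf.of_le (m := 1) (by simp)).eventually (by simp),
      hf.continuousAt.eventually (lt_mem_nhds hpos)] with z h1 h2
    exact fderiv_rpow (h1.differentiableAt (by simp)) h2 q
  have h1 : DifferentiableAt ℝ f z := hf.differentiableAt (by simp)
  have h2 : DifferentiableAt ℝ (fderiv ℝ f) z :=
    (hf.fderiv_right (m := ∞) (by simp)).differentiableAt (by simp)
  have h3 := ((h1.hasFDerivAt.rpow_const (p := q - 1) (Or.inl hpos.ne')).const_mul q).fun_smul
    h2.hasFDerivAt
  rw [hd.fderiv_eq, h3.fderiv]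
  simp only [add_apply, smul_apply, ContinuousLinearMap.smulRight_apply, smul_eq_mul]
  rw [show q - 1 - 1 = q - 2 by ring]
  ring

/-- The Lagrangian `Fᵖ` of the `p`-energy. -/
def lagrangian (F : Vec n → Vec n → ℝ) (p : ℝ) (z : Vec n × Vec n) : ℝ := F z.1 z.2 ^ p

namespace IsLocalFinsler

variable {F : Vec n → Vec n → ℝ} {U : Set (Vec n)} {x y : Vec n}

section

variable (h : IsLocalFinsler F U) (p : ℝ)
include h

theorem contDiffOn_lagrangian : ContDiffOn ℝ ∞ (lagrangian F p) (U ×ˢ {0}ᶜ) :=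
  ContDiffOn.rpow_const_of_ne h.smooth fun z hz => (h.pos z.1 hz.1 z.2 hz.2).ne'

theorem contDiffAt_lagrangian (hx : x ∈ U) (hy : y ≠ 0) :
    ContDiffAt ℝ ∞ (lagrangian F p) (x, y) :=
  (h.contDiffOn_lagrangian p).contDiffAt (x := (x, y))
    ((isOpen_slit h.isOpen).mem_nhds ⟨hx, hy⟩)

/-- The fibre derivatives of `F²` are the momentum and the fundamental tensor, up to a factor `2`,
so derivatives of `F ^ p` are computed through the power `p / 2` of `F²`. -/
theorem lagrangian_eventuallyEq (hx : x ∈ U) (hy : y ≠ 0) :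
    lagrangian F p =ᶠ[𝓝 (x, y)] fun z => (F z.1 z.2 ^ 2) ^ (p / 2) := by
  filter_upwards [(isOpen_slit h.isOpen).mem_nhds (⟨hx, hy⟩ : (x, y) ∈ U ×ˢ ({0}ᶜ : Set (Vec n)))]
    with z hz
  rw [lagrangian, ← Real.rpow_natCast, ← Real.rpow_mul (h.pos _ hz.1 _ hz.2).le]
  congr 1; push_cast; ring

theorem fderiv_fderiv_sq (hx : x ∈ U) (hy : y ≠ 0) (v w e : Vec n) :
    fderiv ℝ (fderiv ℝ (fun z : Vec n × Vec n => F z.1 z.2 ^ 2)) (x, y) (v, w) (0, e)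
      = 2 * ∑ i, e i * (∑ k, v k * pdx k (momentum F i) x y
        + ∑ k, w k * fundTensor F k i x y) := by
  have hc := h.smooth_sq.contDiffAt h.isOpen hx hy
  have e1 : (fun z : Vec n × Vec n => fderiv ℝ (fun z : Vec n × Vec n => F z.1 z.2 ^ 2) z (0, e))
      =ᶠ[𝓝 (x, y)] fun z => 2 * ∑ i, e i * momentum F i z.1 z.2 := by
    filter_upwards [(isOpen_slit h.isOpen).mem_nhds
      (⟨hx, hy⟩ : (x, y) ∈ U ×ˢ ({0}ᶜ : Set (Vec n)))] with z hz
    have := fderiv_eq_sum (h.smooth_sq.differentiableAt h.isOpen hz.1 hz.2) 0 e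
    simp only [PiLp.zero_apply, zero_mul, Finset.sum_const_zero, zero_add] at this
    rw [this, Finset.mul_sum]
    exact Finset.sum_congr rfl fun i _ => by simp only [momentum]; ring
  have hs : SmoothOff U (fun x y => ∑ i, e i * momentum F i x y) :=
    SmoothOff.sum fun i _ => (SmoothOff.const U _).mul (h.smooth_momentum i)
  rw [← fderiv_fderiv_apply hc, e1.fderiv_eq,
    fderiv_const_mul (hs.differentiableAt h.isOpen hx hy), smul_apply, smul_eq_mul,
    fderiv_eq_sum (hs.differentiableAt h.isOpen hx hy)]
  congr 1
  have e2 : ∀ k, pdx k (fun x y => ∑ i, e i * momentum F i x y) x y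
      = ∑ i, e i * pdx k (momentum F i) x y := fun k => by
    rw [pdx_sum _ h.isOpen (fun i _ => (SmoothOff.const U _).mul (h.smooth_momentum i)) k hx hy]
    simp only [pdx_const_mul]
  have e3 : ∀ k, pdy k (fun x y => ∑ i, e i * momentum F i x y) x y
      = ∑ i, e i * fundTensor F k i x y := fun k => by
    rw [pdy_sum _ h.isOpen (fun i _ => (SmoothOff.const U _).mul (h.smooth_momentum i)) k hx hy]
    simp only [pdy_const_mul, fundTensor_eq_pdy_momentum]
  simp only [e2, e3, Finset.mul_sum, mul_add, Finset.sum_add_distrib]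
  congr 1 <;> rw [Finset.sum_comm] <;>
    exact Finset.sum_congr rfl fun i _ => Finset.sum_congr rfl fun k _ => by ring

theorem fderiv_sq (hx : x ∈ U) (hy : y ≠ 0) (e : Vec n) :
    fderiv ℝ (fun z : Vec n × Vec n => F z.1 z.2 ^ 2) (x, y) (0, e)
      = 2 * ∑ i, e i * momentum F i x y := by
  have := fderiv_eq_sum (h.smooth_sq.differentiableAt h.isOpen hx hy) 0 e
  simp only [PiLp.zero_apply, zero_mul, Finset.sum_const_zero, zero_add] at this
  rw [this, Finset.mul_sum]
  exact Finset.sum_congr rfl fun i _ => by simp only [momentum]; ring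

/-- This is `sum_fundTensor_spray` contracted with `e`: the lowered spray is the Euler–Lagrange
expression of `F²`. -/
theorem euler_lagrange_sq (hx : x ∈ U) (hy : y ≠ 0) (e : Vec n) :
    fderiv ℝ (fderiv ℝ (fun z : Vec n × Vec n => F z.1 z.2 ^ 2)) (x, y)
        (y, -sprayVec F (x, y)) (0, e)
      = fderiv ℝ (fun z : Vec n × Vec n => F z.1 z.2 ^ 2) (x, y) (e, 0) := by
  have h1 := fderiv_eq_sum (h.smooth_sq.differentiableAt h.isOpen hx hy) e 0
  simp only [PiLp.zero_apply, zero_mul, Finset.sum_const_zero, add_zero] at h1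
  rw [h1, h.fderiv_fderiv_sq hx hy, Finset.mul_sum]
  refine Finset.sum_congr rfl fun i _ => ?_
  have h2 := h.sum_fundTensor_spray hx hy i
  have h3 : ∑ k, (-sprayVec F (x, y)) k * fundTensor F k i x y
      = - ∑ m, fundTensor F i m x y * spray F m x y := by
    rw [← Finset.sum_neg_distrib]
    refine Finset.sum_congr rfl fun k _ => ?_
    simp only [sprayVec, PiLp.neg_apply, h.fundTensor_symm hx hy k i]; ring
  rw [h3, h2]; ring

/-- Conservation of speed. Contracting the Euler–Lagrange identity with `y`, Euler's relation turns
both sides into multiples of the derivative of `F²` in the direction `(y, 0)`. -/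
theorem fderiv_sq_spray (hx : x ∈ U) (hy : y ≠ 0) :
    fderiv ℝ (fun z : Vec n × Vec n => F z.1 z.2 ^ 2) (x, y) (y, -sprayVec F (x, y)) = 0 := by
  have h1 := fderiv_eq_sum (h.smooth_sq.differentiableAt h.isOpen hx hy) y 0
  simp only [PiLp.zero_apply, zero_mul, Finset.sum_const_zero, add_zero] at h1
  have h0 : ((y, -sprayVec F (x, y)) : Vec n × Vec n) = (y, 0) - (0, sprayVec F (x, y)) := by simp
  rw [h0, map_sub, h1, h.fderiv_sq hx hy]
  have h2 : ∑ i, y i * ∑ m, fundTensor F i m x y * spray F m x y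
      = ∑ i, sprayVec F (x, y) i * momentum F i x y := by
    simp only [Finset.mul_sum]
    rw [Finset.sum_comm]
    refine Finset.sum_congr rfl fun m _ => ?_
    rw [← h.sum_fundTensor hx hy m, Finset.mul_sum]
    exact Finset.sum_congr rfl fun i _ => by
      rw [h.fundTensor_symm hx hy m i]; simp only [sprayVec]; ring
  have h3 : ∑ i, y i * ∑ k, y k * pdx k (momentum F i) x y
      = ∑ k, y k * pdx k (fun x y => F x y ^ 2) x y := by
    simp only [Finset.mul_sum]
    rw [Finset.sum_comm]
    refine Finset.sum_congr rfl fun m _ => ?_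
    rw [← h.sum_pdx_momentum hx hy m, Finset.mul_sum]
    exact Finset.sum_congr rfl fun i _ => by ring
  rw [← h2]
  simp only [h.sum_fundTensor_spray hx hy, mul_sub, Finset.sum_sub_distrib, h3]
  simp only [mul_left_comm _ (1 / 2 : ℝ), ← Finset.mul_sum]
  ring

/-- The integral curves of the spray satisfy the Euler–Lagrange equation of `Fᵖ`. -/
theorem euler_lagrange (hx : x ∈ U) (hy : y ≠ 0) (e : Vec n) :
    fderiv ℝ (fderiv ℝ (lagrangian F p)) (x, y) (y, -sprayVec F (x, y)) (0, e)
      = fderiv ℝ (lagrangian F p) (x, y) (e, 0) := by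
  have hc := h.smooth_sq.contDiffAt h.isOpen hx hy
  have hpos : 0 < F x y ^ 2 := pow_pos (h.pos x hx y hy) 2
  have he := h.lagrangian_eventuallyEq p hx hy
  -- Passing from `F²` to its power multiplies the Euler–Lagrange equation by a common factor. The
  -- extra term contains the derivative of `F²` along the spray and vanishes by conservation of
  -- speed.
  rw [he.fderiv.fderiv_eq, he.fderiv_eq, fderiv_fderiv_rpow hc hpos,
    fderiv_rpow (hc.differentiableAt (by simp)) hpos, h.euler_lagrange_sq hx hy,
    h.fderiv_sq_spray hx hy]
  simp

theorem fderiv_fderiv_lagrangian (hx : x ∈ U) (hy : y ≠ 0) (e : Vec n) :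
    fderiv ℝ (fderiv ℝ (lagrangian F p)) (x, y) (0, e) (0, e)
      = p * (F x y ^ 2) ^ (p / 2 - 2) * (F x y ^ 2 * ∑ i, e i * ∑ j, e j * fundTensor F i j x y
        + (p - 2) * (∑ i, e i * momentum F i x y) ^ 2) := by
  have hc := h.smooth_sq.contDiffAt h.isOpen hx hy
  have hpos : 0 < F x y ^ 2 := pow_pos (h.pos x hx y hy) 2
  have he := h.lagrangian_eventuallyEq p hx hy
  rw [he.fderiv.fderiv_eq, fderiv_fderiv_rpow hc hpos, h.fderiv_fderiv_sq hx hy,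
    h.fderiv_sq hx hy]
  simp only [PiLp.zero_apply, zero_mul, Finset.sum_const_zero, zero_add]
  rw [show (F x y ^ 2) ^ (p / 2 - 1) = (F x y ^ 2) ^ (p / 2 - 2) * F x y ^ 2 by
    rw [← Real.rpow_add_one hpos.ne']; congr 1; ring]
  have : ∀ i, ∑ k, e k * fundTensor F k i x y = ∑ k, e k * fundTensor F i k x y := fun i =>
    Finset.sum_congr rfl fun k _ => by rw [h.fundTensor_symm hx hy k i]
  simp only [this]
  ring

theorem fundTensor_pos (hx : x ∈ U) (hy : y ≠ 0) {e : Vec n} (he : e ≠ 0) :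
    0 < ∑ i, e i * ∑ j, e j * fundTensor F i j x y := by
  have := (h.posDef x hx y hy).re_dotProduct_pos (x := e.ofLp) (by simpa using he)
  simpa [dotProduct, Matrix.mulVec, fundMatrix, mul_comm] using this

theorem legendre_tangent (hx : x ∈ U) (hy : y ≠ 0) :
    fderiv ℝ (fderiv ℝ (lagrangian F p)) (x, y) (0, y) (0, y)
      = p * (p - 1) * F x y ^ p := by
  have hpos : 0 < F x y := h.pos x hx y hy
  rw [h.fderiv_fderiv_lagrangian p hx hy]
  simp only [h.sum_fundTensor hx hy, h.sum_momentum hx hy]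
  have : F x y ^ p = (F x y ^ 2) ^ (p / 2 - 2) * (F x y ^ 2) ^ 2 := by
    rw [← Real.rpow_natCast (F x y ^ 2) 2, ← Real.rpow_add (pow_pos hpos 2),
      ← Real.rpow_natCast (F x y) 2, ← Real.rpow_mul hpos.le]
    congr 1; push_cast; ring
  rw [this]; ring

/-- The vectors `g`-orthogonal to `y` form the kernel of the momentum, which is nonzero for
dimensional reasons. On it the rank-one term of the Hessian is zero. -/
theorem exists_legendre_normal (hn : 2 ≤ n) (hx : x ∈ U) (hy : y ≠ 0) :
    ∃ e : Vec n, ∃ a : ℝ, 0 < a ∧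
      fderiv ℝ (fderiv ℝ (lagrangian F p)) (x, y) (0, e) (0, e) = p * a := by
  have hpos : 0 < F x y := h.pos x hx y hy
  let T : Vec n →ₗ[ℝ] ℝ := ∑ i, momentum F i x y • (EuclideanSpace.proj (𝕜 := ℝ) i).toLinearMap
  have hT : LinearMap.ker T ≠ ⊥ := LinearMap.ker_ne_bot_of_finrank_lt (by simp; omega)
  obtain ⟨e, he, he0⟩ := (Submodule.ne_bot_iff _).1 hT
  have hTe : ∑ i, e i * momentum F i x y = 0 := by
    simpa [T, mul_comm] using he
  refine ⟨e, (F x y ^ 2) ^ (p / 2 - 2) * (F x y ^ 2 * ∑ i, e i * ∑ j, e j * fundTensor F i j x y),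
    mul_pos (Real.rpow_pos_of_pos (pow_pos hpos 2) _)
      (mul_pos (pow_pos hpos 2) (h.fundTensor_pos hx hy he0)), ?_⟩
  rw [h.fderiv_fderiv_lagrangian p hx hy, hTe]
  ring

/-- Cauchy–Schwarz for `g(x, y)` and the pair `y`, `e`, since the momentum paired with `e` is `g(y,
e)` and `g(y, y) = F²`. -/
theorem momentum_sq_le (hx : x ∈ U) (hy : y ≠ 0) (e : Vec n) :
    (∑ i, e i * momentum F i x y) ^ 2
      ≤ F x y ^ 2 * ∑ i, e i * ∑ j, e j * fundTensor F i j x y := by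
  have hpos : 0 < F x y ^ 2 := pow_pos (h.pos x hx y hy) 2
  set m := ∑ i, e i * momentum F i x y with hm
  set A := F x y ^ 2
  -- The vector `A e - m y` is `A` times the component of `e` orthogonal to `y`. Its square is `A (A
  -- g(e,e) - m²)`.
  have hw : 0 ≤ ∑ i, (A • e - m • y) i * ∑ j, (A • e - m • y) j * fundTensor F i j x y := by
    by_cases h0 : A • e - m • y = 0
    · simp [h0]
    · exact (h.fundTensor_pos hx hy h0).le
  have e1 : ∀ i, ∑ j, (A • e - m • y) j * fundTensor F i j x y
      = A * ∑ j, e j * fundTensor F i j x y - m * momentum F i x y := fun i => by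
    rw [← h.sum_fundTensor hx hy i, Finset.mul_sum, Finset.mul_sum, ← Finset.sum_sub_distrib]
    exact Finset.sum_congr rfl fun j _ => by simp; ring
  have e2 : ∑ i, y i * ∑ j, e j * fundTensor F i j x y = m := by
    simp only [Finset.mul_sum]
    rw [Finset.sum_comm, hm]
    refine Finset.sum_congr rfl fun j _ => ?_
    rw [← h.sum_fundTensor hx hy j, Finset.mul_sum]
    exact Finset.sum_congr rfl fun i _ => by rw [h.fundTensor_symm hx hy i j]; ring
  have e3 := h.sum_momentum hx hy
  have e4 : ∑ i, (A • e - m • y) i * ∑ j, (A • e - m • y) j * fundTensor F i j x y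
      = A * (A * ∑ i, e i * ∑ j, e j * fundTensor F i j x y) - A * m * m - m * A * m
        + m * m * A := by
    simp only [e1]
    have : ∀ i, (A • e - m • y) i * (A * ∑ j, e j * fundTensor F i j x y - m * momentum F i x y)
      = A * A * (e i * ∑ j, e j * fundTensor F i j x y) - A * m * (e i * momentum F i x y)
        - m * A * (y i * ∑ j, e j * fundTensor F i j x y) + m * m * (y i * momentum F i x y) :=
      fun i => by simp; ring
    simp only [this, Finset.sum_add_distrib, Finset.sum_sub_distrib, ← Finset.mul_sum, e2, e3,
      ← hm]
    ring
  rw [e4] at hw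
  have : 0 ≤ A * (A * (∑ i, e i * ∑ j, e j * fundTensor F i j x y) - m ^ 2) := by linarith
  linarith [nonneg_of_mul_nonneg_right this hpos]

/-- For `p > 1` the Lagrangian `Fᵖ` is strongly convex in the direction. -/
theorem legendre_pos {p : ℝ} (hp : 1 < p) (hx : x ∈ U) (hy : y ≠ 0) {e : Vec n} (he : e ≠ 0) :
    0 < fderiv ℝ (fderiv ℝ (lagrangian F p)) (x, y) (0, e) (0, e) := by
  have hpos : 0 < F x y ^ 2 := pow_pos (h.pos x hx y hy) 2
  rw [h.fderiv_fderiv_lagrangian p hx hy]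
  have h1 := mul_pos hpos (h.fundTensor_pos hx hy he)
  have h2 := h.momentum_sq_le hx hy e
  refine mul_pos (mul_pos (by linarith) (Real.rpow_pos_of_pos hpos _)) ?_
  -- The bracket equals `(F² g(e,e) - m²) + (p - 1) m²` with `m = g(y,e)`. Both summands are
  -- nonnegative, and they cannot vanish together since `F² g(e,e) > 0`.
  nlinarith [sq_nonneg (∑ i, e i * momentum F i x y), mul_pos (sub_pos.2 hp) h1,
    mul_nonneg (sub_pos.2 hp).le (sq_nonneg (∑ i, e i * momentum F i x y))]

end

end IsLocalFinsler

end Finsler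
end

/-! ### Second-order conditions and differentiation under the integral -/

noncomputable section

namespace Finsler

/-- If the second derivative were negative, the strict test would make the point a local maximum as
well. The function would then be locally constant, with zero second derivative. -/
theorem IsLocalMin.deriv_deriv_nonneg {f : ℝ → ℝ} {a : ℝ} (hf : IsLocalMin f a)
    (hc : ContinuousAt f a) : 0 ≤ deriv (deriv f) a := by
  by_contra! hneg
  have hmax := isLocalMax_of_deriv_deriv_neg hneg hf.deriv_eq_zero hc
  have hconst : f =ᶠ[𝓝 a] fun _ => f a := by
    filter_upwards [hf, hmax] with x h1 h2 using le_antisymm h2 h1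
  have := hconst.deriv.deriv_eq
  simp [this] at hneg

theorem IsLocalMax.deriv_deriv_nonpos {f : ℝ → ℝ} {a : ℝ} (hf : IsLocalMax f a)
    (hc : ContinuousAt f a) : deriv (deriv f) a ≤ 0 := by
  by_contra! hpos
  have hmin := isLocalMin_of_deriv_deriv_pos hpos hf.deriv_eq_zero hc
  have hconst : f =ᶠ[𝓝 a] fun _ => f a := by
    filter_upwards [hf, hmin] with x h1 h2 using le_antisymm h1 h2
  have := hconst.deriv.deriv_eq
  simp [this] at hpos

/-- The slab `(-ε, ε) × [a, b]`. -/
def slab (ε a b : ℝ) : Set (ℝ × ℝ) := Ioo (-ε) ε ×ˢ Icc a b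

theorem continuousOn_slab_section {E : Type*} [TopologicalSpace E] {f : ℝ → ℝ → E} {ε a b s : ℝ}
    (hf : ContinuousOn (fun z : ℝ × ℝ => f z.1 z.2) (slab ε a b)) (hs : s ∈ Ioo (-ε) ε) :
    ContinuousOn (f s) (Icc a b) :=
  hf.comp (f := fun t => ((s, t) : ℝ × ℝ)) (by fun_prop) fun _ ht => ⟨hs, ht⟩

theorem intervalIntegrable_slab_section {E : Type*} [NormedAddCommGroup E]
    {f : ℝ → ℝ → E} {ε a b s : ℝ} (hab : a < b)
    (hf : ContinuousOn (fun z : ℝ × ℝ => f z.1 z.2) (slab ε a b)) (hs : s ∈ Ioo (-ε) ε) :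
    IntervalIntegrable (f s) MeasureTheory.volume a b := by
  refine ContinuousOn.intervalIntegrable ?_
  rw [uIcc_of_le hab.le]
  exact continuousOn_slab_section hf hs

section Slab

variable {E : Type*} [NormedAddCommGroup E] [NormedSpace ℝ E]

/-- The time interval is closed, so time derivatives are one-sided at its ends. The open set `O`
will be the region where a given chart applies. -/
theorem uniqueDiffOn_slab_inter (ε : ℝ) {a b : ℝ} (hab : a < b) {O : Set (ℝ × ℝ)}
    (hO : IsOpen O) : UniqueDiffOn ℝ (slab ε a b ∩ O) :=
  (isOpen_Ioo.uniqueDiffOn.prod (uniqueDiffOn_Icc hab)).inter hO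

theorem slab_mono {ε ε' a b : ℝ} (h : ε' ≤ ε) : slab ε' a b ⊆ slab ε a b :=
  prod_mono (Ioo_subset_Ioo (by linarith) h) le_rfl

variable {f : ℝ → ℝ → E} {ε a b s t : ℝ} {O : Set (ℝ × ℝ)}

theorem hasDerivAt_slab_fst (hO : IsOpen O)
    (hf : DifferentiableWithinAt ℝ (fun z : ℝ × ℝ => f z.1 z.2) (slab ε a b ∩ O) (s, t))
    (hst : (s, t) ∈ slab ε a b ∩ O) :
    HasDerivAt (fun s => f s t)
      (fderivWithin ℝ (fun z : ℝ × ℝ => f z.1 z.2) (slab ε a b ∩ O) (s, t) (1, 0)) s := by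
  set T := Ioo (-ε) ε ∩ (fun s => (s, t)) ⁻¹' O
  have h2 : HasDerivWithinAt (fun s => ((s, t) : ℝ × ℝ)) ((1, 0) : ℝ × ℝ) T s :=
    (hasDerivWithinAt_id s _).prodMk (hasDerivWithinAt_const _ _ _)
  have h3 : HasDerivWithinAt (fun s => f s t) _ T s :=
    HasFDerivWithinAt.comp_hasDerivWithinAt (f := fun s => ((s, t) : ℝ × ℝ)) s
      hf.hasFDerivWithinAt h2 fun r hr => ⟨⟨hr.1, hst.1.2⟩, hr.2⟩
  exact h3.hasDerivAt ((isOpen_Ioo.inter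
    (hO.preimage (Continuous.prodMk_left t))).mem_nhds ⟨hst.1.1, hst.2⟩)

theorem hasDerivWithinAt_slab_snd (hO : IsOpen O)
    (hf : DifferentiableWithinAt ℝ (fun z : ℝ × ℝ => f z.1 z.2) (slab ε a b ∩ O) (s, t))
    (hst : (s, t) ∈ slab ε a b ∩ O) :
    HasDerivWithinAt (f s)
      (fderivWithin ℝ (fun z : ℝ × ℝ => f z.1 z.2) (slab ε a b ∩ O) (s, t) (0, 1))
      (Icc a b) t := by
  have h2 : HasDerivWithinAt (fun t => ((s, t) : ℝ × ℝ)) ((0, 1) : ℝ × ℝ)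
      (Icc a b ∩ (fun t => (s, t)) ⁻¹' O) t :=
    (hasDerivWithinAt_const _ _ _).prodMk (hasDerivWithinAt_id t _)
  have h3 : HasDerivWithinAt (f s) _ (Icc a b ∩ (fun t => (s, t)) ⁻¹' O) t :=
    HasFDerivWithinAt.comp_hasDerivWithinAt (f := fun t => ((s, t) : ℝ × ℝ)) t
      hf.hasFDerivWithinAt h2 fun r hr => ⟨⟨hst.1.1, hr.1⟩, hr.2⟩
  exact (hasDerivWithinAt_inter
    ((hO.preimage (Continuous.prodMk_right s)).mem_nhds hst.2)).1 h3

theorem contDiffOn_slab_fst (hab : a < b) (hO : IsOpen O)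
    (hf : ContDiffOn ℝ ∞ (fun z : ℝ × ℝ => f z.1 z.2) (slab ε a b ∩ O)) :
    ContDiffOn ℝ ∞ (fun z : ℝ × ℝ => deriv (fun s => f s z.2) z.1) (slab ε a b ∩ O) := by
  refine ContDiffOn.congr (f := fun z => fderivWithin ℝ (fun z : ℝ × ℝ => f z.1 z.2)
    (slab ε a b ∩ O) z (1, 0)) ?_ fun z hz =>
    (hasDerivAt_slab_fst hO ((hf z hz).differentiableWithinAt (by simp)) hz).deriv
  exact (hf.fderivWithin (uniqueDiffOn_slab_inter ε hab hO) (by simp)).clm_apply contDiffOn_const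

theorem contDiffOn_slab_snd (hab : a < b) (hO : IsOpen O)
    (hf : ContDiffOn ℝ ∞ (fun z : ℝ × ℝ => f z.1 z.2) (slab ε a b ∩ O)) :
    ContDiffOn ℝ ∞ (fun z : ℝ × ℝ => derivWithin (f z.1) (Icc a b) z.2) (slab ε a b ∩ O) := by
  refine ContDiffOn.congr (f := fun z => fderivWithin ℝ (fun z : ℝ × ℝ => f z.1 z.2)
    (slab ε a b ∩ O) z (0, 1)) ?_ fun z hz =>
    (hasDerivWithinAt_slab_snd hO ((hf z hz).differentiableWithinAt (by simp)) hz).derivWithin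
      (uniqueDiffOn_Icc hab z.2 hz.1.2)
  exact (hf.fderivWithin (uniqueDiffOn_slab_inter ε hab hO) (by simp)).clm_apply contDiffOn_const

theorem hasDerivAt_slab (hst : (s, t) ∈ slab ε a b)
    (hf : ContDiffOn ℝ ∞ (fun z : ℝ × ℝ => f z.1 z.2) (slab ε a b)) :
    HasDerivAt (fun s => f s t) (deriv (fun s => f s t) s) s := by
  rw [← inter_univ (slab ε a b)] at hst hf
  exact (hasDerivAt_slab_fst isOpen_univ
    ((hf _ hst).differentiableWithinAt (by simp)) hst).differentiableAt.hasDerivAt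

theorem contDiffOn_slab_deriv (hab : a < b)
    (hf : ContDiffOn ℝ ∞ (fun z : ℝ × ℝ => f z.1 z.2) (slab ε a b)) :
    ContDiffOn ℝ ∞ (fun z : ℝ × ℝ => deriv (fun s => f s z.2) z.1) (slab ε a b) := by
  rw [← inter_univ (slab ε a b)] at hf ⊢
  exact contDiffOn_slab_fst hab isOpen_univ hf

/-- Differentiation under the integral sign. -/
theorem hasDerivAt_integral_slab [CompleteSpace E] (hab : a < b)
    (hf : ContDiffOn ℝ ∞ (fun z : ℝ × ℝ => f z.1 z.2) (slab ε a b)) (hs : s ∈ Ioo (-ε) ε) :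
    HasDerivAt (fun s => ∫ t in a..b, f s t) (∫ t in a..b, deriv (fun s => f s t) s) s := by
  -- On a closed ball of parameters times the compact time interval the parameter derivative is
  -- bounded; the bound serves as the dominating constant.
  obtain ⟨r, hr, hrs⟩ := Metric.nhds_basis_closedBall.mem_iff.1 (isOpen_Ioo.mem_nhds hs)
  have hf' := (contDiffOn_slab_deriv hab hf).continuousOn
  have hK : IsCompact (Metric.closedBall s r ×ˢ Icc a b) :=
    (isCompact_closedBall s r).prod isCompact_Icc
  obtain ⟨C, hC⟩ := hK.exists_bound_of_continuousOn
    (hf'.mono (prod_mono hrs le_rfl))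
  have hsub : uIoc a b ⊆ Icc a b := by
    rw [uIoc_of_le hab.le]; exact Ioc_subset_Icc_self
  refine (intervalIntegral.hasDerivAt_integral_of_dominated_loc_of_deriv_le
    (F := f) (F' := fun s t => deriv (fun s => f s t) s) (bound := fun _ => C)
    (Metric.closedBall_mem_nhds s hr) ?_
    (intervalIntegrable_slab_section hab hf.continuousOn hs)
    ?_ ?_ intervalIntegrable_const ?_).2
  · filter_upwards [isOpen_Ioo.mem_nhds hs] with s hs
    exact (intervalIntegrable_slab_section hab hf.continuousOn hs).aestronglyMeasurable_restrict_uIoc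
  · exact (intervalIntegrable_slab_section (f := fun s t => deriv (fun s => f s t) s) hab hf' hs).aestronglyMeasurable_restrict_uIoc
  · exact Eventually.of_forall fun t ht x hx => hC (x, t) ⟨hx, hsub ht⟩
  · refine Eventually.of_forall fun t ht x hx => ?_
    have hz : (x, t) ∈ slab ε a b := ⟨hrs hx, hsub ht⟩
    exact hasDerivAt_slab hz hf

theorem deriv_deriv_integral_slab [CompleteSpace E] (hab : a < b)
    (hf : ContDiffOn ℝ ∞ (fun z : ℝ × ℝ => f z.1 z.2) (slab ε a b)) (hs : s ∈ Ioo (-ε) ε) :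
    HasDerivAt (deriv fun s => ∫ t in a..b, f s t)
      (∫ t in a..b, deriv (deriv fun s => f s t) s) s := by
  refine (hasDerivAt_integral_slab hab (contDiffOn_slab_deriv hab hf) hs).congr_of_eventuallyEq ?_
  filter_upwards [isOpen_Ioo.mem_nhds hs] with s hs
  exact (hasDerivAt_integral_slab hab hf hs).deriv

end Slab

/-- Symmetry of the mixed partial derivatives. -/
theorem hasDerivAt_deriv_comm {E : Type*} [NormedAddCommGroup E] [NormedSpace ℝ E]
    {f : ℝ → ℝ → E} {s t : ℝ}
    (hf : ContDiffAt ℝ 2 (fun z : ℝ × ℝ => f z.1 z.2) (s, t)) :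
    HasDerivAt (fun t => deriv (fun s => f s t) s) (deriv (fun s => deriv (f s) t) s) t := by
  set g := fun z : ℝ × ℝ => f z.1 z.2
  have hev : ∀ᶠ z in 𝓝 (s, t), ContDiffAt ℝ 2 g z := hf.eventually (by simp)
  have hd : DifferentiableAt ℝ (fderiv ℝ g) (s, t) :=
    (hf.fderiv_right (m := 1) (by norm_num)).differentiableAt (by simp)
  have e1 : ∀ z : ℝ × ℝ, ContDiffAt ℝ 2 g z → deriv (fun s => f s z.2) z.1 = fderiv ℝ g z (1, 0) :=
    fun z hz => (HasFDerivAt.comp_hasDerivAt (f := fun s => ((s, z.2) : ℝ × ℝ)) z.1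
      (hz.differentiableAt (by simp)).hasFDerivAt
      ((hasDerivAt_id z.1).prodMk (hasDerivAt_const _ _))).deriv
  have e2 : ∀ z : ℝ × ℝ, ContDiffAt ℝ 2 g z → deriv (f z.1) z.2 = fderiv ℝ g z (0, 1) :=
    fun z hz => (HasFDerivAt.comp_hasDerivAt (f := fun t => ((z.1, t) : ℝ × ℝ)) z.2
      (hz.differentiableAt (by simp)).hasFDerivAt
      ((hasDerivAt_const _ _).prodMk (hasDerivAt_id z.2))).deriv
  have ht : Tendsto (fun r : ℝ => (s, r)) (𝓝 t) (𝓝 (s, t)) :=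
    (Continuous.prodMk_right s).continuousAt
  have hs : Tendsto (fun r : ℝ => (r, t)) (𝓝 s) (𝓝 (s, t)) :=
    (Continuous.prodMk_left t).continuousAt
  have h1 : HasDerivAt (fun t => fderiv ℝ g (s, t) (1, 0))
      (fderiv ℝ (fderiv ℝ g) (s, t) (0, 1) (1, 0)) t := by
    have := HasFDerivAt.comp_hasDerivAt (f := fun r => ((s, r) : ℝ × ℝ)) t hd.hasFDerivAt
      ((hasDerivAt_const _ _).prodMk (hasDerivAt_id t))
    simpa using this.clm_apply (hasDerivAt_const t ((1, 0) : ℝ × ℝ))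
  have h2 : HasDerivAt (fun s => fderiv ℝ g (s, t) (0, 1))
      (fderiv ℝ (fderiv ℝ g) (s, t) (1, 0) (0, 1)) s := by
    have := HasFDerivAt.comp_hasDerivAt (f := fun r => ((r, t) : ℝ × ℝ)) s hd.hasFDerivAt
      ((hasDerivAt_id s).prodMk (hasDerivAt_const _ _))
    simpa using this.clm_apply (hasDerivAt_const s ((0, 1) : ℝ × ℝ))
  have h3 : deriv (fun s => deriv (f s) t) s = fderiv ℝ (fderiv ℝ g) (s, t) (1, 0) (0, 1) := by
    rw [← h2.deriv]
    refine Filter.EventuallyEq.deriv_eq ?_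
    filter_upwards [hs.eventually hev] with r hr using e2 (r, t) hr
  rw [h3, hf.isSymmSndFDerivAt (by simp) (1, 0) (0, 1)]
  refine h1.congr_of_eventuallyEq ?_
  filter_upwards [ht.eventually hev] with r hr using e1 (s, r) hr

end Finsler
end

/-! ### Passage between the tangent bundle and coordinates -/

noncomputable section

namespace Finsler

variable {n : ℕ} {M : Type*} [TopologicalSpace M] [ChartedSpace (Vec n) M]

theorem chart_target_isOpen (q : M) : IsOpen (extChartAt (𝓡 n) q).target :=
  isOpen_extChartAt_target q

theorem chart_source_isOpen (q : M) : IsOpen (extChartAt (𝓡 n) q).source :=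
  isOpen_extChartAt_source q

section

variable [IsManifold (𝓡 n) ∞ M]

theorem isManifold_one : IsManifold (𝓡 n) 1 M := IsManifold.of_le (n := ∞) (by simp)

theorem mfderiv_chart_symm_comp {q m : M} (hm : m ∈ (extChartAt (𝓡 n) q).source)
    (v : TangentSpace (𝓡 n) m) :
    (mfderiv 𝓘(ℝ, Vec n) (𝓡 n) (extChartAt (𝓡 n) q).symm (extChartAt (𝓡 n) q m)
      (mfderiv (𝓡 n) 𝓘(ℝ, Vec n) (extChartAt (𝓡 n) q) m v) : Vec n) = v := by
  have := isManifold_one (n := n) (M := M)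
  have := congrArg (fun T => T v) (mfderivWithin_extChartAt_symm_comp_mfderiv_extChartAt' hm)
  simp only [ModelWithCorners.range_eq_univ, mfderivWithin_univ] at this
  exact this

theorem mfderiv_chart_comp_symm {q : M} {x : Vec n} (hx : x ∈ (extChartAt (𝓡 n) q).target)
    (y : Vec n) :
    (mfderiv (𝓡 n) 𝓘(ℝ, Vec n) (extChartAt (𝓡 n) q) ((extChartAt (𝓡 n) q).symm x)
      (mfderiv 𝓘(ℝ, Vec n) (𝓡 n) (extChartAt (𝓡 n) q).symm x y) : Vec n) = y := by
  have := isManifold_one (n := n) (M := M)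
  have := congrArg (fun T => T y) (mfderiv_extChartAt_comp_mfderivWithin_extChartAt_symm hx)
  simp only [ModelWithCorners.range_eq_univ, mfderivWithin_univ] at this
  exact this

/-- A function on the tangent bundle in terms of its coordinate expression. -/
theorem apply_eq_localExpr (F : TangentBundle (𝓡 n) M → ℝ) {q m : M}
    (hm : m ∈ (extChartAt (𝓡 n) q).source) (v : TangentSpace (𝓡 n) m) :
    F ⟨m, v⟩ = localExpr F q (extChartAt (𝓡 n) q m)
      (mfderiv (𝓡 n) 𝓘(ℝ, Vec n) (extChartAt (𝓡 n) q) m v) := by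
  have h1 := (extChartAt (𝓡 n) q).left_inv hm
  have h2 := mfderiv_chart_symm_comp hm v
  unfold localExpr
  congr 1
  refine Bundle.TotalSpace.ext h1.symm ?_
  exact heq_of_eq h2.symm

theorem contMDiffOn_tangent_symm (q : M) :
    ContMDiffOn 𝓘(ℝ, Vec n × Vec n) (𝓡 n).tangent ∞
      (fun z : Vec n × Vec n => (⟨(extChartAt (𝓡 n) q).symm z.1,
        mfderiv 𝓘(ℝ, Vec n) (𝓡 n) (extChartAt (𝓡 n) q).symm z.1 z.2⟩ : TangentBundle (𝓡 n) M))
      ((extChartAt (𝓡 n) q).target ×ˢ univ) := by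
  have := isManifold_one (n := n) (M := M)
  have ho := chart_target_isOpen (n := n) q
  have h1 := (contMDiffOn_extChartAt_symm (I := 𝓡 n) (n := ∞) q).contMDiffOn_tangentMapWithin
    (m := ∞) (by simp) ho.uniqueMDiffOn
  have h2 : ContMDiff 𝓘(ℝ, Vec n × Vec n) (𝓘(ℝ, Vec n)).tangent ∞
      (fun z : Vec n × Vec n => (⟨z.1, z.2⟩ : TangentBundle 𝓘(ℝ, Vec n) (Vec n))) := by
    rw [modelWithCornersSelf_prod]
    exact contMDiff_tangentBundleModelSpaceHomeomorph_symm (I := 𝓘(ℝ, Vec n)) (n := ∞)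
  have h3 := h1.comp h2.contMDiffOn (s := (extChartAt (𝓡 n) q).target ×ˢ univ)
    fun z hz => hz.1
  refine h3.congr fun z hz => ?_
  have : mfderivWithin 𝓘(ℝ, Vec n) (𝓡 n) (extChartAt (𝓡 n) q).symm
      (extChartAt (𝓡 n) q).target z.1 = mfderiv 𝓘(ℝ, Vec n) (𝓡 n) (extChartAt (𝓡 n) q).symm z.1 :=
    mfderivWithin_of_mem_nhds (ho.mem_nhds hz.1)
  simp only [Function.comp, tangentMapWithin, this]

namespace FinslerMetric

variable (F : FinslerMetric n M)

/-- The chart's differential is an isomorphism on each tangent space, so nonzero coordinate vectors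
are nonzero tangent vectors. This is the point at which the local theory applies to `M`. -/
theorem isLocalFinsler (q : M) :
    IsLocalFinsler (localExpr F.toFun q) (extChartAt (𝓡 n) q).target where
  isOpen := chart_target_isOpen q
  smooth := by
    have h := F.smooth.comp (contMDiffOn_tangent_symm q |>.mono
      (prod_mono le_rfl (subset_univ ({0}ᶜ : Set (Vec n))))) ?_
    · exact contMDiffOn_iff_contDiffOn.1 h
    · rintro ⟨x, y⟩ ⟨hx, hy⟩ h0
      apply hy
      have := mfderiv_chart_comp_symm hx y
      rw [mem_singleton_iff, ← this]
      exact (congrArg (mfderiv (𝓡 n) 𝓘(ℝ, Vec n) (extChartAt (𝓡 n) q) _) h0).trans (map_zero _)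
  pos := by
    intro x hx y hy
    refine F.pos _ _ fun h0 => hy ?_
    rw [← mfderiv_chart_comp_symm hx y]
    exact (congrArg _ h0).trans (map_zero _)
  homog := by
    intro x hx a y
    simp only [localExpr]
    rw [← F.homog]
    congr 2
    exact map_smul _ _ _
  posDef := F.posDef q

end FinslerMetric

end

end Finsler
end

/-! ### Smooth families of curves on the manifold -/

noncomputable section

namespace Finsler

variable {n : ℕ} {M : Type*} [TopologicalSpace M] [ChartedSpace (Vec n) M]

section

variable [IsManifold (𝓡 n) ∞ M]

theorem mfderiv_chart_velocity {c : ℝ → M} {I : Set ℝ} {t : ℝ} {q : M}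
    (hc : MDifferentiableWithinAt 𝓘(ℝ, ℝ) (𝓡 n) c I t) (hI : UniqueDiffWithinAt ℝ I t)
    (hq : c t ∈ (extChartAt (𝓡 n) q).source) :
    (mfderiv (𝓡 n) 𝓘(ℝ, Vec n) (extChartAt (𝓡 n) q) (c t)
      (mfderivWithin 𝓘(ℝ, ℝ) (𝓡 n) c I t (1 : ℝ)) : Vec n) = derivWithin (coordCurve (n := n) q c) I t := by
  have := isManifold_one (n := n) (M := M)
  have h1 := mfderiv_comp_mfderivWithin t
    (mdifferentiableAt_extChartAt (I := 𝓡 n) (x := q) (by simpa using hq)) hc hI.uniqueMDiffWithinAt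
  have h2 := congrArg (fun T => T (1 : ℝ)) h1
  simp only [mfderivWithin_eq_fderivWithin] at h2
  rw [← fderivWithin_derivWithin]
  exact h2.symm

theorem velocity_ne_zero_iff {c : ℝ → M} {I : Set ℝ} {t : ℝ} {q : M}
    (hc : MDifferentiableWithinAt 𝓘(ℝ, ℝ) (𝓡 n) c I t) (hI : UniqueDiffWithinAt ℝ I t)
    (hq : c t ∈ (extChartAt (𝓡 n) q).source) :
    mfderivWithin 𝓘(ℝ, ℝ) (𝓡 n) c I t (1 : ℝ) ≠ 0 ↔ derivWithin (coordCurve (n := n) q c) I t ≠ 0 := by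
  rw [← mfderiv_chart_velocity hc hI hq]
  refine not_congr ⟨fun h => ?_, fun h => ?_⟩
  · exact (congrArg (mfderiv (𝓡 n) 𝓘(ℝ, Vec n) (extChartAt (𝓡 n) q) (c t)) h).trans (map_zero _)
  · have h1 := mfderiv_chart_symm_comp hq (mfderivWithin 𝓘(ℝ, ℝ) (𝓡 n) c I t (1 : ℝ))
    rw [h] at h1
    exact h1.symm.trans (map_zero _)

theorem apply_velocity (F : TangentBundle (𝓡 n) M → ℝ) {c : ℝ → M} {I : Set ℝ} {t : ℝ} {q : M}
    (hc : MDifferentiableWithinAt 𝓘(ℝ, ℝ) (𝓡 n) c I t) (hI : UniqueDiffWithinAt ℝ I t)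
    (hq : c t ∈ (extChartAt (𝓡 n) q).source) :
    F ⟨c t, mfderivWithin 𝓘(ℝ, ℝ) (𝓡 n) c I t (1 : ℝ)⟩
      = localExpr F q (coordCurve (n := n) q c t) (derivWithin (coordCurve (n := n) q c) I t) := by
  rw [apply_eq_localExpr F hq, mfderiv_chart_velocity hc hI hq]; rfl

theorem contDiffOn_coord {E : Type*} [NormedAddCommGroup E] [NormedSpace ℝ E] {g : E → M}
    {S : Set E} {q : M} (hg : ContMDiffOn 𝓘(ℝ, E) (𝓡 n) ∞ g S)
    (hq : ∀ z ∈ S, g z ∈ (extChartAt (𝓡 n) q).source) :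
    ContDiffOn ℝ ∞ (fun z => extChartAt (𝓡 n) q (g z)) S :=
  contMDiffOn_iff_contDiffOn.1 <| (contMDiffOn_extChartAt (I := 𝓡 n) (x := q)).comp hg
    fun z hz => by simpa using hq z hz

theorem contMDiffOn_of_coord {E : Type*} [NormedAddCommGroup E] [NormedSpace ℝ E] {g : E → Vec n}
    {S : Set E} {q : M} (hg : ContDiffOn ℝ ∞ g S)
    (hq : ∀ z ∈ S, g z ∈ (extChartAt (𝓡 n) q).target) :
    ContMDiffOn 𝓘(ℝ, E) (𝓡 n) ∞ (fun z => (extChartAt (𝓡 n) q).symm (g z)) S :=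
  (contMDiffOn_extChartAt_symm q).comp (contMDiffOn_iff_contDiffOn.2 hg) hq

/-- A family `γ` of curves which is smooth on `(-ε, ε) × [a, b]`. -/
def SmoothFamily (γ : ℝ → ℝ → M) (ε a b : ℝ) : Prop :=
  ContMDiffOn 𝓘(ℝ, ℝ × ℝ) (𝓡 n) ∞ (fun z : ℝ × ℝ => γ z.1 z.2) (slab ε a b)

variable {γ : ℝ → ℝ → M} {ε a b : ℝ}

omit [IsManifold (𝓡 n) ∞ M] in
theorem SmoothFamily.mono (h : SmoothFamily (n := n) γ ε a b) {ε' : ℝ} (he : ε' ≤ ε) :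
    SmoothFamily (n := n) γ ε' a b := ContMDiffOn.mono h (slab_mono he)

omit [IsManifold (𝓡 n) ∞ M] in
theorem SmoothFamily.curve (h : SmoothFamily (n := n) γ ε a b) {s : ℝ} (hs : s ∈ Ioo (-ε) ε) :
    ContMDiffOn 𝓘(ℝ, ℝ) (𝓡 n) ∞ (γ s) (Icc a b) :=
  ContMDiffOn.comp (f := fun t : ℝ => ((s, t) : ℝ × ℝ)) h
    (contMDiffOn_iff_contDiffOn.2 (by fun_prop)) fun _ ht => ⟨hs, ht⟩

/-- The preimage of the chart domain is only relatively open in the slab. Writing it as the trace of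
an open `O` keeps unique differentiability, so that derivatives within the set behave well. -/
theorem SmoothFamily.exists_coord (h : SmoothFamily (n := n) γ ε a b) (q : M) :
    ∃ O : Set (ℝ × ℝ), IsOpen O ∧
      (∀ z ∈ slab ε a b, z ∈ O ↔ γ z.1 z.2 ∈ (extChartAt (𝓡 n) q).source) ∧
      ContDiffOn ℝ ∞ (fun z : ℝ × ℝ => coordCurve (n := n) q (γ z.1) z.2) (slab ε a b ∩ O) := by
  obtain ⟨O, hO, he⟩ := continuousOn_iff'.1 h.continuousOn _ (chart_source_isOpen (n := n) q)
  have hz : ∀ z ∈ slab ε a b, z ∈ O ↔ γ z.1 z.2 ∈ (extChartAt (𝓡 n) q).source := by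
    intro z hz
    have := Set.ext_iff.1 he z
    simp only [mem_inter_iff, hz, and_true, mem_preimage] at this
    exact this.symm
  exact ⟨O, hO, hz, contDiffOn_coord (ContMDiffOn.mono h inter_subset_left)
    fun z hz' => (hz z hz'.1).1 hz'.2⟩

omit [IsManifold (𝓡 n) ∞ M] in
theorem SmoothFamily.mdifferentiableWithinAt (h : SmoothFamily (n := n) γ ε a b) {s t : ℝ}
    (hs : s ∈ Ioo (-ε) ε) (ht : t ∈ Icc a b) :
    MDifferentiableWithinAt 𝓘(ℝ, ℝ) (𝓡 n) (γ s) (Icc a b) t :=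
  ((h.curve hs) t ht).mdifferentiableWithinAt (by simp)

/-- The `p`-th power of the speed along a family of curves is smooth as long as the velocities
do not vanish. -/
theorem SmoothFamily.contDiffOn_speed (F : FinslerMetric n M) (p : ℝ) (hab : a < b)
    (h : SmoothFamily (n := n) γ ε a b)
    (hne : ∀ z ∈ slab ε a b, mfderivWithin 𝓘(ℝ, ℝ) (𝓡 n) (γ z.1) (Icc a b) z.2 (1 : ℝ) ≠ 0) :
    ContDiffOn ℝ ∞ (fun z : ℝ × ℝ => F.toFun ⟨γ z.1 z.2,
      mfderivWithin 𝓘(ℝ, ℝ) (𝓡 n) (γ z.1) (Icc a b) z.2 (1 : ℝ)⟩ ^ p) (slab ε a b) := by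
  intro z hz
  set q := γ z.1 z.2
  obtain ⟨O, hO, hOq, hu⟩ := h.exists_coord q
  have hzO : z ∈ O := (hOq z hz).2 (mem_extChartAt_source q)
  have hd := contDiffOn_slab_snd (f := fun s t => coordCurve (n := n) q (γ s) t) hab hO hu
  have hmd : ∀ z ∈ slab ε a b, MDifferentiableWithinAt 𝓘(ℝ, ℝ) (𝓡 n) (γ z.1) (Icc a b) z.2 :=
    fun z hz => h.mdifferentiableWithinAt hz.1 hz.2
  have hui : ∀ z ∈ slab ε a b, UniqueDiffWithinAt ℝ (Icc a b) z.2 :=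
    fun z hz => uniqueDiffOn_Icc hab z.2 hz.2
  have hL := ContDiffOn.comp ((F.isLocalFinsler q).contDiffOn_lagrangian p) (hu.prodMk hd)
    fun z hz => ⟨(extChartAt (𝓡 n) q).map_source ((hOq z hz.1).1 hz.2),
      (velocity_ne_zero_iff (hmd z hz.1) (hui z hz.1) ((hOq z hz.1).1 hz.2)).1 (hne z hz.1)⟩
  refine ContDiffWithinAt.mono_of_mem_nhdsWithin (ContDiffOn.congr hL (fun z hz => ?_) z ⟨hz, hzO⟩)
    (inter_mem_nhdsWithin _ (hO.mem_nhds hzO))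
  simp only [Function.comp, lagrangian]
  rw [apply_velocity F.toFun (hmd z hz.1) (hui z hz.1) ((hOq z hz.1).1 hz.2)]

/-- The tube lemma for the compact time interval gives one parameter radius valid for all times. -/
theorem exists_slab_of_eventually {P : ℝ → ℝ → Prop} (hε : 0 < ε)
    (h : ∀ t ∈ Icc a b, ∀ᶠ z : ℝ × ℝ in 𝓝 (0, t), z ∈ slab ε a b → P z.1 z.2) :
    ∃ δ > 0, δ ≤ ε ∧ ∀ s ∈ Ioo (-δ) δ, ∀ t ∈ Icc a b, P s t := by
  have := isCompact_Icc.eventually_forall_of_forall_eventually (K := Icc a b) (x₀ := (0 : ℝ))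
    (P := fun s t => (s, t) ∈ slab ε a b → P s t) h
  obtain ⟨δ, hδ, hP⟩ := Metric.eventually_nhds_iff.1 this
  refine ⟨min δ ε, lt_min hδ hε, min_le_right _ _, fun s hs t ht => ?_⟩
  have h1 : |s| < min δ ε := abs_lt.2 hs
  refine hP (by simpa using h1.trans_le (min_le_left _ _)) t ht ⟨?_, ht⟩
  exact abs_lt.1 (h1.trans_le (min_le_right _ _))

theorem SmoothFamily.exists_velocity_ne_zero (hε : 0 < ε) (hab : a < b)
    (h : SmoothFamily (n := n) γ ε a b)
    (hne : ∀ t ∈ Icc a b, mfderivWithin 𝓘(ℝ, ℝ) (𝓡 n) (γ 0) (Icc a b) t (1 : ℝ) ≠ 0) :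
    ∃ δ > 0, δ ≤ ε ∧ ∀ z ∈ slab δ a b,
      mfderivWithin 𝓘(ℝ, ℝ) (𝓡 n) (γ z.1) (Icc a b) z.2 (1 : ℝ) ≠ 0 := by
  suffices h1 : ∀ t ∈ Icc a b, ∀ᶠ z : ℝ × ℝ in 𝓝 (0, t), z ∈ slab ε a b →
      mfderivWithin 𝓘(ℝ, ℝ) (𝓡 n) (γ z.1) (Icc a b) z.2 (1 : ℝ) ≠ 0 by
    obtain ⟨δ, hδ, hδε, hP⟩ := exists_slab_of_eventually (a := a) (b := b)
      (P := fun s t => mfderivWithin 𝓘(ℝ, ℝ) (𝓡 n) (γ s) (Icc a b) t (1 : ℝ) ≠ 0) hε h1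
    exact ⟨δ, hδ, hδε, fun z hz => hP z.1 hz.1 z.2 hz.2⟩
  intro t ht
  set q := γ 0 t
  have h0 : (0, t) ∈ slab ε a b := ⟨⟨by simpa using hε, hε⟩, ht⟩
  obtain ⟨O, hO, hOq, hu⟩ := h.exists_coord q
  have hzO : (0, t) ∈ O := (hOq _ h0).2 (mem_extChartAt_source q)
  have hd := contDiffOn_slab_snd (f := fun s t => coordCurve (n := n) q (γ s) t) hab hO hu
  have hc := (hd.continuousOn _ ⟨h0, hzO⟩).eventually_ne
    ((velocity_ne_zero_iff (h.mdifferentiableWithinAt h0.1 h0.2)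
      (uniqueDiffOn_Icc hab t ht) ((hOq _ h0).1 hzO)).1 (hne t ht))
  rw [eventually_nhdsWithin_iff] at hc
  filter_upwards [hc, hO.mem_nhds hzO] with z hz hzO' hzs
  exact (velocity_ne_zero_iff (h.mdifferentiableWithinAt hzs.1 hzs.2)
      (uniqueDiffOn_Icc hab z.2 hzs.2) ((hOq _ hzs).1 hzO')).2 (hz ⟨hzs, hzO'⟩)

end

end Finsler
end

/-! ### Second derivative of the energy along a variation -/

noncomputable section

namespace Finsler

variable {n : ℕ} {M : Type*} [TopologicalSpace M] [ChartedSpace (Vec n) M]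

section

variable [IsManifold (𝓡 n) ∞ M]

/-- The integrand `‖ċ‖ᵖ` of the `p`-energy. -/
def speedPow (F : FinslerMetric n M) (p : ℝ) (c : ℝ → M) (t : ℝ) : ℝ :=
  F.toFun ⟨c t, mfderiv 𝓘(ℝ, ℝ) (𝓡 n) c t (1 : ℝ)⟩ ^ p

theorem speedPow_congr (F : FinslerMetric n M) (p : ℝ) {c c' : ℝ → M} {t : ℝ}
    (h : c =ᶠ[𝓝 t] c') : speedPow F p c t = speedPow F p c' t := by
  unfold speedPow
  congr 2
  refine Bundle.TotalSpace.ext h.self_of_nhds ?_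
  exact heq_of_eq (congrArg (fun T : ℝ →L[ℝ] Vec n => T 1)
    (h.mfderiv_eq (I := 𝓘(ℝ, ℝ)) (I' := 𝓡 n)))

/-- The second derivative at `s = 0` of the integrand of the `p`-energy along a family of
curves. -/
def secondVar (F : FinslerMetric n M) (p : ℝ) (γ : ℝ → ℝ → M) (t : ℝ) : ℝ :=
  deriv (deriv fun s => speedPow F p (γ s) t) 0

variable {γ : ℝ → ℝ → M} {ε a b : ℝ}

/-- The energy uses two-sided velocities, which may be ill-behaved at `a` and `b`. The integrand
built from one-sided velocities is smooth up to the ends and agrees with it on the open interval,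
which is enough for integrals. -/
theorem SmoothFamily.energy (F : FinslerMetric n M) (p : ℝ) (hε : 0 < ε) (hab : a < b)
    (h : SmoothFamily (n := n) γ ε a b)
    (hne : ∀ t ∈ Icc a b, mfderivWithin 𝓘(ℝ, ℝ) (𝓡 n) (γ 0) (Icc a b) t (1 : ℝ) ≠ 0) :
    (∀ᶠ s in 𝓝 (0 : ℝ), IntervalIntegrable (speedPow F p (γ s)) MeasureTheory.volume a b) ∧
    IntervalIntegrable (secondVar F p γ) MeasureTheory.volume a b ∧
    (∀ᶠ s in 𝓝 (0 : ℝ), DifferentiableAt ℝ (fun s => ∫ t in a..b, speedPow F p (γ s) t) s) ∧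
    HasDerivAt (deriv fun s => ∫ t in a..b, speedPow F p (γ s) t)
      (∫ t in a..b, secondVar F p γ t) 0 := by
  obtain ⟨δ, hδ, hδε, hP⟩ := h.exists_velocity_ne_zero hε hab hne
  have hf := (h.mono hδε).contDiffOn_speed F p hab hP
  set f : ℝ → ℝ → ℝ := fun s t => F.toFun ⟨γ s t,
      mfderivWithin 𝓘(ℝ, ℝ) (𝓡 n) (γ s) (Icc a b) t (1 : ℝ)⟩ ^ p
  have heq : ∀ s, EqOn (f s) (speedPow F p (γ s)) (Ioo a b) := fun s t ht => by
    simp only [f, speedPow, mfderivWithin_of_mem_nhds (Icc_mem_nhds ht.1 ht.2)]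
  have hev : ∀ᶠ s in 𝓝 (0 : ℝ), s ∈ Ioo (-δ) δ := isOpen_Ioo.mem_nhds ⟨by simpa using hδ, hδ⟩
  have h0 : (0 : ℝ) ∈ Ioo (-δ) δ := hev.self_of_nhds
  have hint : (fun s => ∫ t in a..b, f s t) = fun s => ∫ t in a..b, speedPow F p (γ s) t :=
    funext fun s => intervalIntegral.integral_congr_Ioo_of_le hab.le (heq s)
  have heq2 : EqOn (fun t => deriv (deriv fun s => f s t) 0) (secondVar F p γ) (Ioo a b) :=
    fun t ht => by
      have : (fun s => f s t) = fun s => speedPow F p (γ s) t := funext fun s => heq s ht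
      simp only [secondVar, this]
  have hf2 := contDiffOn_slab_deriv (f := fun s t => deriv (fun s => f s t) s) hab
    (contDiffOn_slab_deriv hab hf)
  refine ⟨?_, ?_, ?_, ?_⟩
  · filter_upwards [hev] with s hs
    refine (intervalIntegrable_slab_section (f := f) hab hf.continuousOn hs).congr_uIoo ?_
    rw [uIoo_of_le hab.le]; exact heq s
  · refine (intervalIntegrable_slab_section (f := fun s t => deriv (fun s => deriv (fun s => f s t) s) s)
      hab hf2.continuousOn h0).congr_uIoo ?_
    rw [uIoo_of_le hab.le]; exact heq2
  · filter_upwards [hev] with s hs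
    rw [← hint]
    exact (hasDerivAt_integral_slab hab hf hs).differentiableAt
  · rw [← hint, ← intervalIntegral.integral_congr_Ioo_of_le hab.le heq2]
    exact deriv_deriv_integral_slab hab hf h0

/-- If `t` avoided every piece, then going up the partition each node after the first would lie
below `t`, which contradicts that the last node is `1`. -/
theorem exists_mem_partition {k : ℕ} {τ : Fin (k + 1) → ℝ} (hτ : IsPartition τ) {t : ℝ}
    (ht : t ∈ Icc (0 : ℝ) 1) : ∃ i : Fin k, t ∈ Icc (τ i.castSucc) (τ i.succ) := by
  by_contra! hcon
  have key : ∀ j : Fin (k + 1), τ j < t ∨ j = 0 := by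
    intro j
    induction j using Fin.induction with
    | zero => exact Or.inr rfl
    | succ i ih =>
      left
      have h1 : τ i.castSucc ≤ t := by
        rcases ih with h | h
        · exact h.le
        · rw [h, hτ.2.1]; exact ht.1
      by_contra! h2
      exact hcon i ⟨h1, h2⟩
  rcases key (Fin.last k) with h | h
  · rw [hτ.2.2] at h; exact absurd ht.2 (not_le.2 h)
  · have := hτ.2.1
    rw [← h, hτ.2.2] at this
    norm_num at this

theorem partition_subset {k : ℕ} {τ : Fin (k + 1) → ℝ} (hτ : IsPartition τ) (i : Fin k) :
    Icc (τ i.castSucc) (τ i.succ) ⊆ Icc 0 1 := by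
  refine Icc_subset_Icc ?_ ?_
  · rw [← hτ.2.1]; exact hτ.1.monotone (Fin.zero_le _)
  · rw [← hτ.2.2]; exact hτ.1.monotone (Fin.le_last _)

omit [IsManifold (𝓡 n) ∞ M] in
-- Regularity is given on the pieces of some unknown partition. Since `c` is smooth on all of `[0,
-- 1]`, its velocity relative to any nondegenerate subinterval is the same.
theorem velocity_ne_zero_of_mem_pathSpace {x₀ x₁ : M} {c : ℝ → M}
    (hc : c ∈ pathSpace (n := n) x₀ x₁) (hs : ContMDiffOn 𝓘(ℝ, ℝ) (𝓡 n) ∞ c (Icc 0 1)) {t : ℝ}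
    (hab : a < b) (hsub : Icc a b ⊆ Icc 0 1) (ht : t ∈ Icc a b) :
    mfderivWithin 𝓘(ℝ, ℝ) (𝓡 n) c (Icc a b) t (1 : ℝ) ≠ 0 := by
  obtain ⟨-, -, k, τ, hτ, hi⟩ := hc
  obtain ⟨i, hti⟩ := exists_mem_partition hτ (hsub ht)
  have hd : MDifferentiableWithinAt 𝓘(ℝ, ℝ) (𝓡 n) c (Icc 0 1) t :=
    (hs t (hsub ht)).mdifferentiableWithinAt (by simp)
  have h1 := (hi i).2 t hti
  have hlt : τ i.castSucc < τ i.succ := hτ.1 Fin.castSucc_lt_succ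
  rw [hd.mfderivWithin_mono (uniqueDiffOn_Icc hlt t hti).uniqueMDiffWithinAt
    (partition_subset hτ i)] at h1
  rwa [hd.mfderivWithin_mono (uniqueDiffOn_Icc hab t ht).uniqueMDiffWithinAt hsub]

/-- The second variation formula: along a variation with at most one corner in time, the second
derivative of the `p`-energy has the sign prescribed by minimality or maximality. -/
theorem second_variation (F : FinslerMetric n M) (p : ℝ) {x₀ x₁ : M} {c : ℝ → M}
    (hc : c ∈ pathSpace (n := n) x₀ x₁) (hs : ContMDiffOn 𝓘(ℝ, ℝ) (𝓡 n) ∞ c (Icc 0 1))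
    (hb : b ∈ Ioo (0 : ℝ) 1) (hε : 0 < ε) (h1 : SmoothFamily (n := n) γ ε 0 b)
    (h2 : SmoothFamily (n := n) γ ε b 1) (hγ : ∀ t ∈ Icc (0 : ℝ) 1, γ 0 t = c t)
    (hends : ∀ s ∈ Ioo (-ε) ε, γ s 0 = x₀ ∧ γ s 1 = x₁) :
    IntervalIntegrable (secondVar F p γ) MeasureTheory.volume 0 b ∧
    IntervalIntegrable (secondVar F p γ) MeasureTheory.volume b 1 ∧
    (IsMinimum F p x₀ x₁ c →
      0 ≤ (∫ t in 0..b, secondVar F p γ t) + ∫ t in b..1, secondVar F p γ t) ∧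
    (IsMaximum F p x₀ x₁ c →
      (∫ t in 0..b, secondVar F p γ t) + ∫ t in b..1, secondVar F p γ t ≤ 0) := by
  have s1 : Icc (0 : ℝ) b ⊆ Icc 0 1 := Icc_subset_Icc le_rfl hb.2.le
  have s2 : Icc b 1 ⊆ Icc (0 : ℝ) 1 := Icc_subset_Icc hb.1.le le_rfl
  have r1 : ∀ t ∈ Icc 0 b, mfderivWithin 𝓘(ℝ, ℝ) (𝓡 n) (γ 0) (Icc 0 b) t (1 : ℝ) ≠ 0 := by
    intro t ht h0
    rw [mfderivWithin_congr (fun t ht => hγ t (s1 ht)) (hγ t (s1 ht))] at h0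
    exact velocity_ne_zero_of_mem_pathSpace hc hs hb.1 s1 ht h0
  have r2 : ∀ t ∈ Icc b 1, mfderivWithin 𝓘(ℝ, ℝ) (𝓡 n) (γ 0) (Icc b 1) t (1 : ℝ) ≠ 0 := by
    intro t ht h0
    rw [mfderivWithin_congr (fun t ht => hγ t (s2 ht)) (hγ t (s2 ht))] at h0
    exact velocity_ne_zero_of_mem_pathSpace hc hs hb.2 s2 ht h0
  obtain ⟨i1, i1', d1, e1⟩ := h1.energy F p hε hb.1 r1
  obtain ⟨i2, i2', d2, e2⟩ := h2.energy F p hε hb.2 r2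
  obtain ⟨δ1, hδ1, hδ1ε, hP1⟩ := h1.exists_velocity_ne_zero hε hb.1 r1
  obtain ⟨δ2, hδ2, hδ2ε, hP2⟩ := h2.exists_velocity_ne_zero hε hb.2 r2
  set δ := min δ1 δ2
  have hδ : 0 < δ := lt_min hδ1 hδ2
  have hδε : δ ≤ ε := (min_le_left _ _).trans hδ1ε
  -- The only admitted corner is at `b`, so the same partition serves for the variation and for each
  -- of its curves.
  have hpart : IsPartition ![0, b, 1] := by
    refine ⟨?_, rfl, rfl⟩
    rw [Fin.strictMono_iff_lt_succ, Fin.forall_fin_two]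
    exact ⟨hb.1, hb.2⟩
  have hvar : IsVariation (n := n) x₀ x₁ c δ γ := by
    refine ⟨fun s hs => ?_, hγ, 2, ![0, b, 1], hpart, ?_⟩
    · have hsε : s ∈ Ioo (-ε) ε := Ioo_subset_Ioo (by linarith) hδε hs
      refine ⟨(hends s hsε).1, (hends s hsε).2, 2, ![0, b, 1], hpart, ?_⟩
      rw [Fin.forall_fin_two]
      refine ⟨⟨h1.curve hsε, fun t ht => ?_⟩, h2.curve hsε, fun t ht => ?_⟩
      · exact hP1 (s, t) ⟨Ioo_subset_Ioo (by simp [δ]) (min_le_left _ _) hs, ht⟩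
      · exact hP2 (s, t) ⟨Ioo_subset_Ioo (by simp [δ]) (min_le_right _ _) hs, ht⟩
    · rw [Fin.forall_fin_two]
      exact ⟨h1.mono hδε, h2.mono hδε⟩
  set E1 := fun s => ∫ t in 0..b, speedPow F p (γ s) t
  set E2 := fun s => ∫ t in b..1, speedPow F p (γ s) t
  have hE : (fun s => pEnergy F p (γ s)) =ᶠ[𝓝 0] fun s => E1 s + E2 s := by
    filter_upwards [i1, i2] with s hs1 hs2
    exact (intervalIntegral.integral_add_adjacent_intervals hs1 hs2).symm
  -- The curves `γ 0` and `c` may differ outside `[0, 1]`, so their two-sided velocities are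
  -- compared only at interior times.
  have hE0 : pEnergy F p c = pEnergy F p (γ 0) := by
    refine intervalIntegral.integral_congr_Ioo_of_le zero_le_one fun t ht => ?_
    have hev : c =ᶠ[𝓝 t] γ 0 := by
      filter_upwards [isOpen_Ioo.mem_nhds ht] with r hr
      exact (hγ r (Ioo_subset_Icc_self hr)).symm
    exact speedPow_congr F p hev
  have hcont : ContinuousAt (fun s => E1 s + E2 s) 0 :=
    (d1.self_of_nhds.add d2.self_of_nhds).continuousAt
  have hdd : HasDerivAt (deriv fun s => E1 s + E2 s)
      ((∫ t in 0..b, secondVar F p γ t) + ∫ t in b..1, secondVar F p γ t) 0 := by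
    refine (e1.add e2).congr_of_eventuallyEq ?_
    filter_upwards [d1, d2] with s hs1 hs2
    exact deriv_add hs1 hs2
  refine ⟨i1', i2', fun hmin => ?_, fun hmax => ?_⟩
  · rw [← hdd.deriv]
    refine IsLocalMin.deriv_deriv_nonneg ?_ hcont
    filter_upwards [hmin δ γ hδ hvar, hE] with s hs1 hs2
    have h0 : pEnergy F p (γ 0) = E1 0 + E2 0 := hE.self_of_nhds
    rwa [← h0, ← hs2, ← hE0]
  · rw [← hdd.deriv]
    refine IsLocalMax.deriv_deriv_nonpos ?_ hcont
    filter_upwards [hmax δ γ hδ hvar, hE] with s hs1 hs2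
    have h0 : pEnergy F p (γ 0) = E1 0 + E2 0 := hE.self_of_nhds
    rwa [← h0, ← hs2, ← hE0]

end

end Finsler
end

/-! ### Modifying a family of curves inside one chart -/

noncomputable section

namespace Finsler

section Calculus

variable {E G : Type*} [NormedAddCommGroup E] [NormedSpace ℝ E] [NormedAddCommGroup G]
  [NormedSpace ℝ G]

theorem ContDiffAt.eventually_differentiableAt {f : E → G} {x : E} (hf : ContDiffAt ℝ ∞ f x) :
    ∀ᶠ y in 𝓝 x, DifferentiableAt ℝ f y :=
  ((hf.of_le (m := 1) (by simp)).eventually (by simp)).mono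
    fun _ hy => hy.differentiableAt (by simp)

theorem hasDerivAt_fst {u : ℝ → ℝ → G} {z : ℝ × ℝ}
    (hu : DifferentiableAt ℝ (fun z : ℝ × ℝ => u z.1 z.2) z) :
    HasDerivAt (fun s => u s z.2) (fderiv ℝ (fun z : ℝ × ℝ => u z.1 z.2) z (1, 0)) z.1 :=
  HasFDerivAt.comp_hasDerivAt (f := fun s => ((s, z.2) : ℝ × ℝ)) z.1 hu.hasFDerivAt
    ((hasDerivAt_id z.1).prodMk (hasDerivAt_const _ _))

theorem hasDerivAt_snd {u : ℝ → ℝ → G} {z : ℝ × ℝ}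
    (hu : DifferentiableAt ℝ (fun z : ℝ × ℝ => u z.1 z.2) z) :
    HasDerivAt (u z.1) (fderiv ℝ (fun z : ℝ × ℝ => u z.1 z.2) z (0, 1)) z.2 :=
  HasFDerivAt.comp_hasDerivAt (f := fun t => ((z.1, t) : ℝ × ℝ)) z.2 hu.hasFDerivAt
    ((hasDerivAt_const _ _).prodMk (hasDerivAt_id z.2))

theorem ContDiffAt.deriv_fst {u : ℝ → ℝ → G} {z : ℝ × ℝ}
    (hu : ContDiffAt ℝ ∞ (fun z : ℝ × ℝ => u z.1 z.2) z) :
    ContDiffAt ℝ ∞ (fun z : ℝ × ℝ => deriv (fun s => u s z.2) z.1) z := by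
  refine ((hu.fderiv_right (m := ∞) (by simp)).clm_apply
    (contDiffAt_const (c := ((1, 0) : ℝ × ℝ)))).congr_of_eventuallyEq ?_
  filter_upwards [ContDiffAt.eventually_differentiableAt hu] with w hw
    using (hasDerivAt_fst hw).deriv

theorem ContDiffAt.deriv_snd {u : ℝ → ℝ → G} {z : ℝ × ℝ}
    (hu : ContDiffAt ℝ ∞ (fun z : ℝ × ℝ => u z.1 z.2) z) :
    ContDiffAt ℝ ∞ (fun z : ℝ × ℝ => deriv (u z.1) z.2) z := by
  refine ((hu.fderiv_right (m := ∞) (by simp)).clm_apply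
    (contDiffAt_const (c := ((0, 1) : ℝ × ℝ)))).congr_of_eventuallyEq ?_
  filter_upwards [ContDiffAt.eventually_differentiableAt hu] with w hw
    using (hasDerivAt_snd hw).deriv

theorem ContDiffAt.deriv' {u : ℝ → G} {t : ℝ} (hu : ContDiffAt ℝ ∞ u t) :
    ContDiffAt ℝ ∞ (deriv u) t := by
  have : ContDiffAt ℝ ∞ (fun z : ℝ × ℝ => deriv ((fun _ : ℝ => u) z.1) z.2) (0, t) :=
    ContDiffAt.deriv_snd (u := fun _ => u) (z := (0, t)) (hu.comp (0, t) contDiffAt_snd)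
  exact this.comp t (f := fun t : ℝ => ((0, t) : ℝ × ℝ)) (by fun_prop)

/-- The second derivative of a function along a curve. -/
theorem deriv_deriv_comp_curve {L : E → ℝ} {w : ℝ → E} {s : ℝ} (hL : ContDiffAt ℝ ∞ L (w s))
    (hw : ContDiffAt ℝ ∞ w s) :
    deriv (deriv fun s => L (w s)) s
      = fderiv ℝ (fderiv ℝ L) (w s) (deriv w s) (deriv w s) + fderiv ℝ L (w s) (deriv (deriv w) s) := by
  have h1 : deriv (fun s => L (w s)) =ᶠ[𝓝 s] fun s => fderiv ℝ L (w s) (deriv w s) := by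
    filter_upwards [ContDiffAt.eventually_differentiableAt hw,
      hw.continuousAt.eventually (ContDiffAt.eventually_differentiableAt hL)] with r h1 h2
    exact (h2.hasFDerivAt.comp_hasDerivAt r h1.hasDerivAt).deriv
  rw [h1.deriv_eq]
  have h2 : DifferentiableAt ℝ (fderiv ℝ L) (w s) :=
    (hL.fderiv_right (m := ∞) (by simp)).differentiableAt (by simp)
  have h3 := h2.hasFDerivAt.comp_hasDerivAt s (hw.differentiableAt (by simp)).hasDerivAt
  have h4 : HasDerivAt (deriv w) (deriv (deriv w) s) s :=
    ((ContDiffAt.deriv' hw).differentiableAt (by simp)).hasDerivAt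
  simpa using (h3.clm_apply h4).deriv

/-- A term linear in `s` leaves the second derivative of the curve unchanged. So the first-order
part of the Taylor formula is the same, and only the Hessian term is expanded. -/
theorem deriv_deriv_comp_add_smul {L : E → ℝ} {w : ℝ → E} (hL : ContDiffAt ℝ ∞ L (w 0))
    (hw : ContDiffAt ℝ ∞ w 0) (η : E) :
    deriv (deriv fun s => L (w s + s • η)) 0 = deriv (deriv fun s => L (w s)) 0
      + (2 * fderiv ℝ (fderiv ℝ L) (w 0) (deriv w 0) η + fderiv ℝ (fderiv ℝ L) (w 0) η η) := by
  have hd : deriv (fun s => w s + s • η) =ᶠ[𝓝 0] fun s => deriv w s + η := by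
    filter_upwards [ContDiffAt.eventually_differentiableAt hw] with r hr
    simpa using (hr.hasDerivAt.fun_add ((hasDerivAt_id r).smul_const η)).deriv
  have hdd : deriv (deriv fun s => w s + s • η) 0 = deriv (deriv w) 0 := by
    rw [hd.deriv_eq, deriv_add_const]
  have h0 : w 0 + (0 : ℝ) • η = w 0 := by simp
  have hw' : ContDiffAt ℝ ∞ (fun s : ℝ => w s + s • η) 0 := hw.add (by fun_prop)
  have hsymm := hL.isSymmSndFDerivAt minSmoothness_two_le η (deriv w 0)
  rw [deriv_deriv_comp_curve (by rwa [h0]) hw', deriv_deriv_comp_curve hL hw, hdd,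
    hd.self_of_nhds, h0]
  simp only [map_add, add_apply, hsymm]
  ring

end Calculus

variable {n : ℕ} {M : Type*} [TopologicalSpace M] [ChartedSpace (Vec n) M]

section

variable [IsManifold (𝓡 n) ∞ M]

variable {γ : ℝ → ℝ → M} {ε a b : ℝ} {q : M}

theorem slab_mem_nhds (hε : 0 < ε) {t : ℝ} (ht : t ∈ Ioo a b) : slab ε a b ∈ 𝓝 (0, t) :=
  prod_mem_nhds (isOpen_Ioo.mem_nhds ⟨by simpa using hε, hε⟩) (Icc_mem_nhds ht.1 ht.2)

theorem SmoothFamily.contDiffAt_coord (h : SmoothFamily (n := n) γ ε a b) (hε : 0 < ε) {t : ℝ}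
    (ht : t ∈ Ioo a b) (hq : γ 0 t ∈ (extChartAt (𝓡 n) q).source) :
    ContDiffAt ℝ ∞ (fun z : ℝ × ℝ => coordCurve (n := n) q (γ z.1) z.2) (0, t) := by
  obtain ⟨O, hO, hOq, hu⟩ := h.exists_coord q
  have hs := slab_mem_nhds hε ht
  exact hu.contDiffAt (inter_mem hs (hO.mem_nhds ((hOq _ (mem_of_mem_nhds hs)).2 hq)))

theorem SmoothFamily.eventually_mem_source (h : SmoothFamily (n := n) γ ε a b) (hε : 0 < ε)
    {t : ℝ} (ht : t ∈ Ioo a b) (hq : γ 0 t ∈ (extChartAt (𝓡 n) q).source) :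
    ∀ᶠ z : ℝ × ℝ in 𝓝 (0, t), γ z.1 z.2 ∈ (extChartAt (𝓡 n) q).source := by
  obtain ⟨O, hO, hOq, hu⟩ := h.exists_coord q
  have hs := slab_mem_nhds hε ht
  filter_upwards [hs, hO.mem_nhds ((hOq _ (mem_of_mem_nhds hs)).2 hq)] with z h1 h2
  exact (hOq z h1).1 h2

theorem SmoothFamily.eventually_apply_velocity (h : SmoothFamily (n := n) γ ε a b) (hε : 0 < ε)
    (F : FinslerMetric n M) (p : ℝ)
    {t : ℝ} (ht : t ∈ Ioo a b) (hq : γ 0 t ∈ (extChartAt (𝓡 n) q).source) :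
    ∀ᶠ z : ℝ × ℝ in 𝓝 (0, t), speedPow F p (γ z.1) z.2
      = lagrangian (localExpr F.toFun q) p
        (coordCurve (n := n) q (γ z.1) z.2, deriv (coordCurve (n := n) q (γ z.1)) z.2) := by
  have hz : (Ioo (-ε) ε) ×ˢ (Ioo a b) ∈ 𝓝 ((0 : ℝ), t) :=
    prod_mem_nhds (isOpen_Ioo.mem_nhds ⟨by simpa using hε, hε⟩) (isOpen_Ioo.mem_nhds ht)
  filter_upwards [hz, h.eventually_mem_source hε ht hq] with z h1 h2
  have hI := Icc_mem_nhds h1.2.1 h1.2.2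
  have := apply_velocity F.toFun (h.mdifferentiableWithinAt h1.1 (Ioo_subset_Icc_self h1.2))
    (uniqueDiffWithinAt_of_mem_nhds hI) h2
  simp only [mfderivWithin_of_mem_nhds hI, derivWithin_of_mem_nhds hI] at this
  simp only [speedPow, lagrangian, this]

theorem SmoothFamily.secondVar_eq (h : SmoothFamily (n := n) γ ε a b) (hε : 0 < ε)
    (F : FinslerMetric n M) (p : ℝ)
    {t : ℝ} (ht : t ∈ Ioo a b) (hq : γ 0 t ∈ (extChartAt (𝓡 n) q).source) :
    secondVar F p γ t = deriv (deriv fun s => lagrangian (localExpr F.toFun q) p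
        (coordCurve (n := n) q (γ s) t, deriv (coordCurve (n := n) q (γ s)) t)) 0 := by
  have hs : Tendsto (fun r : ℝ => (r, t)) (𝓝 0) (𝓝 (0, t)) :=
    (Continuous.prodMk_left t).continuousAt
  have := hs.eventually (h.eventually_apply_velocity hε F p ht hq)
  exact (Filter.EventuallyEq.deriv this).deriv_eq

open Classical in
/-- The family obtained from `γ` by adding `s v(t)` in the chart at `q`, for `t ∈ K`. -/
def shift (q : M) (K : Set ℝ) (v : ℝ → Vec n) (γ : ℝ → ℝ → M) (s t : ℝ) : M :=
  if t ∈ K then (extChartAt (𝓡 n) q).symm (extChartAt (𝓡 n) q (γ s t) + s • v t) else γ s t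

variable {K : Set ℝ} {v : ℝ → Vec n}

omit [IsManifold (𝓡 n) ∞ M] in
theorem shift_of_source {s t : ℝ} (hv : t ∉ K → v t = 0)
    (hq : γ s t ∈ (extChartAt (𝓡 n) q).source) :
    shift q K v γ s t = (extChartAt (𝓡 n) q).symm (extChartAt (𝓡 n) q (γ s t) + s • v t) := by
  unfold shift
  split_ifs with ht
  · rfl
  · rw [hv ht, smul_zero, add_zero, (extChartAt (𝓡 n) q).left_inv hq]

omit [IsManifold (𝓡 n) ∞ M] in
theorem shift_of_notMem {s t : ℝ} (ht : t ∉ K) : shift q K v γ s t = γ s t := if_neg ht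

omit [IsManifold (𝓡 n) ∞ M] in
theorem shift_of_eq_zero {s t : ℝ} (hv : v t = 0)
    (hq : t ∈ K → γ s t ∈ (extChartAt (𝓡 n) q).source) :
    shift q K v γ s t = γ s t := by
  unfold shift
  split_ifs with ht
  · rw [hv, smul_zero, add_zero, (extChartAt (𝓡 n) q).left_inv (hq ht)]
  · rfl

omit [IsManifold (𝓡 n) ∞ M] in
theorem shift_zero {t : ℝ} (hq : t ∈ K → γ 0 t ∈ (extChartAt (𝓡 n) q).source) :
    shift q K v γ 0 t = γ 0 t := by
  unfold shift
  split_ifs with ht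
  · rw [zero_smul, add_zero, (extChartAt (𝓡 n) q).left_inv (hq ht)]
  · rfl

/-- Near times in `K` the shifted family is given by a smooth formula in the chart; near the other
times it is `γ`. The two descriptions agree on overlaps because `v` vanishes off `K`. Compactness of
`[a, b]` keeps the shifted points in the chart for a uniform range of `s`. -/
theorem SmoothFamily.exists_shift (h : SmoothFamily (n := n) γ ε a b) (hε : 0 < ε)
    (hK : IsClosed K) (hv : ContDiffOn ℝ ∞ v (Icc a b)) (hvK : ∀ t ∉ K, v t = 0)
    (hq : ∀ t ∈ K ∩ Icc a b, γ 0 t ∈ (extChartAt (𝓡 n) q).source) :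
    ∃ δ > 0, δ ≤ ε ∧ SmoothFamily (n := n) (shift q K v γ) δ a b ∧
      ∀ s ∈ Ioo (-δ) δ, ∀ t ∈ Icc a b, t ∈ K → γ s t ∈ (extChartAt (𝓡 n) q).source ∧
        extChartAt (𝓡 n) q (γ s t) + s • v t ∈ (extChartAt (𝓡 n) q).target := by
  obtain ⟨O, hO, hOq, hu⟩ := h.exists_coord q
  have hw : ContDiffOn ℝ ∞ (fun z : ℝ × ℝ => coordCurve (n := n) q (γ z.1) z.2 + z.1 • v z.2)
      (slab ε a b ∩ O) :=
    hu.add (contDiffOn_fst.smul (hv.comp contDiffOn_snd fun z hz => hz.1.2))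
  obtain ⟨O', hO', hO'q⟩ := continuousOn_iff'.1 hw.continuousOn _ (chart_target_isOpen (n := n) q)
  have hgood : ∀ z ∈ slab ε a b ∩ (O' ∩ O), γ z.1 z.2 ∈ (extChartAt (𝓡 n) q).source ∧
      extChartAt (𝓡 n) q (γ z.1 z.2) + z.1 • v z.2 ∈ (extChartAt (𝓡 n) q).target := by
    intro z hz
    refine ⟨(hOq z hz.1).1 hz.2.2, ?_⟩
    have : z ∈ O' ∩ (slab ε a b ∩ O) := ⟨hz.2.1, hz.1, hz.2.2⟩
    rw [← hO'q] at this
    exact this.1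
  have hgood' : ∀ z ∈ slab ε a b, γ z.1 z.2 ∈ (extChartAt (𝓡 n) q).source →
      extChartAt (𝓡 n) q (γ z.1 z.2) + z.1 • v z.2 ∈ (extChartAt (𝓡 n) q).target →
      z ∈ O' ∩ O := by
    intro z hz h1 h2
    have hzO := (hOq z hz).2 h1
    have : z ∈ (fun z : ℝ × ℝ => coordCurve (n := n) q (γ z.1) z.2 + z.1 • v z.2) ⁻¹'
      (extChartAt (𝓡 n) q).target ∩ (slab ε a b ∩ O) := ⟨h2, hz, hzO⟩
    rw [hO'q] at this
    exact ⟨this.1, hzO⟩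
  have hev : ∀ t ∈ Icc a b, ∀ᶠ z : ℝ × ℝ in 𝓝 (0, t), z ∈ slab ε a b →
      (z.2 ∈ K → γ z.1 z.2 ∈ (extChartAt (𝓡 n) q).source ∧
        extChartAt (𝓡 n) q (γ z.1 z.2) + z.1 • v z.2 ∈ (extChartAt (𝓡 n) q).target) := by
    intro t ht
    by_cases htK : t ∈ K
    · have h0 : ((0 : ℝ), t) ∈ slab ε a b := ⟨⟨by simpa using hε, hε⟩, ht⟩
      have hsrc := hq t ⟨htK, ht⟩
      have hOO := hgood' _ h0 hsrc (by simpa using (extChartAt (𝓡 n) q).map_source hsrc)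
      filter_upwards [(hO'.inter hO).mem_nhds hOO] with z hz hzs _ using hgood z ⟨hzs, hz⟩
    · filter_upwards [(hK.isOpen_compl.preimage continuous_snd).mem_nhds htK] with z hz _ hzK
      exact absurd hzK hz
  obtain ⟨δ, hδ, hδε, hP⟩ := exists_slab_of_eventually (a := a) (b := b)
    (P := fun s t => t ∈ K → γ s t ∈ (extChartAt (𝓡 n) q).source ∧
        extChartAt (𝓡 n) q (γ s t) + s • v t ∈ (extChartAt (𝓡 n) q).target) hε hev
  refine ⟨δ, hδ, hδε, ?_, hP⟩
  intro z hz
  by_cases hzK : z.2 ∈ K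
  · have h1 := hP z.1 hz.1 z.2 hz.2 hzK
    have hzO := hgood' z (slab_mono hδε hz) h1.1 h1.2
    have h2 : ContMDiffOn 𝓘(ℝ, ℝ × ℝ) (𝓡 n) ∞ (fun z : ℝ × ℝ => (extChartAt (𝓡 n) q).symm
        (coordCurve (n := n) q (γ z.1) z.2 + z.1 • v z.2)) (slab δ a b ∩ (O' ∩ O)) :=
      contMDiffOn_of_coord (hw.mono (inter_subset_inter (slab_mono hδε) inter_subset_right))
        fun z hz => (hgood z ⟨slab_mono hδε hz.1, hz.2⟩).2
    have h3 : ContMDiffOn 𝓘(ℝ, ℝ × ℝ) (𝓡 n) ∞ (fun z : ℝ × ℝ => shift q K v γ z.1 z.2)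
        (slab δ a b ∩ (O' ∩ O)) := h2.congr fun z hz =>
      shift_of_source (hvK z.2) (hgood z ⟨slab_mono hδε hz.1, hz.2⟩).1
    exact (h3 z ⟨hz, hzO⟩).mono_of_mem_nhdsWithin
      (inter_mem_nhdsWithin _ ((hO'.inter hO).mem_nhds hzO))
  · refine ContMDiffWithinAt.congr_of_eventuallyEq ((h.mono hδε) z hz) ?_ (shift_of_notMem hzK)
    filter_upwards [mem_nhdsWithin_of_mem_nhds
      ((hK.isOpen_compl.preimage continuous_snd).mem_nhds hzK)] with w hw
    exact shift_of_notMem hw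

/-- The effect of a shift on the second derivative of the integrand of the energy. -/
theorem SmoothFamily.secondVar_shift (h : SmoothFamily (n := n) γ ε a b) (hε : 0 < ε)
    (F : FinslerMetric n M) (p : ℝ) (hK : IsClosed K) (hv : ContDiff ℝ ∞ v)
    (hvK : ∀ t ∉ K, v t = 0)
    (hq : ∀ t ∈ K ∩ Icc a b, γ 0 t ∈ (extChartAt (𝓡 n) q).source) {t : ℝ} (ht : t ∈ Ioo a b)
    (hne : mfderivWithin 𝓘(ℝ, ℝ) (𝓡 n) (γ 0) (Icc a b) t (1 : ℝ) ≠ 0) :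
    secondVar F p (shift q K v γ) t = secondVar F p γ t
      + (2 * fderiv ℝ (fderiv ℝ (lagrangian (localExpr F.toFun q) p))
          (coordCurve (n := n) q (γ 0) t, deriv (coordCurve (n := n) q (γ 0)) t)
          (deriv (fun s => (coordCurve (n := n) q (γ s) t,
            deriv (coordCurve (n := n) q (γ s)) t)) 0) (v t, deriv v t)
        + fderiv ℝ (fderiv ℝ (lagrangian (localExpr F.toFun q) p))
          (coordCurve (n := n) q (γ 0) t, deriv (coordCurve (n := n) q (γ 0)) t)
          (v t, deriv v t) (v t, deriv v t)) := by
  by_cases htK : t ∈ K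
  · obtain ⟨δ, hδ, hδε, hsm, hgood⟩ := h.exists_shift hε hK hv.contDiffOn hvK hq
    have hsrc := hq t ⟨htK, Ioo_subset_Icc_self ht⟩
    have hsrc' : shift q K v γ 0 t ∈ (extChartAt (𝓡 n) q).source := by
      rwa [shift_zero fun _ => hsrc]
    have hc := h.contDiffAt_coord hε ht hsrc
    have hev : ∀ᶠ z : ℝ × ℝ in 𝓝 (0, t), coordCurve (n := n) q (shift q K v γ z.1) z.2
        = coordCurve (n := n) q (γ z.1) z.2 + z.1 • v z.2 := by
      have htar : ∀ᶠ z : ℝ × ℝ in 𝓝 (0, t),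
          coordCurve (n := n) q (γ z.1) z.2 + z.1 • v z.2 ∈ (extChartAt (𝓡 n) q).target := by
        have hcont : ContinuousAt (fun z : ℝ × ℝ =>
            coordCurve (n := n) q (γ z.1) z.2 + z.1 • v z.2) (0, t) :=
          hc.continuousAt.add (continuousAt_fst.smul
            (hv.continuous.continuousAt.comp continuousAt_snd))
        refine hcont.eventually ((chart_target_isOpen (n := n) q).mem_nhds ?_)
        simpa [coordCurve] using (extChartAt (𝓡 n) q).map_source hsrc
      filter_upwards [h.eventually_mem_source hε ht hsrc, htar] with z h1 h2
      simp only [coordCurve, shift_of_source (hvK z.2) h1]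
      exact (extChartAt (𝓡 n) q).right_inv h2
    rw [hsm.secondVar_eq hδ F p ht hsrc', h.secondVar_eq hε F p ht hsrc]
    set u : ℝ → ℝ → Vec n := fun s t => coordCurve (n := n) q (γ s) t
    have hw : ContDiffAt ℝ ∞ (fun s => (u s t, deriv (u s) t)) 0 := by
      have h1 : ContDiffAt ℝ ∞ (fun s : ℝ => ((s, t) : ℝ × ℝ)) 0 := by fun_prop
      exact (ContDiffAt.comp (f := fun s : ℝ => ((s, t) : ℝ × ℝ)) (0 : ℝ) hc h1).prodMk
        (ContDiffAt.comp (f := fun s : ℝ => ((s, t) : ℝ × ℝ)) (0 : ℝ)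
          (ContDiffAt.deriv_snd (u := u) hc) h1)
    have hI := Icc_mem_nhds ht.1 ht.2
    have hL : ContDiffAt ℝ ∞ (lagrangian (localExpr F.toFun q) p) (u 0 t, deriv (u 0) t) := by
      refine (F.isLocalFinsler q).contDiffAt_lagrangian p
        ((extChartAt (𝓡 n) q).map_source hsrc) ?_
      have := (velocity_ne_zero_iff (h.mdifferentiableWithinAt ⟨by simpa using hε, hε⟩
        (Ioo_subset_Icc_self ht)) (uniqueDiffWithinAt_of_mem_nhds hI) hsrc).1 hne
      rwa [derivWithin_of_mem_nhds hI] at this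
    rw [← deriv_deriv_comp_add_smul (w := fun s => (u s t, deriv (u s) t)) hL hw]
    refine Filter.EventuallyEq.deriv_eq (Filter.EventuallyEq.deriv ?_)
    have hs : Tendsto (fun r : ℝ => (r, t)) (𝓝 0) (𝓝 (0, t)) :=
      (Continuous.prodMk_left t).continuousAt
    filter_upwards [hs.eventually hev.eventually_nhds,
      hs.eventually (ContDiffAt.eventually_differentiableAt hc)] with s h1 h2
    -- The formula for the shifted curve is needed on a neighbourhood of `t`, and not only at `t`,
    -- so that its time derivative can be taken.
    have h3 : coordCurve (n := n) q (shift q K v γ s) =ᶠ[𝓝 t] fun r => u s r + s • v r := by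
      have : Tendsto (fun r : ℝ => (s, r)) (𝓝 t) (𝓝 (s, t)) :=
        (Continuous.prodMk_right s).continuousAt
      exact this.eventually h1
    have h4 := ((hasDerivAt_snd (u := u) h2).differentiableAt.hasDerivAt.add
      ((hv.differentiable (by simp) t).hasDerivAt.const_smul s)).deriv
    have h5 : deriv (coordCurve (n := n) q (shift q K v γ s)) t = deriv (u s) t + s • deriv v t := by
      rw [h3.deriv_eq]; exact h4
    rw [h5, h3.self_of_nhds]
    rfl
  -- Off `K` the chart need not contain the curve, but `v` and its derivative vanish. The correction
  -- is then zero whatever the coordinate expressions mean, and the shift changes nothing near `t`.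
  · have hv0 : v =ᶠ[𝓝 t] fun _ => 0 := by
      filter_upwards [hK.isOpen_compl.mem_nhds htK] with r hr using hvK r hr
    have hv1 : deriv v t = 0 := by rw [hv0.deriv_eq]; simp
    have e : ((v t, deriv v t) : Vec n × Vec n) = 0 := by rw [hv0.self_of_nhds, hv1]; rfl
    rw [e, map_zero, map_zero, mul_zero, add_zero, add_zero]
    refine congrArg (fun f : ℝ → ℝ => deriv (deriv f) 0) (funext fun s => ?_)
    refine speedPow_congr F p ?_
    filter_upwards [hK.isOpen_compl.mem_nhds htK] with r hr using shift_of_notMem hr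

end

end Finsler
end

/-! ### Legendre's necessary condition -/

noncomputable section

namespace Finsler

/-- Legendre's necessary condition for quadratic functionals. -/
theorem nonneg_of_integral_bump_nonneg {A B C : ℝ → ℝ} {b r₀ : ℝ} (hr₀ : 0 < r₀)
    (hA : ContinuousOn A (Icc (b - r₀) (b + r₀))) (hB : ContinuousOn B (Icc (b - r₀) (b + r₀)))
    (hC : ContinuousOn C (Icc (b - r₀) (b + r₀)))
    (h : ∀ χ : ContDiffBump b, χ.rOut ≤ r₀ →
      0 ≤ ∫ t in (b - χ.rOut)..(b + χ.rOut),
        (deriv χ t ^ 2 * A t + 2 * χ t * deriv χ t * B t + χ t ^ 2 * C t)) : 0 ≤ A b := by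
  by_contra! hneg
  have hbmem : Icc (b - r₀) (b + r₀) ∈ 𝓝 b := Icc_mem_nhds (by linarith) (by linarith)
  obtain ⟨K, hK⟩ := (isCompact_Icc (a := b - r₀) (b := b + r₀)).exists_bound_of_continuousOn hB
  obtain ⟨K', hK'⟩ := (isCompact_Icc (a := b - r₀) (b := b + r₀)).exists_bound_of_continuousOn hC
  set α := -A b / 2 with hα
  have hα0 : 0 < α := by rw [hα]; linarith
  have hAb : ∀ᶠ t in 𝓝 b, A t < -α :=
    (hA.continuousAt hbmem).eventually (gt_mem_nhds (by rw [hα]; linarith))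
  obtain ⟨r₁, hr₁, hAr⟩ := Metric.eventually_nhds_iff.1 hAb
  -- `D` is chosen so that the mixed term is absorbed by half of `α χ'²`, via the inequality between
  -- arithmetic and geometric means. The remainder `2 K² / α` and the bound `K'` for the
  -- zeroth-order term add up to `D`.
  set D := 2 * K ^ 2 / α + K' with hD
  have hD0 : 0 ≤ D := add_nonneg (by positivity)
    ((norm_nonneg _).trans (hK' b (mem_of_mem_nhds hbmem)))
  -- a small radius
  obtain ⟨r, hr, hr0, hr1, hr2⟩ : ∃ r > 0, r ≤ r₀ ∧ r < r₁ ∧ 2 * r * D < α / 2 * (1 / r) := by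
    have h1 : Tendsto (fun r : ℝ => 2 * r * D * r) (𝓝[>] 0) (𝓝 0) := by
      refine (Continuous.tendsto' (by fun_prop) 0 0 (by simp)).mono_left nhdsWithin_le_nhds
    have h2 := h1.eventually (gt_mem_nhds (show (0 : ℝ) < α / 2 by linarith))
    have h3 : ∀ᶠ r in 𝓝[>] (0 : ℝ), r ∈ Ioc 0 r₀ := Ioc_mem_nhdsGT hr₀
    have h4 : ∀ᶠ r in 𝓝[>] (0 : ℝ), r ∈ Ioo 0 r₁ := Ioo_mem_nhdsGT hr₁
    obtain ⟨r, h2, h3, h4⟩ := (h2.and (h3.and h4)).exists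
    refine ⟨r, h3.1, h3.2, h4.2, ?_⟩
    rw [mul_one_div, lt_div_iff₀ h3.1]
    exact h2
  let χ : ContDiffBump b := ⟨r / 2, r, by linarith, by linarith⟩
  have hχ := h χ hr0
  have hχR : χ.rOut = r := rfl
  rw [hχR] at hχ
  have hcd : Continuous (deriv χ) := (χ.contDiff (n := 1)).continuous_deriv le_rfl
  have hsub : Icc (b - r) (b + r) ⊆ Icc (b - r₀) (b + r₀) :=
    Icc_subset_Icc (by linarith) (by linarith)
  have hbound : ∀ t ∈ Icc (b - r) (b + r),
      deriv χ t ^ 2 * A t + 2 * χ t * deriv χ t * B t + χ t ^ 2 * C t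
        ≤ -(α / 2) * deriv χ t ^ 2 + D := by
    intro t ht
    have h1 : A t < -α := hAr (by rw [Real.dist_eq, abs_lt]; constructor <;> linarith [ht.1, ht.2])
    have h2 := hK t (hsub ht)
    have h3 := hK' t (hsub ht)
    rw [Real.norm_eq_abs] at h2 h3
    have hx0 : 0 ≤ χ t := χ.nonneg
    have hx1 : χ t ≤ 1 := χ.le_one
    set x := χ t
    set d := deriv χ t
    have hx2 : x ^ 2 ≤ 1 := by nlinarith
    have e1 : d ^ 2 * A t ≤ -α * d ^ 2 := by nlinarith [sq_nonneg d]
    have e2 : x ^ 2 * C t ≤ K' := by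
      have : C t ≤ K' := (le_abs_self _).trans h3
      have h0 : 0 ≤ K' := (abs_nonneg _).trans h3
      nlinarith [sq_nonneg x]
    have hB2 : B t ^ 2 ≤ K ^ 2 := by rw [← sq_abs]; exact pow_le_pow_left₀ (abs_nonneg _) h2 2
    have e3 : 2 * x * d * B t ≤ α / 2 * d ^ 2 + 2 * K ^ 2 / α := by
      have h4 : 2 * x * d * B t ≤ α / 2 * d ^ 2 + 2 * (x * B t) ^ 2 / α := by
        have : 0 ≤ (α * d - 2 * (x * B t)) ^ 2 / (2 * α) := by positivity
        have e : (α * d - 2 * (x * B t)) ^ 2 / (2 * α)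
          = α / 2 * d ^ 2 - 2 * x * d * B t + 2 * (x * B t) ^ 2 / α := by field_simp; ring
        linarith
      have h5 : 2 * (x * B t) ^ 2 / α ≤ 2 * K ^ 2 / α := by
        gcongr ?_ / _
        have : (x * B t) ^ 2 ≤ K ^ 2 := by
          rw [mul_pow]; nlinarith [sq_nonneg (B t), sq_nonneg x]
        linarith
      linarith
    rw [hD]; linarith
  have hI1 : IntervalIntegrable (fun t => deriv χ t ^ 2 * A t + 2 * χ t * deriv χ t * B t
      + χ t ^ 2 * C t) MeasureTheory.volume (b - r) (b + r) := by
    refine ContinuousOn.intervalIntegrable ?_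
    rw [uIcc_of_le (by linarith)]
    have := χ.continuous
    exact ((hcd.pow 2).continuousOn.mul (hA.mono hsub)).add
      ((((continuous_const.mul this).mul hcd).continuousOn.mul (hB.mono hsub))) |>.add
      ((this.pow 2).continuousOn.mul (hC.mono hsub))
  have hI2 : ∀ a b, IntervalIntegrable (fun t => deriv χ t ^ 2) MeasureTheory.volume a b :=
    fun a b => (hcd.pow 2).intervalIntegrable a b
  have hle := intervalIntegral.integral_mono_on (by linarith) hI1
    (((hI2 _ _).const_mul (-(α / 2))).add intervalIntegrable_const) hbound
  rw [intervalIntegral.integral_add ((hI2 _ _).const_mul _) intervalIntegrable_const,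
    intervalIntegral.integral_const_mul, intervalIntegral.integral_const] at hle
  -- the Dirichlet integral of the bump
  have hdir : 1 / r ≤ ∫ t in (b - r)..(b + r), deriv χ t ^ 2 := by
    have h1 : ∫ t in (b - r)..b, deriv χ t = 1 := by
      rw [intervalIntegral.integral_deriv_eq_sub (fun t _ => (χ.contDiff (n := 1)).differentiable
        (by simp) t) (hcd.intervalIntegrable _ _),
        χ.one_of_mem_closedBall (Metric.mem_closedBall_self χ.rIn_pos.le),
        χ.zero_of_le_dist (by simp [hχR, abs_of_pos hr]), sub_zero]
    -- Cauchy–Schwarz on `[b - r, b]`, where `χ` rises from `0` to `1`: integrate `(χ' - 1/r)² ≥ 0`.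
    have h2 : ∫ t in (b - r)..b, (2 / r * deriv χ t - 1 / r ^ 2) = 1 / r := by
      rw [intervalIntegral.integral_sub ((hcd.intervalIntegrable _ _).const_mul _)
        intervalIntegrable_const, intervalIntegral.integral_const_mul, h1,
        intervalIntegral.integral_const]
      simp only [sub_sub_cancel, smul_eq_mul]
      field_simp
      ring
    have h3 : ∫ t in (b - r)..b, (2 / r * deriv χ t - 1 / r ^ 2)
        ≤ ∫ t in (b - r)..b, deriv χ t ^ 2 := by
      refine intervalIntegral.integral_mono_on (by linarith)
        (((hcd.intervalIntegrable _ _).const_mul _).sub intervalIntegrable_const) (hI2 _ _) ?_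
      intro t _
      have : 0 ≤ (deriv χ t - 1 / r) ^ 2 := sq_nonneg _
      have e : (deriv χ t - 1 / r) ^ 2 = deriv χ t ^ 2 - (2 / r * deriv χ t - 1 / r ^ 2) := by ring
      linarith
    have h4 : 0 ≤ ∫ t in b..(b + r), deriv χ t ^ 2 :=
      intervalIntegral.integral_nonneg (by linarith) fun t _ => sq_nonneg _
    rw [← intervalIntegral.integral_add_adjacent_intervals (hI2 (b - r) b) (hI2 b (b + r))]
    linarith
  have : (b + r - (b - r)) • D = 2 * r * D := by
    rw [smul_eq_mul]; ring
  rw [this] at hle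
  -- The integral is at most `-(α / 2) / r + 2 r D`, negative by the choice of `r`.
  nlinarith

variable {n : ℕ} {M : Type*} [TopologicalSpace M] [ChartedSpace (Vec n) M]

section

variable [IsManifold (𝓡 n) ∞ M]

omit [IsManifold (𝓡 n) ∞ M] in
theorem smoothFamily_const {c : ℝ → M} {a b a' b' : ℝ}
    (hc : ContMDiffOn 𝓘(ℝ, ℝ) (𝓡 n) ∞ c (Icc a b)) (h : Icc a' b' ⊆ Icc a b) (ε : ℝ) :
    SmoothFamily (n := n) (fun _ => c) ε a' b' :=
  ContMDiffOn.comp (f := fun z : ℝ × ℝ => z.2) hc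
    (contMDiffOn_iff_contDiffOn.2 contDiffOn_snd) fun _ hz => h hz.2

omit [IsManifold (𝓡 n) ∞ M] in
theorem exists_closedBall_subset_source {c : ℝ → M} (hc : ContinuousOn c (Icc 0 1)) {b : ℝ}
    (hb : b ∈ Ioo (0 : ℝ) 1) :
    ∃ r > 0, Icc (b - r) (b + r) ⊆ Ioo 0 1 ∧
      ∀ t ∈ Icc (b - r) (b + r), c t ∈ (extChartAt (𝓡 n) (c b)).source := by
  have h1 : ∀ᶠ t in 𝓝 b, c t ∈ (extChartAt (𝓡 n) (c b)).source :=
    (hc.continuousAt (Icc_mem_nhds hb.1 hb.2)).eventually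
      (extChartAt_source_mem_nhds (I := 𝓡 n) (c b))
  obtain ⟨r, hr, h⟩ := Metric.nhds_basis_closedBall.mem_iff.1
    (h1.and (isOpen_Ioo.mem_nhds hb) : {t | _} ∈ 𝓝 b)
  rw [Real.closedBall_eq_Icc] at h
  exact ⟨r, hr, fun t ht => (h ht).2, fun t ht => (h ht).1⟩

/-- Legendre's necessary condition for the `p`-energy. -/
theorem legendre_condition (F : FinslerMetric n M) (p : ℝ) {x₀ x₁ : M} {c : ℝ → M}
    (hc : c ∈ pathSpace (n := n) x₀ x₁) (hs : ContMDiffOn 𝓘(ℝ, ℝ) (𝓡 n) ∞ c (Icc 0 1))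
    {b : ℝ} (hb : b ∈ Ioo (0 : ℝ) 1) (e : Vec n) :
    (IsMinimum F p x₀ x₁ c → 0 ≤ fderiv ℝ (fderiv ℝ (lagrangian (localExpr F.toFun (c b)) p))
      (coordCurve (c b) c b, deriv (coordCurve (n := n) (c b) c) b) (0, e) (0, e)) ∧
    (IsMaximum F p x₀ x₁ c → fderiv ℝ (fderiv ℝ (lagrangian (localExpr F.toFun (c b)) p))
      (coordCurve (c b) c b, deriv (coordCurve (n := n) (c b) c) b) (0, e) (0, e) ≤ 0) := by
  obtain ⟨r₀, hr₀, hr01, hsrc⟩ := exists_closedBall_subset_source (n := n) hs.continuousOn hb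
  set q := c b
  set u := coordCurve (n := n) q c
  set L := lagrangian (localExpr F.toFun q) p
  set Q : ℝ → (Vec n × Vec n) →L[ℝ] (Vec n × Vec n) →L[ℝ] ℝ :=
    fun t => fderiv ℝ (fderiv ℝ L) (u t, deriv u t) with hQ
  have hloc := F.isLocalFinsler q
  have hcu : ∀ t ∈ Icc (b - r₀) (b + r₀), ContDiffAt ℝ ∞ u t := by
    intro t ht
    have hfam := smoothFamily_const (n := n) hs le_rfl 1
    exact (hfam.contDiffAt_coord one_pos (hr01 ht) (hsrc t ht)).comp t
      (f := fun t : ℝ => ((0, t) : ℝ × ℝ)) (by fun_prop)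
  have hvel : ∀ t ∈ Icc (b - r₀) (b + r₀), deriv u t ≠ 0 := by
    intro t ht
    have ht1 := Ioo_subset_Icc_self (hr01 ht)
    have hI := Icc_mem_nhds (hr01 ht).1 (hr01 ht).2
    have := (velocity_ne_zero_iff ((hs t ht1).mdifferentiableWithinAt (by simp))
      (uniqueDiffWithinAt_of_mem_nhds hI) (hsrc t ht)).1
      (velocity_ne_zero_of_mem_pathSpace hc hs one_pos le_rfl ht1)
    rwa [derivWithin_of_mem_nhds hI] at this
  have hQc : ContinuousOn Q (Icc (b - r₀) (b + r₀)) := by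
    intro t ht
    have hL := hloc.contDiffAt_lagrangian p ((extChartAt (𝓡 n) q).map_source (hsrc t ht)) (hvel t ht)
    have h2 : ContinuousAt (fderiv ℝ (fderiv ℝ L)) (u t, deriv u t) :=
      ((hL.fderiv_right (m := ∞) (by simp)).fderiv_right (m := ∞) (by simp)).continuousAt
    exact (h2.comp (f := fun t => (u t, deriv u t)) ((hcu t ht).continuousAt.prodMk
      (ContDiffAt.deriv' (hcu t ht)).continuousAt)).continuousWithinAt
  have hsymm : ∀ t ∈ Icc (b - r₀) (b + r₀), ∀ v w, Q t v w = Q t w v := by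
    intro t ht v w
    exact (hloc.contDiffAt_lagrangian p ((extChartAt (𝓡 n) q).map_source (hsrc t ht))
      (hvel t ht)).isSymmSndFDerivAt minSmoothness_two_le v w
  set A : ℝ → ℝ := fun t => Q t (0, e) (0, e)
  set B : ℝ → ℝ := fun t => Q t (e, 0) (0, e)
  set C : ℝ → ℝ := fun t => Q t (e, 0) (e, 0)
  have hA : ContinuousOn A (Icc (b - r₀) (b + r₀)) :=
    (hQc.clm_apply continuousOn_const).clm_apply continuousOn_const
  have hB : ContinuousOn B (Icc (b - r₀) (b + r₀)) :=
    (hQc.clm_apply continuousOn_const).clm_apply continuousOn_const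
  have hC : ContinuousOn C (Icc (b - r₀) (b + r₀)) :=
    (hQc.clm_apply continuousOn_const).clm_apply continuousOn_const
  -- The test variation moves `c` in the fixed coordinate direction `e` by `s χ`. Since the
  -- unshifted family is constant in `s`, its second variation is exactly the Hessian evaluated on
  -- `(χ e, χ' e)`.
  have key : ∀ χ : ContDiffBump b, χ.rOut ≤ r₀ →
      (IsMinimum F p x₀ x₁ c → 0 ≤ ∫ t in (b - χ.rOut)..(b + χ.rOut),
        (deriv χ t ^ 2 * A t + 2 * χ t * deriv χ t * B t + χ t ^ 2 * C t)) ∧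
      (IsMaximum F p x₀ x₁ c → ∫ t in (b - χ.rOut)..(b + χ.rOut),
        (deriv χ t ^ 2 * A t + 2 * χ t * deriv χ t * B t + χ t ^ 2 * C t) ≤ 0) := by
    intro χ hχ
    set r := χ.rOut
    have hr : 0 < r := χ.rOut_pos
    set K := Icc (b - r) (b + r)
    have hKsub : K ⊆ Icc (b - r₀) (b + r₀) := Icc_subset_Icc (by linarith) (by linarith)
    set v : ℝ → Vec n := fun t => χ t • e
    have hv : ContDiff ℝ ∞ v := χ.contDiff.smul contDiff_const
    have hχK : ∀ t ∉ K, χ t = 0 := fun t ht => χ.zero_of_le_dist (by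
      by_contra! h
      rw [Real.dist_eq, abs_lt] at h
      exact ht ⟨by linarith, by linarith⟩)
    have hvK : ∀ t ∉ K, v t = 0 := fun t ht => by simp only [v, hχK t ht, zero_smul]
    have hdv : ∀ t, deriv v t = deriv χ t • e := fun t =>
      ((χ.contDiff (n := 1)).differentiable (by simp) t).hasDerivAt.smul_const e |>.deriv
    have hb1 : Icc (0 : ℝ) b ⊆ Icc 0 1 := Icc_subset_Icc le_rfl hb.2.le
    have hb2 : Icc b 1 ⊆ Icc (0 : ℝ) 1 := Icc_subset_Icc hb.1.le le_rfl
    have hf1 := smoothFamily_const (n := n) hs hb1 1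
    have hf2 := smoothFamily_const (n := n) hs hb2 1
    have hsK : ∀ t ∈ K, c t ∈ (extChartAt (𝓡 n) q).source := fun t ht => hsrc t (hKsub ht)
    obtain ⟨δ1, hδ1, -, hs1, -⟩ := hf1.exists_shift one_pos isClosed_Icc hv.contDiffOn hvK
      (K := K) fun t ht => hsK t ht.1
    obtain ⟨δ2, hδ2, -, hs2, -⟩ := hf2.exists_shift one_pos isClosed_Icc hv.contDiffOn hvK
      (K := K) fun t ht => hsK t ht.1
    have h0K : (0 : ℝ) ∉ K := fun h => lt_irrefl _ (hr01 (hKsub h)).1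
    have h1K : (1 : ℝ) ∉ K := fun h => lt_irrefl _ (hr01 (hKsub h)).2
    -- This variation is smooth across `b`, which serves merely as a dummy corner.
    obtain ⟨i1, i2, hmin, hmax⟩ := second_variation F p hc hs hb (lt_min hδ1 hδ2)
      (hs1.mono (min_le_left _ _)) (hs2.mono (min_le_right _ _))
      (fun t _ => shift_zero fun h => hsK t h)
      (fun s _ => ⟨by rw [shift_of_notMem h0K]; exact hc.1,
        by rw [shift_of_notMem h1K]; exact hc.2.1⟩)
    set g : ℝ → ℝ := fun t => deriv χ t ^ 2 * A t + 2 * χ t * deriv χ t * B t + χ t ^ 2 * C t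
    have hform : ∀ a' b', a' < b' → Icc a' b' ⊆ Icc (0 : ℝ) 1 → EqOn
        (secondVar F p (shift q K v fun _ => c)) g (Ioo a' b') := by
      intro a' b' hab hsub t ht
      have h1 := (smoothFamily_const (n := n) hs hsub 1).secondVar_shift one_pos F p
        isClosed_Icc hv hvK (K := K) (fun t ht => hsK t ht.1) ht
        (velocity_ne_zero_of_mem_pathSpace hc hs hab hsub (Ioo_subset_Icc_self ht))
      rw [h1]
      have h2 : secondVar F p (fun _ => c) t = 0 := by simp [secondVar]
      rw [h2, deriv_const, map_zero, zero_apply, mul_zero, zero_add, zero_add, hdv]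
      change Q t (χ t • e, deriv χ t • e) (χ t • e, deriv χ t • e) = g t
      have h3 : ((χ t • e, deriv χ t • e) : Vec n × Vec n)
        = χ t • (e, 0) + deriv χ t • (0, e) := by simp
      by_cases htK : t ∈ K
      · rw [h3]
        simp only [map_add, map_smul, add_apply, smul_apply, smul_eq_mul,
          hsymm t (hKsub htK) (0, e) (e, 0), g, A, B, C]
        ring
      · have hd0 : deriv χ t = 0 := by
          have : (χ : ℝ → ℝ) =ᶠ[𝓝 t] fun _ => 0 := by
            filter_upwards [isClosed_Icc.isOpen_compl.mem_nhds htK] with r hr using hχK r hr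
          rw [this.deriv_eq, deriv_const]
        simp only [g, hd0, hχK t htK, zero_smul]
        exact (map_zero (Q t (0, 0))).trans (by simp)
    rw [intervalIntegral.integral_congr_Ioo_of_le hb.1.le (hform 0 b hb.1 hb1),
      intervalIntegral.integral_congr_Ioo_of_le hb.2.le (hform b 1 hb.2 hb2)] at hmin hmax
    have j1 := i1.congr_uIoo (by rw [uIoo_of_le hb.1.le]; exact hform 0 b hb.1 hb1)
    have j2 := i2.congr_uIoo (by rw [uIoo_of_le hb.2.le]; exact hform b 1 hb.2 hb2)
    have hl : 0 < b - r := (hr01 (hKsub ⟨le_rfl, by linarith⟩)).1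
    have hu : b + r < 1 := (hr01 (hKsub ⟨by linarith, le_rfl⟩)).2
    have hg0 : ∀ t ∉ K, g t = 0 := by
      intro t htK
      have hd0 : deriv χ t = 0 := by
        have : (χ : ℝ → ℝ) =ᶠ[𝓝 t] fun _ => 0 := by
          filter_upwards [isClosed_Icc.isOpen_compl.mem_nhds htK] with r hr using hχK r hr
        rw [this.deriv_eq, deriv_const]
      simp [g, hd0, hχK t htK]
    -- The integrand vanishes off `K`, which lies inside `(0, 1)`. So the integral over `K` is the
    -- one over `[0, 1]`.
    have hint : (∫ t in (b - r)..(b + r), g t) = (∫ t in 0..b, g t) + ∫ t in b..1, g t := by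
      rw [intervalIntegral.integral_add_adjacent_intervals j1 j2]
      have hJ := j1.trans j2
      have z1 : ∫ t in 0..(b - r), g t = 0 := by
        rw [intervalIntegral.integral_congr_Ioo_of_le (g := fun _ => 0) hl.le
          fun t ht => hg0 t fun h => absurd h.1 (not_le.2 ht.2)]
        simp
      have z2 : ∫ t in (b + r)..1, g t = 0 := by
        rw [intervalIntegral.integral_congr_Ioo_of_le (g := fun _ => 0) hu.le
          fun t ht => hg0 t fun h => absurd h.2 (not_le.2 ht.1)]
        simp
      have k1 : IntervalIntegrable g MeasureTheory.volume 0 (b - r) := hJ.mono_set (by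
        rw [uIcc_of_le hl.le, uIcc_of_le zero_le_one]; exact Icc_subset_Icc le_rfl (by linarith))
      have k2 : IntervalIntegrable g MeasureTheory.volume (b - r) (b + r) := hJ.mono_set (by
        rw [uIcc_of_le (by linarith), uIcc_of_le zero_le_one]
        exact Icc_subset_Icc hl.le hu.le)
      have k3 : IntervalIntegrable g MeasureTheory.volume (b + r) 1 := hJ.mono_set (by
        rw [uIcc_of_le hu.le, uIcc_of_le zero_le_one]; exact Icc_subset_Icc (by linarith) le_rfl)
      rw [← intervalIntegral.integral_add_adjacent_intervals (k1.trans k2) k3,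
        ← intervalIntegral.integral_add_adjacent_intervals k1 k2, z1, z2]
      ring
    rw [hint]
    exact ⟨hmin, hmax⟩
  refine ⟨fun hmin => nonneg_of_integral_bump_nonneg hr₀ hA hB hC fun χ hχ => (key χ hχ).1 hmin,
    fun hmax => ?_⟩
  have := nonneg_of_integral_bump_nonneg hr₀ hA.neg hB.neg hC.neg fun χ hχ => by
    have h1 := (key χ hχ).2 hmax
    have h2 : ∀ t, deriv χ t ^ 2 * (-A) t + 2 * χ t * deriv χ t * (-B) t + χ t ^ 2 * (-C) t
      = -(deriv χ t ^ 2 * A t + 2 * χ t * deriv χ t * B t + χ t ^ 2 * C t) := fun t => by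
      simp only [Pi.neg_apply]; ring
    simp only [h2, intervalIntegral.integral_neg]
    linarith
  simp only [Pi.neg_apply] at this
  linarith

end

end Finsler
end

/-! ### Families with a prescribed variation field -/

noncomputable section

namespace Finsler

variable {n : ℕ} {M : Type*} [TopologicalSpace M] [ChartedSpace (Vec n) M]

section

variable [IsManifold (𝓡 n) ∞ M]

theorem contDiffOn_coordField {c : ℝ → M} {X : (t : ℝ) → TangentSpace (𝓡 n) (c t)} {S : Set ℝ}
    (hX : ContMDiffOn 𝓘(ℝ, ℝ) (𝓡 n).tangent ∞
      (fun t => (⟨c t, X t⟩ : TangentBundle (𝓡 n) M)) S) {q : M}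
    (hq : ∀ t ∈ S, c t ∈ (extChartAt (𝓡 n) q).source) :
    ContDiffOn ℝ ∞ (coordField (n := n) q c X) S := by
  have := isManifold_one (n := n) (M := M)
  have ho := chart_source_isOpen (n := n) q
  have h0 : ContMDiffOn (𝓡 n) 𝓘(ℝ, Vec n) ∞ (extChartAt (𝓡 n) q) (extChartAt (𝓡 n) q).source := by
    rw [extChartAt_source]
    exact contMDiffOn_extChartAt
  have h1 := h0.contMDiffOn_tangentMapWithin (m := ∞) (by simp) ho.uniqueMDiffOn
  have h2 : ContMDiff (𝓘(ℝ, Vec n)).tangent 𝓘(ℝ, Vec n × Vec n) ∞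
      (fun z : TangentBundle 𝓘(ℝ, Vec n) (Vec n) => ((z.1, z.2) : Vec n × Vec n)) := by
    rw [modelWithCornersSelf_prod]
    exact contMDiff_tangentBundleModelSpaceHomeomorph (I := 𝓘(ℝ, Vec n)) (n := ∞)
  have h3 := contMDiffOn_iff_contDiffOn.1 (h2.comp_contMDiffOn (h1.comp hX fun t ht => hq t ht))
  refine (contDiff_snd.comp_contDiffOn h3).congr fun t ht => ?_
  have : mfderivWithin (𝓡 n) 𝓘(ℝ, Vec n) (extChartAt (𝓡 n) q) (extChartAt (𝓡 n) q).source (c t)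
      = mfderiv (𝓡 n) 𝓘(ℝ, Vec n) (extChartAt (𝓡 n) q) (c t) :=
    mfderivWithin_of_mem_nhds (ho.mem_nhds (hq t ht))
  simp only [Function.comp, tangentMapWithin, this]
  rfl

theorem coordField_eq_zero_iff {c : ℝ → M} {X : (t : ℝ) → TangentSpace (𝓡 n) (c t)} {q : M}
    {t : ℝ} (hq : c t ∈ (extChartAt (𝓡 n) q).source) :
    coordField (n := n) q c X t = 0 ↔ X t = 0 := by
  refine ⟨fun h => ?_, fun h => ?_⟩
  · have h1 := mfderiv_chart_symm_comp hq (X t)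
    have h2 : (mfderiv (𝓡 n) 𝓘(ℝ, Vec n) (extChartAt (𝓡 n) q) (c t) (X t) : Vec n) = 0 := h
    exact h1.symm.trans ((congrArg _ h2).trans (map_zero _))
  · exact (congrArg (mfderiv (𝓡 n) 𝓘(ℝ, Vec n) (extChartAt (𝓡 n) q) (c t)) h).trans (map_zero _)

/-- The rule for the change of coordinates of a vector field. -/
theorem hasDerivAt_chart_change {q q' m : M} (hq : m ∈ (extChartAt (𝓡 n) q).source)
    (hq' : m ∈ (extChartAt (𝓡 n) q').source) {x : ℝ → Vec n} {a : ℝ} (V : TangentSpace (𝓡 n) m)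
    (h0 : x 0 = extChartAt (𝓡 n) q' m)
    (hx : HasDerivAt x (a • (mfderiv (𝓡 n) 𝓘(ℝ, Vec n) (extChartAt (𝓡 n) q') m V : Vec n)) 0) :
    HasDerivAt (fun s => extChartAt (𝓡 n) q ((extChartAt (𝓡 n) q').symm (x s)))
      (a • (mfderiv (𝓡 n) 𝓘(ℝ, Vec n) (extChartAt (𝓡 n) q) m V : Vec n)) 0 := by
  have := isManifold_one (n := n) (M := M)
  have hl := (extChartAt (𝓡 n) q').left_inv hq'
  have h1 : MDifferentiableAt 𝓘(ℝ, Vec n) (𝓡 n) (extChartAt (𝓡 n) q').symm (x 0) := by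
    have hm : x 0 ∈ (extChartAt (𝓡 n) q').target := h0 ▸ (extChartAt (𝓡 n) q').map_source hq'
    exact ((contMDiffOn_extChartAt_symm (I := 𝓡 n) (n := 1) q' _ hm).contMDiffAt
      ((chart_target_isOpen (n := n) q').mem_nhds hm)).mdifferentiableAt (by simp)
  have h2 : MDifferentiableAt (𝓡 n) 𝓘(ℝ, Vec n) (extChartAt (𝓡 n) q)
      ((extChartAt (𝓡 n) q').symm (x 0)) := by
    rw [h0, hl]
    exact mdifferentiableAt_extChartAt (I := 𝓡 n) (x := q) (by simpa using hq)
  have h3 := mfderiv_comp (x 0) h2 h1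
  have h4 := (mdifferentiableAt_iff_differentiableAt.1 (h2.comp (x 0) h1)).hasFDerivAt
  set w : Vec n := mfderiv (𝓡 n) 𝓘(ℝ, Vec n) (extChartAt (𝓡 n) q') m V
  set T : Vec n →L[ℝ] Vec n :=
    fderiv ℝ (extChartAt (𝓡 n) q ∘ (extChartAt (𝓡 n) q').symm) (x 0) with hTdef
  have h5 := h4.comp_hasDerivAt 0 hx
  have hT : T w = (mfderiv (𝓡 n) 𝓘(ℝ, Vec n) (extChartAt (𝓡 n) q) m V : Vec n) := by
    rw [hTdef, ← mfderiv_eq_fderiv, h3, h0]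
    have e : ∀ m', m' = m → (mfderiv (𝓡 n) 𝓘(ℝ, Vec n) (extChartAt (𝓡 n) q) m' V : Vec n)
      = (mfderiv (𝓡 n) 𝓘(ℝ, Vec n) (extChartAt (𝓡 n) q) m V : Vec n) := by
      rintro _ rfl; rfl
    exact (congrArg (mfderiv (𝓡 n) 𝓘(ℝ, Vec n) (extChartAt (𝓡 n) q)
      ((extChartAt (𝓡 n) q').symm (extChartAt (𝓡 n) q' m)))
      (mfderiv_chart_symm_comp hq' V)).trans (e _ hl)
  exact h5.congr_deriv ((T.map_smul a w).trans (congrArg (a • ·) hT))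

omit [IsManifold (𝓡 n) ∞ M] in
-- A partition of unity on `[0, 1]`, subordinate to a finite cover by preimages of chart domains. It
-- replaces the exponential map in the construction of a family with a given variation field.
theorem exists_smooth_subordinate {c : ℝ → M} (hc : ContinuousOn c (Icc 0 1)) :
    ∃ (T : Finset ℝ) (χ : ℝ → ℝ → ℝ), (∀ j, ContDiff ℝ ∞ (χ j)) ∧
      (∀ j, ∀ t ∈ tsupport (χ j) ∩ Icc 0 1, c t ∈ (extChartAt (𝓡 n) (c j)).source) ∧
      ∀ t ∈ Icc (0 : ℝ) 1, ∑ j ∈ T, χ j t = 1 := by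
  have h1 : ∀ j : ℝ, ∃ O : Set ℝ, IsOpen O ∧
      ∀ t ∈ Icc (0 : ℝ) 1, t ∈ O ↔ c t ∈ (extChartAt (𝓡 n) (c j)).source := by
    intro j
    obtain ⟨O, hO, he⟩ := continuousOn_iff'.1 hc _ (chart_source_isOpen (n := n) (c j))
    refine ⟨O, hO, fun t ht => ?_⟩
    have := Set.ext_iff.1 he t
    simp only [mem_inter_iff, ht, and_true, mem_preimage] at this
    exact this.symm
  choose O hO hOq using h1
  obtain ⟨T, hT⟩ := isCompact_Icc.elim_finite_subcover O hO (s := Icc (0 : ℝ) 1)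
    fun t ht => mem_iUnion.2 ⟨t, (hOq t t ht).2 (mem_extChartAt_source (I := 𝓡 n) (c t))⟩
  obtain ⟨f, hf⟩ := SmoothPartitionOfUnity.exists_isSubordinate (M := ℝ) 𝓘(ℝ, ℝ)
    (isClosed_Icc (a := (0 : ℝ)) (b := 1)) (fun j : T => O j) (fun j => hO j) fun t ht => by
      obtain ⟨j, hj, htj⟩ := mem_iUnion₂.1 (hT ht)
      exact mem_iUnion.2 ⟨⟨j, hj⟩, htj⟩
  classical
  refine ⟨T, fun j => if h : j ∈ T then f ⟨j, h⟩ else 0, fun j => ?_, fun j t ht => ?_,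
    fun t ht => ?_⟩
  · by_cases h : j ∈ T
    · simp only [h, dif_pos]
      exact (f ⟨j, h⟩).contMDiff.contDiff
    · simp only [h, dif_neg, not_false_eq_true]
      exact contDiff_const
  · by_cases h : j ∈ T
    · simp only [h, dif_pos] at ht
      exact (hOq j t ht.2).1 (hf ⟨j, h⟩ ht.1)
    · simp [h] at ht
  · have := f.sum_eq_one ht
    rw [finsum_eq_sum_of_fintype] at this
    refine Eq.trans ?_ this
    rw [← Finset.sum_coe_sort T]
    exact Finset.sum_congr rfl fun j _ => by simp

/-- Each smooth vector field along a smooth curve is the variation field of a smooth family, which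
is constant where the field vanishes. -/
theorem exists_smoothFamily {c : ℝ → M} (hc : ContMDiffOn 𝓘(ℝ, ℝ) (𝓡 n) ∞ c (Icc 0 1))
    {X : (t : ℝ) → TangentSpace (𝓡 n) (c t)}
    (hX : ContMDiffOn 𝓘(ℝ, ℝ) (𝓡 n).tangent ∞
      (fun t => (⟨c t, X t⟩ : TangentBundle (𝓡 n) M)) (Icc 0 1)) :
    ∃ ε > 0, ∃ γ : ℝ → ℝ → M, SmoothFamily (n := n) γ ε 0 1 ∧
      (∀ t ∈ Icc (0 : ℝ) 1, γ 0 t = c t) ∧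
      (∀ s ∈ Ioo (-ε) ε, ∀ t ∈ Icc (0 : ℝ) 1, X t = 0 → γ s t = c t) ∧
      ∀ q : M, ∀ t ∈ Icc (0 : ℝ) 1, c t ∈ (extChartAt (𝓡 n) q).source →
        HasDerivAt (fun s => coordCurve (n := n) q (γ s) t) (coordField (n := n) q c X t) 0 := by
  obtain ⟨T, χ, hχ, hsrc, hsum⟩ := exists_smooth_subordinate (n := n) hc.continuousOn
  -- Induction on the set of cut-offs already used: each step shifts the current family by `χ j • X`
  -- in the chart at `c j`, and the variation field becomes the partial sum of the cut-offs times
  -- `X`.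
  suffices h : ∀ S : Finset ℝ, ∃ ε > 0, ∃ γ : ℝ → ℝ → M, SmoothFamily (n := n) γ ε 0 1 ∧
      (∀ t ∈ Icc (0 : ℝ) 1, γ 0 t = c t) ∧
      (∀ s ∈ Ioo (-ε) ε, ∀ t ∈ Icc (0 : ℝ) 1, X t = 0 → γ s t = c t) ∧
      ∀ q : M, ∀ t ∈ Icc (0 : ℝ) 1, c t ∈ (extChartAt (𝓡 n) q).source →
        HasDerivAt (fun s => coordCurve (n := n) q (γ s) t)
          ((∑ j ∈ S, χ j t) • coordField (n := n) q c X t) 0 by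
    obtain ⟨ε, hε, γ, h1, h2, h3, h4⟩ := h T
    refine ⟨ε, hε, γ, h1, h2, h3, fun q t ht hq => ?_⟩
    simpa only [hsum t ht, one_smul] using h4 q t ht hq
  intro S
  classical
  induction S using Finset.induction_on with
  | empty =>
    refine ⟨1, one_pos, fun _ => c, smoothFamily_const hc le_rfl 1, fun _ _ => rfl,
      fun _ _ _ _ _ => rfl, fun q t _ _ => ?_⟩
    simpa using hasDerivAt_const (0 : ℝ) (coordCurve (n := n) q c t)
  | insert j S hj ih =>
    obtain ⟨ε, hε, γ, h1, h2, h3, h4⟩ := ih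
    set v : ℝ → Vec n := fun t => χ j t • coordField (n := n) (c j) c X t with hv
    have hvK : ∀ t ∉ tsupport (χ j), v t = 0 := fun t ht => by
      simp only [hv, image_eq_zero_of_notMem_tsupport ht, zero_smul]
    have hvc : ContDiffOn ℝ ∞ v (Icc 0 1) := by
      intro t ht
      by_cases htK : t ∈ tsupport (χ j)
      · have hs := hsrc j t ⟨htK, ht⟩
        have hn : c ⁻¹' (extChartAt (𝓡 n) (c j)).source ∈ 𝓝[Icc 0 1] t :=
          hc.continuousOn t ht ((chart_source_isOpen (n := n) (c j)).mem_nhds hs)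
        have hcf := contDiffOn_coordField (q := c j) (hX.mono inter_subset_left
          (t := Icc 0 1 ∩ c ⁻¹' (extChartAt (𝓡 n) (c j)).source)) fun t ht => ht.2
        exact (((hχ j).contDiffOn.smul hcf) t ⟨ht, hs⟩).mono_of_mem_nhdsWithin
          (inter_mem self_mem_nhdsWithin hn)
      · refine (contDiffWithinAt_const (c := (0 : Vec n))).congr_of_eventuallyEq ?_ (hvK t htK)
        filter_upwards [mem_nhdsWithin_of_mem_nhds
          ((isClosed_tsupport (χ j)).isOpen_compl.mem_nhds htK)] with r hr using hvK r hr
    have hsrc' : ∀ t ∈ tsupport (χ j) ∩ Icc 0 1, γ 0 t ∈ (extChartAt (𝓡 n) (c j)).source :=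
      fun t ht => by rw [h2 t ht.2]; exact hsrc j t ht
    obtain ⟨δ, hδ, hδε, hsm, hgood⟩ := h1.exists_shift hε (isClosed_tsupport (χ j)) hvc hvK hsrc'
    refine ⟨δ, hδ, _, hsm, fun t ht => ?_, fun s hs t ht hXt => ?_, fun q t ht hq => ?_⟩
    · rw [shift_zero fun h => hsrc' t ⟨h, ht⟩, h2 t ht]
    · have hvt : v t = 0 := by
        by_cases htK : t ∈ tsupport (χ j)
        · simp only [hv, (coordField_eq_zero_iff (hsrc j t ⟨htK, ht⟩)).2 hXt, smul_zero]
        · exact hvK t htK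
      rw [shift_of_eq_zero hvt fun h => (hgood s hs t ht h).1]
      exact h3 s (Ioo_subset_Ioo (by linarith) hδε hs) t ht hXt
    · rw [Finset.sum_insert hj]
      by_cases htK : t ∈ tsupport (χ j)
      · have hs := hsrc j t ⟨htK, ht⟩
        -- The derivatives add in the chart at `c j`, where the shift is linear in `s`. The result
        -- is then carried to the chart at `q`.
        have hx := (h4 (c j) t ht hs).add ((hasDerivAt_id (0 : ℝ)).smul_const (v t))
        simp only [hv, one_smul, ← add_smul] at hx
        rw [add_comm (∑ j ∈ S, χ j t)] at hx
        have := hasDerivAt_chart_change hq hs (X t) (by simp [coordCurve, h2 t ht]) hx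
        refine this.congr_of_eventuallyEq (Eventually.of_forall fun s => ?_)
        simp only [coordCurve, shift, if_pos htK]
        rfl
      · have h0 : χ j t = 0 := image_eq_zero_of_notMem_tsupport htK
        simpa only [coordCurve, shift_of_notMem htK, h0, zero_add] using h4 q t ht hq

end

end Finsler
end

/-! ### Momentum along a variation by a Jacobi field -/

noncomputable section

namespace Finsler

variable {n : ℕ}

theorem ContDiffAt.eventually_contDiffAt_two {E G : Type*} [NormedAddCommGroup E]
    [NormedSpace ℝ E] [NormedAddCommGroup G] [NormedSpace ℝ G] {f : E → G} {x : E}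
    (hf : ContDiffAt ℝ ∞ f x) : ∀ᶠ y in 𝓝 x, ContDiffAt ℝ 2 f y :=
  (hf.of_le (m := 2) (WithTop.coe_le_coe.2 (le_top : (2 : ℕ∞) ≤ ⊤))).eventually (by simp)

theorem hasDerivAt_apply_of_zero {E G : Type*} [NormedAddCommGroup E] [NormedSpace ℝ E]
    [NormedAddCommGroup G] [NormedSpace ℝ G]
    {A : ℝ → E →L[ℝ] G} {v : ℝ → E} {s : ℝ} (hA : DifferentiableAt ℝ A s)
    (hv : HasDerivAt v 0 s) (hv0 : v s = 0) :
    HasDerivAt (fun s => A s (v s)) 0 s := by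
  have h1 : HasDerivAt (fun s => A s (v s)) (deriv A s (v s) + A s 0) s :=
    hA.hasDerivAt.clm_apply hv
  simpa [hv0] using h1

/-- This disposes of the Euler–Lagrange defect, which for a Jacobi variation vanishes together with
its first derivative in `s`. -/
theorem hasDerivAt_bilinear_of_zero {E : Type*} [NormedAddCommGroup E] [NormedSpace ℝ E]
    {A : ℝ → E →L[ℝ] E →L[ℝ] ℝ} {v w : ℝ → E} {s : ℝ} (hA : DifferentiableAt ℝ A s)
    (hv : HasDerivAt v 0 s) (hv0 : v s = 0) (hw : DifferentiableAt ℝ w s) :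
    HasDerivAt (fun s => A s (v s) (w s)) 0 s := by
  have h1 := hasDerivAt_apply_of_zero (G := E →L[ℝ] ℝ) hA hv hv0
  have h2 : HasDerivAt (fun s => A s (v s) (w s))
      ((0 : E →L[ℝ] ℝ) (w s) + A s (v s) (deriv w s)) s := h1.clm_apply hw.hasDerivAt
  have h3 : (0 : E →L[ℝ] ℝ) (w s) + A s (v s) (deriv w s) = 0 := by rw [hv0]; simp
  rwa [h3] at h2

section Mixed

variable {G : Type*} [NormedAddCommGroup G] [NormedSpace ℝ G] {u : ℝ → ℝ → G} {t : ℝ}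

theorem eventually_deriv_deriv_comm
    (hu : ContDiffAt ℝ ∞ (fun z : ℝ × ℝ => u z.1 z.2) (0, t)) :
    ∀ᶠ z : ℝ × ℝ in 𝓝 (0, t), deriv (fun r => deriv (fun s => u s r) z.1) z.2
      = deriv (fun s => deriv (u s) z.2) z.1 := by
  filter_upwards [ContDiffAt.eventually_contDiffAt_two hu] with z hz
  exact (hasDerivAt_deriv_comm hz).deriv

/-- Commuting derivatives twice identifies the rate of change of the acceleration with the
acceleration of the variation field, the quantity controlled by the Jacobi equation. -/
theorem deriv_deriv_variation (hu : ContDiffAt ℝ ∞ (fun z : ℝ × ℝ => u z.1 z.2) (0, t)) :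
    deriv (fun s => deriv (deriv (u s)) t) 0
      = deriv (deriv fun r => deriv (fun s => u s r) 0) t := by
  have h1 : HasDerivAt (fun r => deriv (fun s => deriv (u s) r) 0)
      (deriv (fun s => deriv (deriv (u s)) t) 0) t :=
    hasDerivAt_deriv_comm (f := fun s => deriv (u s))
      (ContDiffAt.eventually_contDiffAt_two (ContDiffAt.deriv_snd hu)).self_of_nhds
  rw [← h1.deriv]
  refine Filter.EventuallyEq.deriv_eq ?_
  have ht : Tendsto (fun r : ℝ => ((0 : ℝ), r)) (𝓝 t) (𝓝 (0, t)) :=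
    (Continuous.prodMk_right (0 : ℝ)).continuousAt
  filter_upwards [ht.eventually (eventually_deriv_deriv_comm hu)] with r hr using hr.symm

theorem hasDerivAt_state (hu : ContDiffAt ℝ ∞ (fun z : ℝ × ℝ => u z.1 z.2) (0, t)) :
    HasDerivAt (fun s => (u s t, deriv (u s) t))
      (deriv (fun s => u s t) 0, deriv (fun r => deriv (fun s => u s r) 0) t) 0 := by
  have h2 := hasDerivAt_fst (u := fun s r => deriv (u s) r) (z := (0, t))
    ((ContDiffAt.deriv_snd hu).differentiableAt (by simp))
  have h3 := (eventually_deriv_deriv_comm hu).self_of_nhds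
  dsimp only at h2 h3
  rw [h3]
  exact (hasDerivAt_fst (u := u) (z := (0, t))
    (hu.differentiableAt (by simp))).differentiableAt.hasDerivAt.prodMk
    h2.differentiableAt.hasDerivAt

end Mixed

namespace IsLocalFinsler

variable {F : Vec n → Vec n → ℝ} {U : Set (Vec n)} (h : IsLocalFinsler F U) (p : ℝ)

include h

theorem contDiffAt_pairing {u : ℝ → ℝ → Vec n} {η : ℝ → ℝ → Vec n × Vec n} {t : ℝ}
    (hu : ContDiffAt ℝ ∞ (fun z : ℝ × ℝ => u z.1 z.2) (0, t))
    (hη : ContDiffAt ℝ ∞ (fun z : ℝ × ℝ => η z.1 z.2) (0, t))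
    (hx : u 0 t ∈ U) (hy : deriv (u 0) t ≠ 0) :
    ContDiffAt ℝ ∞ (fun z : ℝ × ℝ => fderiv ℝ (lagrangian F p)
      (u z.1 z.2, deriv (u z.1) z.2) (η z.1 z.2)) (0, t) := by
  have hL : ContDiffAt ℝ ∞ (fderiv ℝ (lagrangian F p)) (u 0 t, deriv (u 0) t) :=
    (h.contDiffAt_lagrangian p hx hy).fderiv_right (by simp)
  exact (ContDiffAt.comp (f := fun z : ℝ × ℝ => (u z.1 z.2, deriv (u z.1) z.2)) (0, t) hL
    (hu.prodMk (ContDiffAt.deriv_snd hu))).clm_apply hη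

/-- The first variation of the pairing of the momentum with a vector field, along a variation of
a geodesic through geodesics, up to second order. -/
theorem hasDerivAt_deriv_momentum {u η : ℝ → ℝ → Vec n} {t : ℝ}
    (hu : ContDiffAt ℝ ∞ (fun z : ℝ × ℝ => u z.1 z.2) (0, t))
    (hη : ContDiffAt ℝ ∞ (fun z : ℝ × ℝ => η z.1 z.2) (0, t))
    (hx : u 0 t ∈ U) (hy : deriv (u 0) t ≠ 0)
    (hgeo : deriv (deriv (u 0)) t = -sprayVec F (u 0 t, deriv (u 0) t))
    (hjac : deriv (deriv fun r => deriv (fun s => u s r) 0) t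
      = -fderiv ℝ (sprayVec F) (u 0 t, deriv (u 0) t)
        (deriv (fun s => u s t) 0, deriv (fun r => deriv (fun s => u s r) 0) t)) :
    HasDerivAt (fun t => deriv (fun s => fderiv ℝ (lagrangian F p)
        (u s t, deriv (u s) t) (0, η s t)) 0)
      (deriv (fun s => fderiv ℝ (lagrangian F p)
        (u s t, deriv (u s) t) (η s t, deriv (η s) t)) 0) t := by
  set L := lagrangian F p
  have hut := ContDiffAt.deriv_snd hu
  have hutt := ContDiffAt.deriv_snd (u := fun s => deriv (u s)) hut
  have hηt := ContDiffAt.deriv_snd hη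
  have hpair := h.contDiffAt_pairing p (η := fun s t => (0, η s t)) hu
    (contDiffAt_const.prodMk hη) hx hy
  have hcomm := hasDerivAt_deriv_comm (f := fun s t => fderiv ℝ L (u s t, deriv (u s) t) (0, η s t))
    (ContDiffAt.eventually_contDiffAt_two hpair).self_of_nhds
  refine hcomm.congr_deriv ?_
  have hs : Tendsto (fun r : ℝ => (r, t)) (𝓝 0) (𝓝 (0, t)) :=
    (Continuous.prodMk_left t).continuousAt
  have hsm : ContDiffAt ℝ ∞ (fun s : ℝ => ((s, t) : ℝ × ℝ)) 0 := by fun_prop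
  set z : ℝ → Vec n × Vec n := fun s => (u s t, deriv (u s) t)
  -- `J s` is the defect of `u s` from being a geodesic. It vanishes at `s = 0` by the geodesic
  -- equation, and its derivative there vanishes by the Jacobi equation; the nearby curves need not
  -- be geodesics.
  set J : ℝ → Vec n := fun s => deriv (deriv (u s)) t + sprayVec F (z s)
  have hz : HasDerivAt z _ 0 := hasDerivAt_state hu
  have hL1 := h.contDiffAt_lagrangian p hx hy
  have hD2 : DifferentiableAt ℝ (fderiv ℝ (fderiv ℝ L)) (z 0) :=
    ((hL1.fderiv_right (m := ∞) (by simp)).fderiv_right (m := ∞) (by simp)).differentiableAt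
      (by simp)
  have hS : DifferentiableAt ℝ (sprayVec F) (z 0) :=
    (h.contDiffOn_sprayVec.contDiffAt ((isOpen_slit h.isOpen).mem_nhds
      (show z 0 ∈ U ×ˢ {0}ᶜ from ⟨hx, hy⟩))).differentiableAt (by simp)
  have hJ : HasDerivAt J 0 0 := by
    have h1 := (hasDerivAt_fst (u := fun s => deriv (deriv (u s))) (z := (0, t))
      (hutt.differentiableAt (by simp))).differentiableAt.hasDerivAt.add
      (hS.hasFDerivAt.comp_hasDerivAt 0 hz)
    refine h1.congr_deriv ?_
    dsimp only
    rw [deriv_deriv_variation hu, hjac]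
    exact neg_add_cancel _
  have hJ0 : J 0 = 0 := by
    simp only [J, hgeo, z, neg_add_cancel]
  have hη0 : DifferentiableAt ℝ (fun s => η s t) 0 :=
    (hasDerivAt_fst (u := η) (z := (0, t)) (hη.differentiableAt (by simp))).differentiableAt
  have hrest : HasDerivAt (fun s => fderiv ℝ (fderiv ℝ L) (z s) (0, J s) (0, η s t)) 0 0 := by
    have hA : DifferentiableAt ℝ (fun s => fderiv ℝ (fderiv ℝ L) (z s)) 0 :=
      DifferentiableAt.comp (F := Vec n × Vec n)
        (G := Vec n × Vec n →L[ℝ] Vec n × Vec n →L[ℝ] ℝ) (0 : ℝ) hD2 hz.differentiableAt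
    exact hasDerivAt_bilinear_of_zero hA
      ((hasDerivAt_const (0 : ℝ) (0 : Vec n)).prodMk hJ) (by rw [hJ0]; rfl)
      ((differentiableAt_const (0 : Vec n)).prodMk hη0)
  -- Differentiate the momentum in time and split the acceleration into minus the spray plus `J`.
  -- The spray part is given by the Euler–Lagrange identity; the `J` part contributes nothing to the
  -- `s`-derivative at `0`.
  have hev : (fun s => deriv (fun t => fderiv ℝ L (u s t, deriv (u s) t) (0, η s t)) t)
      =ᶠ[𝓝 0] fun s => fderiv ℝ L (z s) (η s t, deriv (η s) t)
        + fderiv ℝ (fderiv ℝ L) (z s) (0, J s) (0, η s t) := by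
    have hzc : ContinuousAt z 0 := hz.continuousAt
    filter_upwards [hs.eventually (ContDiffAt.eventually_differentiableAt hu),
      hs.eventually (ContDiffAt.eventually_differentiableAt hut),
      hs.eventually (ContDiffAt.eventually_differentiableAt hη),
      hzc.eventually ((isOpen_slit h.isOpen).mem_nhds (show z 0 ∈ U ×ˢ {0}ᶜ from ⟨hx, hy⟩))]
      with s h1 h2 h3 h4
    have d1 := (hasDerivAt_snd h1).differentiableAt.hasDerivAt
    have d2 := (hasDerivAt_snd (u := fun s => deriv (u s)) h2).differentiableAt.hasDerivAt
    have d3 := (hasDerivAt_snd h3).differentiableAt.hasDerivAt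
    have hLs : DifferentiableAt ℝ (fderiv ℝ L) (z s) :=
      ((h.contDiffAt_lagrangian p h4.1 h4.2).fderiv_right (m := ∞) (by simp)).differentiableAt
        (by simp)
    have d4 := (HasFDerivAt.comp_hasDerivAt (f := fun t => (u s t, deriv (u s) t)) t
      hLs.hasFDerivAt (d1.prodMk d2)).clm_apply
      ((hasDerivAt_const t (0 : Vec n)).prodMk d3)
    refine d4.deriv.trans ?_
    dsimp only
    have e1 := h.euler_lagrange p h4.1 h4.2 (η s t)
    have e2 : ((deriv (u s) t, deriv (deriv (u s)) t) : Vec n × Vec n)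
        = (deriv (u s) t, -sprayVec F (z s)) + (0, J s) := by simp [J]
    have e3 : ((η s t, deriv (η s) t) : Vec n × Vec n) = (η s t, 0) + (0, deriv (η s) t) := by simp
    rw [e2, e3, map_add, map_add, add_apply]
    change fderiv ℝ (fderiv ℝ L) (z s) _ _ + _ + _ = _
    rw [show fderiv ℝ (fderiv ℝ L) (z s) (deriv (u s) t, -sprayVec F (z s)) (0, η s t)
      = fderiv ℝ L (z s) (η s t, 0) from e1]
    abel
  rw [hev.deriv_eq]
  have hmain : DifferentiableAt ℝ (fun s => fderiv ℝ L (z s) (η s t, deriv (η s) t)) 0 :=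
    (hasDerivAt_fst (u := fun s t => fderiv ℝ L (u s t, deriv (u s) t) (η s t, deriv (η s) t))
      (z := (0, t)) ((h.contDiffAt_pairing p (η := fun s t => (η s t, deriv (η s) t)) hu
        (hη.prodMk hηt) hx hy).differentiableAt (by simp))).differentiableAt
  simpa using (hmain.hasDerivAt.fun_add hrest).deriv

/-- Only one of the two derivatives is carried out. This puts the density in the form of
`hasDerivAt_deriv_momentum` with `η = ∂u/∂s`, so it becomes a total time derivative. -/
theorem deriv_deriv_lagrangian {u : ℝ → ℝ → Vec n} {t : ℝ}
    (hu : ContDiffAt ℝ ∞ (fun z : ℝ × ℝ => u z.1 z.2) (0, t))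
    (hx : u 0 t ∈ U) (hy : deriv (u 0) t ≠ 0) :
    deriv (deriv fun s => lagrangian F p (u s t, deriv (u s) t)) 0
      = deriv (fun s => fderiv ℝ (lagrangian F p) (u s t, deriv (u s) t)
        (deriv (fun s => u s t) s, deriv (fun t => deriv (fun s => u s t) s) t)) 0 := by
  refine Filter.EventuallyEq.deriv_eq ?_
  have hs : Tendsto (fun r : ℝ => (r, t)) (𝓝 0) (𝓝 (0, t)) :=
    (Continuous.prodMk_left t).continuousAt
  have hz := (hasDerivAt_state hu).continuousAt
  filter_upwards [hs.eventually (ContDiffAt.eventually_differentiableAt hu),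
    hs.eventually (ContDiffAt.eventually_differentiableAt (ContDiffAt.deriv_snd hu)),
    hs.eventually (eventually_deriv_deriv_comm hu),
    hz.eventually ((isOpen_slit h.isOpen).mem_nhds
      (show (u 0 t, deriv (u 0) t) ∈ U ×ˢ {0}ᶜ from ⟨hx, hy⟩))] with s h1 h2 h3 h4
  have d1 := (hasDerivAt_fst h1).differentiableAt.hasDerivAt
  have d2 := (hasDerivAt_fst (u := fun s => deriv (u s)) h2).differentiableAt.hasDerivAt
  rw [← h3] at d2
  exact (HasFDerivAt.comp_hasDerivAt (f := fun s => (u s t, deriv (u s) t)) s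
    ((h.contDiffAt_lagrangian p h4.1 h4.2).differentiableAt (by simp)).hasFDerivAt
    (d1.prodMk d2)).deriv

end IsLocalFinsler

end Finsler
end

/-! ### Uniqueness for the Jacobi equation -/

noncomputable section

namespace Finsler

variable {n : ℕ} {M : Type*} [TopologicalSpace M] [ChartedSpace (Vec n) M]

section

variable [IsManifold (𝓡 n) ∞ M]

section Coordinates

variable {F : FinslerMetric n M} {c : ℝ → M} {X : (t : ℝ) → TangentSpace (𝓡 n) (c t)} {q : M}
  {t : ℝ}

omit [IsManifold (𝓡 n) ∞ M] in
theorem isOpen_mem_source (hs : ContinuousOn c (Icc 0 1)) (q : M) :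
    IsOpen (Ioo (0 : ℝ) 1 ∩ c ⁻¹' (extChartAt (𝓡 n) q).source) :=
  (hs.mono Ioo_subset_Icc_self).isOpen_inter_preimage isOpen_Ioo (chart_source_isOpen q)

theorem contDiffOn_coordCurve (hs : ContMDiffOn 𝓘(ℝ, ℝ) (𝓡 n) ∞ c (Icc 0 1)) (q : M) :
    ContDiffOn ℝ ∞ (coordCurve (n := n) q c)
      (Ioo (0 : ℝ) 1 ∩ c ⁻¹' (extChartAt (𝓡 n) q).source) :=
  contDiffOn_coord (hs.mono (inter_subset_left.trans Ioo_subset_Icc_self)) fun _ ht => ht.2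

theorem deriv_coordCurve_ne_zero (hs : ContMDiffOn 𝓘(ℝ, ℝ) (𝓡 n) ∞ c (Icc 0 1))
    (hreg : ∀ t ∈ Icc (0 : ℝ) 1, mfderivWithin 𝓘(ℝ, ℝ) (𝓡 n) c (Icc 0 1) t (1 : ℝ) ≠ 0)
    (ht : t ∈ Ioo (0 : ℝ) 1) (hq : c t ∈ (extChartAt (𝓡 n) q).source) :
    deriv (coordCurve (n := n) q c) t ≠ 0 := by
  have hI := Icc_mem_nhds ht.1 ht.2
  have ht1 := Ioo_subset_Icc_self ht
  have := (velocity_ne_zero_iff ((hs t ht1).mdifferentiableWithinAt (by simp))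
    (uniqueDiffWithinAt_of_mem_nhds hI) hq).1 (hreg t ht1)
  rwa [derivWithin_of_mem_nhds hI] at this

theorem IsGeodesic.deriv_deriv (hgeo : IsGeodesic F c)
    (hreg : ∀ t ∈ Icc (0 : ℝ) 1, mfderivWithin 𝓘(ℝ, ℝ) (𝓡 n) c (Icc 0 1) t (1 : ℝ) ≠ 0)
    (ht : t ∈ Ioo (0 : ℝ) 1) (hq : c t ∈ (extChartAt (𝓡 n) q).source) :
    deriv (deriv (coordCurve (n := n) q c)) t = -sprayVec (localExpr F.toFun q)
      (coordCurve (n := n) q c t, deriv (coordCurve (n := n) q c) t) := by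
  have h := (F.isLocalFinsler q).spray_of_covDeriv (u := coordCurve (n := n) q c)
    ((extChartAt (𝓡 n) q).map_source hq)
    (by rw [dot_eq_deriv ht]; exact deriv_coordCurve_ne_zero hgeo.1 hreg ht hq)
    (hgeo.2 q t (Ioo_subset_Icc_self ht) hq)
  rwa [dot_dot_eq ht, dot_eq_deriv ht] at h

theorem IsJacobi.deriv_deriv (hX : IsJacobi F c X) (hgeo : IsGeodesic F c)
    (hreg : ∀ t ∈ Icc (0 : ℝ) 1, mfderivWithin 𝓘(ℝ, ℝ) (𝓡 n) c (Icc 0 1) t (1 : ℝ) ≠ 0)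
    (ht : t ∈ Ioo (0 : ℝ) 1) (hq : c t ∈ (extChartAt (𝓡 n) q).source) :
    deriv (deriv (coordField (n := n) q c X)) t = -fderiv ℝ (sprayVec (localExpr F.toFun q))
      (coordCurve (n := n) q c t, deriv (coordCurve (n := n) q c) t)
      (coordField (n := n) q c X t, deriv (coordField (n := n) q c X) t) := by
  have hsub : Ioo (0 : ℝ) 1 ∩ c ⁻¹' (extChartAt (𝓡 n) q).source ⊆ Icc 0 1 :=
    inter_subset_left.trans Ioo_subset_Icc_self
  exact (F.isLocalFinsler q).linearized_spray (isOpen_mem_source hgeo.1.continuousOn q)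
    inter_subset_left (contDiffOn_coordCurve hgeo.1 q)
    (contDiffOn_coordField (hX.1.mono hsub) fun t ht => ht.2)
    (fun t ht => (extChartAt (𝓡 n) q).map_source ht.2)
    (fun t ht => deriv_coordCurve_ne_zero hgeo.1 hreg ht.1 ht.2)
    (fun t ht => hgeo.2 q t (hsub ht) ht.2) (fun t ht => hX.2 q t (hsub ht) ht.2) ⟨ht, hq⟩

/-- A Jacobi field is determined by its value and its derivative at a point. -/
theorem IsJacobi.eventually_eq_zero (hX : IsJacobi F c X) (hgeo : IsGeodesic F c)
    (hreg : ∀ t ∈ Icc (0 : ℝ) 1, mfderivWithin 𝓘(ℝ, ℝ) (𝓡 n) c (Icc 0 1) t (1 : ℝ) ≠ 0)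
    (ht : t ∈ Ioo (0 : ℝ) 1) (hq : c t ∈ (extChartAt (𝓡 n) q).source)
    (h0 : coordField (n := n) q c X t = 0) (h1 : deriv (coordField (n := n) q c X) t = 0) :
    ∀ᶠ r in 𝓝 t, X r = 0 := by
  set ξ := coordField (n := n) q c X
  set u := coordCurve (n := n) q c
  set s := Ioo (0 : ℝ) 1 ∩ c ⁻¹' (extChartAt (𝓡 n) q).source
  have hso : IsOpen s := isOpen_mem_source hgeo.1.continuousOn q
  have hts : t ∈ s := ⟨ht, hq⟩
  have hu : ContDiffOn ℝ ∞ u s := contDiffOn_coordCurve hgeo.1 q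
  have hξ : ContDiffOn ℝ ∞ ξ s := contDiffOn_coordField
    (hX.1.mono (inter_subset_left.trans Ioo_subset_Icc_self)) fun t ht => ht.2
  have hu1 : ContDiffOn ℝ ∞ (deriv u) s := hu.deriv_of_isOpen hso (by simp)
  have hξ1 : ContDiffOn ℝ ∞ (deriv ξ) s := hξ.deriv_of_isOpen hso (by simp)
  set D : ℝ → Vec n × Vec n →L[ℝ] Vec n :=
    fun r => fderiv ℝ (sprayVec (localExpr F.toFun q)) (u r, deriv u r)
  have hD : ContinuousOn D s := by
    have h2 := (F.isLocalFinsler q).contDiffOn_sprayVec.continuousOn_fderiv_of_isOpen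
      (isOpen_slit (F.isLocalFinsler q).isOpen) (by simp)
    exact h2.comp (hu.continuousOn.prodMk hu1.continuousOn) fun r hr =>
      ⟨(extChartAt (𝓡 n) q).map_source hr.2, deriv_coordCurve_ne_zero hgeo.1 hreg hr.1 hr.2⟩
  obtain ⟨C, hC⟩ : ∃ C : ℝ, ∀ᶠ r in 𝓝 t, ‖D r‖ < C :=
    ⟨‖D t‖ + 1, (hD.continuousAt (hso.mem_nhds hts)).norm.eventually (gt_mem_nhds (by linarith))⟩
  obtain ⟨δ, hδ, hball⟩ := Metric.eventually_nhds_iff.1 (hC.and (hso.mem_nhds hts))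
  have hIoo : ∀ r ∈ Ioo (t - δ) (t + δ), ‖D r‖ < C ∧ r ∈ s := fun r hr =>
    hball (by rw [Real.dist_eq, abs_lt]; constructor <;> linarith [hr.1, hr.2])
  have hC0 : 0 ≤ C := (norm_nonneg _).trans hC.self_of_nhds.le
  -- The Jacobi equation as a linear first-order system. Its coefficients are continuous, hence
  -- bounded near `t`, which gives the Lipschitz constant.
  set V : ℝ → Vec n × Vec n → Vec n × Vec n := fun r z => (z.2, -D r z)
  have hV : ∀ r ∈ Ioo (t - δ) (t + δ), LipschitzOnWith (max 1 C.toNNReal) (V r) univ := by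
    intro r hr
    have hsnd : LipschitzWith 1 (fun z : Vec n × Vec n => z.2) := LipschitzWith.prod_snd
    have hDr : LipschitzWith C.toNNReal (fun z => -D r z) := by
      refine LipschitzWith.of_dist_le_mul fun x y => ?_
      rw [dist_neg_neg, dist_eq_norm, dist_eq_norm, ← map_sub, Real.coe_toNNReal C hC0]
      exact ((D r).le_opNorm _).trans (mul_le_mul_of_nonneg_right (hIoo r hr).1.le (norm_nonneg _))
    exact (hsnd.prodMk hDr).lipschitzOnWith
  have hsol : ∀ r ∈ Ioo (t - δ) (t + δ),
      HasDerivAt (fun r => (ξ r, deriv ξ r)) (V r (ξ r, deriv ξ r)) r ∧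
        (ξ r, deriv ξ r) ∈ (univ : Set (Vec n × Vec n)) := by
    intro r hr
    have hrs := (hIoo r hr).2
    have d1 := (((hξ r hrs).contDiffAt (hso.mem_nhds hrs)).differentiableAt (by simp)).hasDerivAt
    have d2 := (((hξ1 r hrs).contDiffAt (hso.mem_nhds hrs)).differentiableAt (by simp)).hasDerivAt
    have hj : deriv (deriv ξ) r = -D r (ξ r, deriv ξ r) := hX.deriv_deriv hgeo hreg hrs.1 hrs.2
    rw [hj] at d2
    exact ⟨d1.prodMk d2, mem_univ _⟩
  have hzero : ∀ r ∈ Ioo (t - δ) (t + δ),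
      HasDerivAt (fun _ : ℝ => (0 : Vec n × Vec n)) (V r 0) r ∧
        (0 : Vec n × Vec n) ∈ (univ : Set (Vec n × Vec n)) := by
    intro r _
    have : V r 0 = 0 := by simp [V]
    rw [this]
    exact ⟨hasDerivAt_const _ _, mem_univ _⟩
  have heq := ODE_solution_unique_of_mem_Ioo hV (t₀ := t) ⟨by linarith, by linarith⟩ hsol hzero
    (by simp [h0, h1])
  filter_upwards [Ioo_mem_nhds (show t - δ < t by linarith) (show t < t + δ by linarith)]
    with r hr
  exact (coordField_eq_zero_iff (hIoo r hr).2.2).1 (congrArg Prod.fst (heq hr))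

/-- The interior times near which `X` vanishes form an open set, and local uniqueness makes it
relatively closed. Connectedness gives the open interval, and continuity the endpoints. -/
theorem IsJacobi.eq_zero (hX : IsJacobi F c X) (hgeo : IsGeodesic F c)
    (hreg : ∀ t ∈ Icc (0 : ℝ) 1, mfderivWithin 𝓘(ℝ, ℝ) (𝓡 n) c (Icc 0 1) t (1 : ℝ) ≠ 0)
    (ht : t ∈ Ioo (0 : ℝ) 1) (hq : c t ∈ (extChartAt (𝓡 n) q).source)
    (h0 : coordField (n := n) q c X t = 0) (h1 : deriv (coordField (n := n) q c X) t = 0) :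
    ∀ r ∈ Icc (0 : ℝ) 1, X r = 0 := by
  set Z : Set ℝ := {r | ∀ᶠ r' in 𝓝 r, X r' = 0}
  have hZo : IsOpen Z := isOpen_setOfPred_eventually_nhds
  have hsub : Ioo (0 : ℝ) 1 ⊆ Z := by
    refine isPreconnected_Ioo.subset_of_closure_inter_subset hZo
      ⟨t, ht, hX.eventually_eq_zero hgeo hreg ht hq h0 h1⟩ ?_
    rintro r ⟨hr, hr01⟩
    set ξ := coordField (n := n) (c r) c X
    set s := Ioo (0 : ℝ) 1 ∩ c ⁻¹' (extChartAt (𝓡 n) (c r)).source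
    have hso : IsOpen s := isOpen_mem_source hgeo.1.continuousOn (c r)
    have hrs : r ∈ s := ⟨hr01, mem_extChartAt_source (I := 𝓡 n) (c r)⟩
    have hξ : ContDiffOn ℝ ∞ ξ s := contDiffOn_coordField
      (hX.1.mono (inter_subset_left.trans Ioo_subset_Icc_self)) fun t ht => ht.2
    have hξ1 : ContDiffOn ℝ ∞ (deriv ξ) s := hξ.deriv_of_isOpen hso (by simp)
    -- A limit point of the vanishing set is approached by points where the field and its derivative
    -- are zero, so by continuity both vanish at the limit.
    have hfr : ∃ᶠ r' in 𝓝 r, (ξ r', deriv ξ r') = 0 := by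
      refine ((mem_closure_iff_frequently.1 hr).and_eventually (hso.mem_nhds hrs)).mono ?_
      rintro r' ⟨h1, h2⟩
      have hev : ξ =ᶠ[𝓝 r'] fun _ => 0 := by
        filter_upwards [h1, hso.mem_nhds h2] with x hx hxs
        exact (coordField_eq_zero_iff hxs.2).2 hx
      rw [hev.deriv_eq, hev.self_of_nhds, deriv_const]
      rfl
    have hcont : ContinuousAt (fun r' => (ξ r', deriv ξ r')) r :=
      (hξ.continuousOn.continuousAt (hso.mem_nhds hrs)).prodMk
        (hξ1.continuousOn.continuousAt (hso.mem_nhds hrs))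
    have h00 : (ξ r, deriv ξ r) = 0 := by
      by_contra hne
      exact hfr (hcont.eventually_ne hne)
    exact hX.eventually_eq_zero hgeo hreg hr01 hrs.2 (congrArg Prod.fst h00)
      (congrArg Prod.snd h00)
  intro r hr
  rw [← coordField_eq_zero_iff (mem_extChartAt_source (I := 𝓡 n) (c r))]
  set S := Icc (0 : ℝ) 1 ∩ c ⁻¹' (extChartAt (𝓡 n) (c r)).source
  have hrS : r ∈ S := ⟨hr, mem_extChartAt_source (I := 𝓡 n) (c r)⟩
  have hξ : ContDiffOn ℝ ∞ (coordField (n := n) (c r) c X) S :=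
    contDiffOn_coordField (hX.1.mono inter_subset_left) fun t ht => ht.2
  have hn : c ⁻¹' (extChartAt (𝓡 n) (c r)).source ∈ 𝓝[Icc 0 1] r :=
    hgeo.1.continuousOn r hr ((chart_source_isOpen (n := n) (c r)).mem_nhds hrS.2)
  have hcw : ContinuousWithinAt (coordField (n := n) (c r) c X) (Icc 0 1) r :=
    (hξ.continuousOn r hrS).mono_of_mem_nhdsWithin (inter_mem self_mem_nhdsWithin hn)
  have hcl : r ∈ closure (Ioo (0 : ℝ) 1) := by rwa [closure_Ioo zero_ne_one]
  have := mem_closure_iff_nhdsWithin_neBot.1 hcl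
  refine tendsto_nhds_unique (hcw.mono Ioo_subset_Icc_self).tendsto (tendsto_const_nhds.congr' ?_)
  filter_upwards [self_mem_nhdsWithin, nhdsWithin_mono r Ioo_subset_Icc_self hn] with x hx hxs
  exact ((coordField_eq_zero_iff hxs).2 (hsub hx).self_of_nhds).symm

end Coordinates

end

end Finsler
end

/-! ### Vanishing of the second variation on a conjugate interval -/

noncomputable section

namespace Finsler

variable {n : ℕ} {M : Type*} [TopologicalSpace M] [ChartedSpace (Vec n) M]

section

variable [IsManifold (𝓡 n) ∞ M]

/-- The pairing of the momentum of the curve `γ s` with the variation field `∂γ/∂s`, with respect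
to the Lagrangian `Fᵖ`. -/
def momentumPairing (F : FinslerMetric n M) (p : ℝ) (γ : ℝ → ℝ → M) (s t : ℝ) : ℝ :=
  deriv (fun r : ℝ => F.toFun ⟨γ s t, mfderivWithin 𝓘(ℝ, ℝ) (𝓡 n) (γ s) (Icc 0 1) t (1 : ℝ)
    + r • mfderiv 𝓘(ℝ, ℝ) (𝓡 n) (fun s => γ s t) s (1 : ℝ)⟩ ^ p) 0

variable {F : FinslerMetric n M} {p : ℝ} {γ : ℝ → ℝ → M} {ε : ℝ} {q : M}

/-- The pairing is defined as a derivative along the fibre, without reference to a chart. It can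
therefore be integrated over an interval that no single chart covers, while being computed in any
chart. -/
theorem SmoothFamily.momentumPairing_eq (h : SmoothFamily (n := n) γ ε 0 1) {s t : ℝ}
    (hst : (s, t) ∈ slab ε 0 1) (hq : γ s t ∈ (extChartAt (𝓡 n) q).source)
    (hne : mfderivWithin 𝓘(ℝ, ℝ) (𝓡 n) (γ s) (Icc 0 1) t (1 : ℝ) ≠ 0) :
    momentumPairing F p γ s t = fderiv ℝ (lagrangian (localExpr F.toFun q) p)
      (coordCurve (n := n) q (γ s) t, derivWithin (coordCurve (n := n) q (γ s)) (Icc 0 1) t)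
      (0, deriv (fun s => coordCurve (n := n) q (γ s) t) s) := by
  have hI := uniqueDiffOn_Icc (zero_lt_one (α := ℝ)) t hst.2
  have hmd := h.mdifferentiableWithinAt hst.1 hst.2
  have hms : MDifferentiableWithinAt 𝓘(ℝ, ℝ) (𝓡 n) (fun s => γ s t) univ s := by
    have h1 : ContMDiffOn 𝓘(ℝ, ℝ) (𝓡 n) ∞ (fun s => γ s t) (Ioo (-ε) ε) :=
      ContMDiffOn.comp (f := fun s : ℝ => ((s, t) : ℝ × ℝ)) h
        (contMDiffOn_iff_contDiffOn.2 (by fun_prop)) fun _ hs => ⟨hs, hst.2⟩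
    rw [mdifferentiableWithinAt_univ]
    exact ((h1 s hst.1).contMDiffAt (isOpen_Ioo.mem_nhds hst.1)).mdifferentiableAt (by simp)
  set x : Vec n := coordCurve (n := n) q (γ s) t
  set y : Vec n := derivWithin (coordCurve (n := n) q (γ s)) (Icc 0 1) t
  set e : Vec n := deriv (fun s => coordCurve (n := n) q (γ s) t) s
  have hy : (mfderiv (𝓡 n) 𝓘(ℝ, Vec n) (extChartAt (𝓡 n) q) (γ s t)
      (mfderivWithin 𝓘(ℝ, ℝ) (𝓡 n) (γ s) (Icc 0 1) t (1 : ℝ)) : Vec n) = y :=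
    mfderiv_chart_velocity hmd hI hq
  have he : (mfderiv (𝓡 n) 𝓘(ℝ, Vec n) (extChartAt (𝓡 n) q) (γ s t)
      (mfderiv 𝓘(ℝ, ℝ) (𝓡 n) (fun s => γ s t) s (1 : ℝ)) : Vec n) = e := by
    have := mfderiv_chart_velocity (q := q) hms uniqueDiffWithinAt_univ hq
    rw [mfderivWithin_univ, derivWithin_univ] at this
    exact this
  have hy0 : y ≠ 0 := (velocity_ne_zero_iff hmd hI hq).1 hne
  have hL := ((F.isLocalFinsler q).contDiffAt_lagrangian p
    ((extChartAt (𝓡 n) q).map_source hq) hy0).differentiableAt (by simp)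
  have hfun : (fun r : ℝ => F.toFun ⟨γ s t, mfderivWithin 𝓘(ℝ, ℝ) (𝓡 n) (γ s) (Icc 0 1) t (1 : ℝ)
      + r • mfderiv 𝓘(ℝ, ℝ) (𝓡 n) (fun s => γ s t) s (1 : ℝ)⟩ ^ p)
      = fun r : ℝ => lagrangian (localExpr F.toFun q) p (x, y + r • e) := by
    funext r
    rw [apply_eq_localExpr F.toFun hq, lagrangian]
    congr 2
    refine (map_add _ _ _).trans ?_
    refine congrArg₂ (· + ·) hy ?_
    exact (map_smul _ _ _).trans (congrArg (r • ·) he)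
  have hline : HasDerivAt (fun r : ℝ => (x, y + r • e)) ((0, e) : Vec n × Vec n) 0 := by
    refine (hasDerivAt_const (0 : ℝ) x).prodMk ?_
    simpa using ((hasDerivAt_id (0 : ℝ)).smul_const e).const_add y
  have hL' : HasFDerivAt (lagrangian (localExpr F.toFun q) p)
      (fderiv ℝ (lagrangian (localExpr F.toFun q) p) (x, y)) (x, y + (0 : ℝ) • e) := by
    rw [zero_smul, add_zero]
    exact hL.hasFDerivAt
  rw [momentumPairing, hfun]
  exact (hL'.comp_hasDerivAt (0 : ℝ) hline).deriv

theorem SmoothFamily.contDiffOn_momentumPairing (h : SmoothFamily (n := n) γ ε 0 1)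
    (hne : ∀ z ∈ slab ε 0 1, mfderivWithin 𝓘(ℝ, ℝ) (𝓡 n) (γ z.1) (Icc 0 1) z.2 (1 : ℝ) ≠ 0) :
    ContDiffOn ℝ ∞ (fun z : ℝ × ℝ => momentumPairing F p γ z.1 z.2) (slab ε 0 1) := by
  intro z hz
  set q := γ z.1 z.2
  obtain ⟨O, hO, hOq, hu⟩ := h.exists_coord q
  have hzO : z ∈ O := (hOq z hz).2 (mem_extChartAt_source q)
  have hd := contDiffOn_slab_snd (f := fun s t => coordCurve (n := n) q (γ s) t) zero_lt_one hO hu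
  have he := contDiffOn_slab_fst (f := fun s t => coordCurve (n := n) q (γ s) t) zero_lt_one hO hu
  have hL := ContDiffOn.comp (((F.isLocalFinsler q).contDiffOn_lagrangian p).fderiv_of_isOpen
      (m := ∞) (isOpen_slit (F.isLocalFinsler q).isOpen) (by simp)) (hu.prodMk hd)
    fun z hz => ⟨(extChartAt (𝓡 n) q).map_source ((hOq z hz.1).1 hz.2),
      (velocity_ne_zero_iff (h.mdifferentiableWithinAt hz.1.1 hz.1.2)
        (uniqueDiffOn_Icc zero_lt_one z.2 hz.1.2) ((hOq z hz.1).1 hz.2)).1 (hne z hz.1)⟩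
  refine ContDiffWithinAt.mono_of_mem_nhdsWithin (ContDiffOn.congr
    (hL.clm_apply ((contDiffOn_const (c := (0 : Vec n))).prodMk he)) (fun z hz => ?_) z ⟨hz, hzO⟩)
    (inter_mem_nhdsWithin _ (hO.mem_nhds hzO))
  exact h.momentumPairing_eq hz.1 ((hOq z hz.1).1 hz.2) (hne z hz.1)

variable {c : ℝ → M} {X : (t : ℝ) → TangentSpace (𝓡 n) (c t)}

omit [IsManifold (𝓡 n) ∞ M] in
theorem eventually_coordCurve_eq (hγ : ∀ t ∈ Icc (0 : ℝ) 1, γ 0 t = c t) {t : ℝ}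
    (ht : t ∈ Ioo (0 : ℝ) 1) : coordCurve (n := n) q (γ 0) =ᶠ[𝓝 t] coordCurve (n := n) q c := by
  filter_upwards [isOpen_Ioo.mem_nhds ht] with r hr
  rw [coordCurve, hγ r (Ioo_subset_Icc_self hr), coordCurve]

omit [IsManifold (𝓡 n) ∞ M] in
theorem eventually_variation_eq (hs : ContinuousOn c (Icc 0 1))
    (hvar : ∀ q : M, ∀ t ∈ Icc (0 : ℝ) 1, c t ∈ (extChartAt (𝓡 n) q).source →
      HasDerivAt (fun s => coordCurve (n := n) q (γ s) t) (coordField (n := n) q c X t) 0)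
    {t : ℝ} (ht : t ∈ Ioo (0 : ℝ) 1) (hq : c t ∈ (extChartAt (𝓡 n) q).source) :
    (fun r => deriv (fun s => coordCurve (n := n) q (γ s) r) 0)
      =ᶠ[𝓝 t] coordField (n := n) q c X := by
  filter_upwards [(isOpen_mem_source hs q).mem_nhds ⟨ht, hq⟩] with r hr
  exact (hvar q r (Ioo_subset_Icc_self hr.1) hr.2).deriv

/-- The first variation of the momentum along a variation of a geodesic by a Jacobi field. -/
theorem SmoothFamily.hasDerivAt_momentum (h : SmoothFamily (n := n) γ ε 0 1) (hε : 0 < ε)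
    (F : FinslerMetric n M) (p : ℝ)
    (hX : IsJacobi F c X) (hgeo : IsGeodesic F c)
    (hreg : ∀ t ∈ Icc (0 : ℝ) 1, mfderivWithin 𝓘(ℝ, ℝ) (𝓡 n) c (Icc 0 1) t (1 : ℝ) ≠ 0)
    (hγ : ∀ t ∈ Icc (0 : ℝ) 1, γ 0 t = c t)
    (hvar : ∀ q : M, ∀ t ∈ Icc (0 : ℝ) 1, c t ∈ (extChartAt (𝓡 n) q).source →
      HasDerivAt (fun s => coordCurve (n := n) q (γ s) t) (coordField (n := n) q c X t) 0)
    {t : ℝ} (ht : t ∈ Ioo (0 : ℝ) 1) (hq : c t ∈ (extChartAt (𝓡 n) q).source)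
    {η : ℝ → ℝ → Vec n} (hη : ContDiffAt ℝ ∞ (fun z : ℝ × ℝ => η z.1 z.2) (0, t)) :
    HasDerivAt (fun t => deriv (fun s => fderiv ℝ (lagrangian (localExpr F.toFun q) p)
        (coordCurve (n := n) q (γ s) t, deriv (coordCurve (n := n) q (γ s)) t) (0, η s t)) 0)
      (deriv (fun s => fderiv ℝ (lagrangian (localExpr F.toFun q) p)
        (coordCurve (n := n) q (γ s) t, deriv (coordCurve (n := n) q (γ s)) t)
        (η s t, deriv (η s) t)) 0) t := by
  have ht1 := Ioo_subset_Icc_self ht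
  have hq' : γ 0 t ∈ (extChartAt (𝓡 n) q).source := by rwa [hγ t ht1]
  have e1 := eventually_coordCurve_eq (n := n) (q := q) hγ ht
  have e2 := eventually_variation_eq hgeo.1.continuousOn hvar ht hq
  have hy := deriv_coordCurve_ne_zero hgeo.1 hreg ht hq
  refine (F.isLocalFinsler q).hasDerivAt_deriv_momentum p
    (u := fun s t => coordCurve (n := n) q (γ s) t) (h.contDiffAt_coord hε ht hq') hη
    ((extChartAt (𝓡 n) q).map_source hq') ?_ ?_ ?_
  · change deriv (coordCurve (n := n) q (γ 0)) t ≠ 0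
    rwa [e1.deriv_eq]
  · change deriv (deriv (coordCurve (n := n) q (γ 0))) t = -sprayVec _
      (coordCurve (n := n) q (γ 0) t, deriv (coordCurve (n := n) q (γ 0)) t)
    rw [e1.deriv.deriv_eq, e1.deriv_eq, e1.self_of_nhds]
    exact hgeo.deriv_deriv hreg ht hq
  · change deriv (deriv fun r => deriv (fun s => coordCurve (n := n) q (γ s) r) 0) t
      = -fderiv ℝ (sprayVec _)
        (coordCurve (n := n) q (γ 0) t, deriv (coordCurve (n := n) q (γ 0)) t)
        (deriv (fun s => coordCurve (n := n) q (γ s) t) 0,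
          deriv (fun r => deriv (fun s => coordCurve (n := n) q (γ s) r) 0) t)
    rw [e2.deriv.deriv_eq, e2.deriv_eq, e1.deriv_eq, e1.self_of_nhds,
      (hvar q t ht1 hq).deriv]
    exact hX.deriv_deriv hgeo hreg ht hq

/-- Along a Jacobi field vanishing at `0` and `b`, the second variation of the energy on `[0, b]`
vanishes. -/
theorem SmoothFamily.integral_secondVar_eq_zero (h : SmoothFamily (n := n) γ ε 0 1) (hε : 0 < ε)
    (F : FinslerMetric n M) (p : ℝ)
    (hX : IsJacobi F c X) (hgeo : IsGeodesic F c)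
    (hreg : ∀ t ∈ Icc (0 : ℝ) 1, mfderivWithin 𝓘(ℝ, ℝ) (𝓡 n) c (Icc 0 1) t (1 : ℝ) ≠ 0)
    (hγ : ∀ t ∈ Icc (0 : ℝ) 1, γ 0 t = c t)
    (hfix : ∀ s ∈ Ioo (-ε) ε, ∀ t ∈ Icc (0 : ℝ) 1, X t = 0 → γ s t = c t)
    (hvar : ∀ q : M, ∀ t ∈ Icc (0 : ℝ) 1, c t ∈ (extChartAt (𝓡 n) q).source →
      HasDerivAt (fun s => coordCurve (n := n) q (γ s) t) (coordField (n := n) q c X t) 0)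
    {b : ℝ} (hb : b ∈ Ioo (0 : ℝ) 1) (h0 : X 0 = 0) (hXb : X b = 0)
    (hint : IntervalIntegrable (secondVar F p γ) MeasureTheory.volume 0 b) :
    ∫ t in 0..b, secondVar F p γ t = 0 := by
  obtain ⟨δ, hδ, hδε, hne⟩ := h.exists_velocity_ne_zero hε zero_lt_one (fun t ht => by
    intro h0
    rw [mfderivWithin_congr (fun t ht => hγ t ht) (hγ t ht)] at h0
    exact hreg t ht h0)
  have h' := h.mono hδε
  have hsm := h'.contDiffOn_momentumPairing (F := F) (p := p) hne
  set β : ℝ → ℝ := fun t => deriv (fun s => momentumPairing F p γ s t) 0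
  have h0δ : (0 : ℝ) ∈ Ioo (-δ) δ := ⟨by simpa using hδ, hδ⟩
  -- The formula for the derivative of `β` is available only at interior times. Continuity up to the
  -- ends, where velocities are one-sided, lets the fundamental theorem of calculus start at `0`.
  have hβc : ContinuousOn β (Icc 0 1) := continuousOn_slab_section
    (f := fun s t => deriv (fun s => momentumPairing F p γ s t) s)
    (contDiffOn_slab_deriv (f := momentumPairing F p γ) zero_lt_one hsm).continuousOn h0δ
  -- Where `X` vanishes the family stands still for all small `s`, so the pairing is identically
  -- zero in `s`, and its `s`-derivative at `0` vanishes too.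
  have hβ0 : ∀ t ∈ Icc (0 : ℝ) 1, X t = 0 → β t = 0 := by
    intro t ht hXt
    have hev : (fun s => momentumPairing F p γ s t) =ᶠ[𝓝 0] fun _ => 0 := by
      filter_upwards [isOpen_Ioo.mem_nhds h0δ] with s hs
      have hc : (fun s => γ s t) =ᶠ[𝓝 s] fun _ => c t := by
        filter_upwards [isOpen_Ioo.mem_nhds hs] with s' hs'
        exact hfix s' (Ioo_subset_Ioo (by linarith) hδε hs') t ht hXt
      have hm : (mfderiv 𝓘(ℝ, ℝ) (𝓡 n) (fun s => γ s t) s (1 : ℝ)) = 0 := by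
        rw [hc.mfderiv_eq, mfderiv_const]; rfl
      simp only [momentumPairing, hm, smul_zero, add_zero, deriv_const]
    simp only [β, hev.deriv_eq, deriv_const]
  have hβd : ∀ t ∈ Ioo (0 : ℝ) 1, HasDerivAt β (secondVar F p γ t) t := by
    intro t ht
    set q := c t
    have hq : c t ∈ (extChartAt (𝓡 n) q).source := mem_extChartAt_source (I := 𝓡 n) (c t)
    have hq' : γ 0 t ∈ (extChartAt (𝓡 n) q).source := by rwa [hγ t (Ioo_subset_Icc_self ht)]
    have hu := h.contDiffAt_coord hε ht hq'
    have hd := h.hasDerivAt_momentum hε F p hX hgeo hreg hγ hvar ht hq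
      (η := fun s t => deriv (fun s => coordCurve (n := n) q (γ s) t) s)
      (ContDiffAt.deriv_fst (u := fun s t => coordCurve (n := n) q (γ s) t) hu)
    have hy : deriv (coordCurve (n := n) q (γ 0)) t ≠ 0 := by
      rw [(eventually_coordCurve_eq (n := n) (q := q) hγ ht).deriv_eq]
      exact deriv_coordCurve_ne_zero hgeo.1 hreg ht hq
    rw [h.secondVar_eq hε F p ht hq', (F.isLocalFinsler q).deriv_deriv_lagrangian p
      (u := fun s t => coordCurve (n := n) q (γ s) t) hu ((extChartAt (𝓡 n) q).map_source hq') hy]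
    refine hd.congr_of_eventuallyEq ?_
    have hz : ∀ᶠ z : ℝ × ℝ in 𝓝 (0, t), momentumPairing F p γ z.1 z.2
        = fderiv ℝ (lagrangian (localExpr F.toFun q) p)
          (coordCurve (n := n) q (γ z.1) z.2, deriv (coordCurve (n := n) q (γ z.1)) z.2)
          (0, deriv (fun s => coordCurve (n := n) q (γ s) z.2) z.1) := by
      filter_upwards [h.eventually_mem_source hε ht hq',
        prod_mem_nhds (isOpen_Ioo.mem_nhds h0δ) (isOpen_Ioo.mem_nhds ht)] with z h1 h2
      have hzs : (z.1, z.2) ∈ slab δ 0 1 := ⟨h2.1, Ioo_subset_Icc_self h2.2⟩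
      rw [h'.momentumPairing_eq hzs h1 (hne _ hzs),
        derivWithin_of_mem_nhds (Icc_mem_nhds h2.2.1 h2.2.2)]
    have htt : Tendsto (fun r : ℝ => ((0 : ℝ), r)) (𝓝 t) (𝓝 (0, t)) :=
      (Continuous.prodMk_right (0 : ℝ)).continuousAt
    filter_upwards [htt.eventually hz.eventually_nhds] with r hr
    have hss : Tendsto (fun s : ℝ => (s, r)) (𝓝 0) (𝓝 (0, r)) :=
      (Continuous.prodMk_left r).continuousAt
    exact Filter.EventuallyEq.deriv_eq (hss.eventually hr)
  have hb1 : Icc (0 : ℝ) b ⊆ Icc 0 1 := Icc_subset_Icc le_rfl hb.2.le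
  rw [intervalIntegral.integral_eq_sub_of_hasDerivAt_of_le hb.1.le (hβc.mono hb1)
    (fun t ht => hβd t ⟨ht.1, ht.2.trans hb.2⟩) hint,
    hβ0 b (Ioo_subset_Icc_self hb) hXb, hβ0 0 ⟨le_rfl, zero_le_one⟩ h0, sub_zero]

end

end Finsler
end

/-! ### Conjugate points: lowering the energy by a broken Jacobi field -/

noncomputable section

namespace Finsler

variable {n : ℕ} {M : Type*} [TopologicalSpace M] [ChartedSpace (Vec n) M]

section

variable [IsManifold (𝓡 n) ∞ M]

theorem secondVar_congr (F : FinslerMetric n M) (p : ℝ) {γ γ' : ℝ → ℝ → M} {t : ℝ}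
    (h : ∀ s, γ s =ᶠ[𝓝 t] γ' s) : secondVar F p γ t = secondVar F p γ' t := by
  have : (fun s => speedPow F p (γ s) t) = fun s => speedPow F p (γ' s) t :=
    funext fun s => speedPow_congr F p (h s)
  rw [secondVar, this, secondVar]

/-- For `p > 1`, a geodesic does not minimize the `p`-energy beyond its first conjugate point. -/
theorem not_isMinimum_of_hasConjugatePoints {F : FinslerMetric n M} {p : ℝ} (hp : 1 < p)
    {x₀ x₁ : M} {c : ℝ → M} (hc : c ∈ pathSpace (n := n) x₀ x₁) (hgeo : IsGeodesic F c)
    (hconj : HasConjugatePoints F c) : ¬ IsMinimum F p x₀ x₁ c := by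
  obtain ⟨b, -, hb0, hb1, X, hX, ⟨t₀, ht₀, hXt₀⟩, hX0, hXb⟩ := hconj
  intro hmin
  have hb : b ∈ Ioo (0 : ℝ) 1 := ⟨hb0, hb1⟩
  have hreg : ∀ t ∈ Icc (0 : ℝ) 1, mfderivWithin 𝓘(ℝ, ℝ) (𝓡 n) c (Icc 0 1) t (1 : ℝ) ≠ 0 :=
    fun t ht => velocity_ne_zero_of_mem_pathSpace hc hgeo.1 zero_lt_one le_rfl ht
  obtain ⟨ε, hε, γ, hfam, hγ, hfix, hvar⟩ := exists_smoothFamily hgeo.1 hX.1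
  obtain ⟨r, hr, hr01, hsrc⟩ := exists_closedBall_subset_source (n := n) hgeo.1.continuousOn hb
  set q := c b
  set ξ := coordField (n := n) q c X
  set L := lagrangian (localExpr F.toFun q) p
  have hqb : c b ∈ (extChartAt (𝓡 n) q).source := mem_extChartAt_source (I := 𝓡 n) (c b)
  have hξb : ξ b = 0 := (coordField_eq_zero_iff hqb).2 hXb
  have hw : deriv ξ b ≠ 0 := fun h => hXt₀ (hX.eq_zero hgeo hreg hb hqb hξb h t₀ ht₀)
  -- This direction, opposite to the jump term of the broken field at `b`, rounds off the corner.
  set w : Vec n := -deriv ξ b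
  let χ : ContDiffBump b := ⟨r / 2, r, by linarith, by linarith⟩
  set K := Icc (b - r) (b + r)
  have hχK : ∀ t ∉ K, χ t = 0 := fun t ht => χ.zero_of_le_dist (by
    by_contra! h
    have h' : dist t b < r := h
    rw [Real.dist_eq, abs_lt] at h'
    exact ht ⟨by linarith, by linarith⟩)
  set v : ℝ → Vec n := fun t => χ t • w
  have hv : ContDiff ℝ ∞ v := χ.contDiff.smul contDiff_const
  have hvK : ∀ t ∉ K, v t = 0 := fun t ht => by simp only [v, hχK t ht, zero_smul]
  have hvb : v b = w := by
    simp only [v, χ.one_of_mem_closedBall (Metric.mem_closedBall_self χ.rIn_pos.le), one_smul]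
  have h0K : (0 : ℝ) ∉ K := fun h => lt_irrefl _ (hr01 h).1
  have h1K : (1 : ℝ) ∉ K := fun h => lt_irrefl _ (hr01 h).2
  have s1 : Icc (0 : ℝ) b ⊆ Icc 0 1 := Icc_subset_Icc le_rfl hb1.le
  have s2 : Icc b 1 ⊆ Icc (0 : ℝ) 1 := Icc_subset_Icc hb0.le le_rfl
  have hfL : SmoothFamily (n := n) γ ε 0 b := ContMDiffOn.mono hfam (prod_mono le_rfl s1)
  have hfR : SmoothFamily (n := n) (fun _ => c) ε b 1 := smoothFamily_const hgeo.1 s2 ε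
  have hqL : ∀ t ∈ K ∩ Icc 0 b, γ 0 t ∈ (extChartAt (𝓡 n) q).source :=
    fun t ht => by rw [hγ t (s1 ht.2)]; exact hsrc t ht.1
  have hqR : ∀ t ∈ K ∩ Icc b 1, c t ∈ (extChartAt (𝓡 n) q).source := fun t ht => hsrc t ht.1
  -- the family with a corner at `b`
  let Γ : ℝ → ℝ → ℝ → M := fun δ s t =>
    if t ≤ b then shift q K (δ • v) γ s t else shift q K (δ • v) (fun _ => c) s t
  have hδv : ∀ δ : ℝ, ContDiff ℝ ∞ (δ • v) := fun δ => hv.const_smul δ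
  have hδK : ∀ δ : ℝ, ∀ t ∉ K, (δ • v) t = 0 := fun δ t ht => by
    rw [Pi.smul_apply, hvK t ht, smul_zero]
  have hΓ : ∀ δ : ℝ, IntervalIntegrable (secondVar F p (Γ δ)) MeasureTheory.volume 0 b ∧
      IntervalIntegrable (secondVar F p (Γ δ)) MeasureTheory.volume b 1 ∧
      0 ≤ (∫ t in 0..b, secondVar F p (Γ δ) t) + ∫ t in b..1, secondVar F p (Γ δ) t := by
    intro δ
    obtain ⟨d1, hd1, hd1ε, hs1, -⟩ := hfL.exists_shift hε isClosed_Icc (hδv δ).contDiffOn (hδK δ)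
      (K := K) hqL
    obtain ⟨d2, hd2, hd2ε, hs2, -⟩ := hfR.exists_shift hε isClosed_Icc (hδv δ).contDiffOn (hδK δ)
      (K := K) hqR
    have hm1 : min d1 d2 ≤ ε := (min_le_left _ _).trans hd1ε
    have hmem : ∀ s ∈ Ioo (-min d1 d2) (min d1 d2), s ∈ Ioo (-ε) ε := fun s hs =>
      Ioo_subset_Ioo (by linarith) hm1 hs
    refine (fun H => ⟨H.1, H.2.1, H.2.2.1 hmin⟩) (second_variation (γ := Γ δ) F p hc hgeo.1 hb
      (lt_min hd1 hd2) ?_ ?_ ?_ ?_)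
    · refine (hs1.mono (min_le_left d1 d2)).congr fun z hz => ?_
      simp only [Γ, if_pos hz.2.2]
    · refine (hs2.mono (min_le_right d1 d2)).congr fun z hz => ?_
      -- The pieces fit together at `b`: since `X b = 0`, the family `γ` stays at `c b`, and the
      -- same shift is applied on both sides.
      rcases hz.2.1.eq_or_lt with hzb | hzb
      · simp only [Γ, ← hzb, le_refl, if_true, shift,
          hfix z.1 (hmem z.1 hz.1) b (Ioo_subset_Icc_self hb) hXb]
      · simp only [Γ, if_neg (not_le.2 hzb)]
    · intro t ht
      by_cases htb : t ≤ b
      · simp only [Γ, if_pos htb]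
        rw [shift_zero fun h => hqL t ⟨h, ht.1, htb⟩, hγ t ht]
      · simp only [Γ, if_neg htb]
        exact shift_zero (γ := fun _ => c) fun h => hsrc t h
    · intro s hs
      simp only [Γ, if_pos hb0.le, if_neg (not_le.2 hb1), shift_of_notMem h0K,
        shift_of_notMem h1K, hfix s (hmem s hs) 0 ⟨le_rfl, zero_le_one⟩ hX0]
      exact ⟨hc.1, hc.2.1⟩
  -- the second variation in terms of `δ`
  set S := secondVar F p γ
  set Q : ℝ → Vec n × Vec n →L[ℝ] Vec n × Vec n →L[ℝ] ℝ := fun t => fderiv ℝ (fderiv ℝ L)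
    (coordCurve (n := n) q (γ 0) t, deriv (coordCurve (n := n) q (γ 0)) t)
  set k : ℝ → ℝ := fun t => Q t (deriv (fun s => (coordCurve (n := n) q (γ s) t,
    deriv (coordCurve (n := n) q (γ s)) t)) 0) (v t, deriv v t)
  set l : ℝ → ℝ := fun t => Q t (v t, deriv v t) (v t, deriv v t)
  set l' : ℝ → ℝ := fun t => fderiv ℝ (fderiv ℝ L)
    (coordCurve (n := n) q c t, deriv (coordCurve (n := n) q c) t) (v t, deriv v t) (v t, deriv v t)
  have hsm : ∀ δ t : ℝ, (((δ • v) t, deriv (δ • v) t) : Vec n × Vec n)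
      = δ • (v t, deriv v t) := fun δ t => by
    rw [deriv_const_smul _ (hv.differentiable (by simp) t)]; rfl
  have hL : ∀ δ : ℝ, EqOn (secondVar F p (Γ δ)) (fun t => S t + (2 * δ * k t + δ ^ 2 * l t))
      (Ioo 0 b) := by
    intro δ t ht
    have e : secondVar F p (Γ δ) t = secondVar F p (shift q K (δ • v) γ) t := by
      refine secondVar_congr F p fun s => ?_
      filter_upwards [Iio_mem_nhds ht.2] with r hr
      simp only [Γ, if_pos (mem_Iio.1 hr).le]
    rw [e, hfL.secondVar_shift hε F p isClosed_Icc (hδv δ) (hδK δ) hqL ht (by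
      rw [mfderivWithin_congr (fun t ht => hγ t (s1 ht)) (hγ t (s1 (Ioo_subset_Icc_self ht)))]
      intro h0
      exact velocity_ne_zero_of_mem_pathSpace hc hgeo.1 hb0 s1 (Ioo_subset_Icc_self ht) h0), hsm]
    simp only [map_smul, smul_apply, smul_eq_mul, S, k, l, Q, L]
    ring
  have hR : ∀ δ : ℝ, EqOn (secondVar F p (Γ δ)) (fun t => δ ^ 2 * l' t) (Ioo b 1) := by
    intro δ t ht
    have e : secondVar F p (Γ δ) t = secondVar F p (shift q K (δ • v) fun _ => c) t := by
      refine secondVar_congr F p fun s => ?_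
      filter_upwards [Ioi_mem_nhds ht.1] with r hr
      simp only [Γ, if_neg (not_le.2 (mem_Ioi.1 hr))]
    have h2 : secondVar F p (fun _ => c) t = 0 := by simp [secondVar]
    rw [e, hfR.secondVar_shift hε F p isClosed_Icc (hδv δ) (hδK δ) hqR ht
      (velocity_ne_zero_of_mem_pathSpace hc hgeo.1 hb1 s2 (Ioo_subset_Icc_self ht)), hsm, h2,
      deriv_const, map_zero, zero_apply, mul_zero, zero_add, zero_add]
    simp only [map_smul, smul_apply, smul_eq_mul, l', L]
    ring
  have iL : ∀ δ : ℝ, IntervalIntegrable (fun t => S t + (2 * δ * k t + δ ^ 2 * l t))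
      MeasureTheory.volume 0 b := fun δ =>
    (hΓ δ).1.congr_uIoo (by rw [uIoo_of_le hb0.le]; exact hL δ)
  have iS : IntervalIntegrable S MeasureTheory.volume 0 b := by simpa using iL 0
  -- Only the whole second variation is known to be integrable for each `δ`. The values at `δ = 0,
  -- 1, -1` determine the coefficients of this quadratic polynomial.
  have ik : IntervalIntegrable k MeasureTheory.volume 0 b := by
    refine (((iL 1).sub (iL (-1))).const_mul (1 / 4)).congr fun t _ => ?_
    ring
  have il : IntervalIntegrable l MeasureTheory.volume 0 b := by
    refine ((((iL 1).add (iL (-1))).sub (iS.const_mul 2)).const_mul (1 / 2)).congr fun t _ => ?_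
    ring
  -- the mixed term
  have hS0 : ∫ t in 0..b, S t = 0 :=
    hfam.integral_secondVar_eq_zero hε F p hX hgeo hreg hγ hfix hvar hb hX0 hXb iS
  -- `B` is a primitive of the mixed term: the first variation of the momentum paired with the fixed
  -- field `v`. It vanishes at `0`, so the mixed integral is the boundary value at `b`.
  set B : ℝ → ℝ := fun t => deriv (fun s => fderiv ℝ L
    (coordCurve (n := n) q (γ s) t, deriv (coordCurve (n := n) q (γ s)) t) (0, v t)) 0
  have hDL : ∀ t ∈ K, ∀ e : Vec n × Vec n, HasDerivAt (fun s => fderiv ℝ L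
      (coordCurve (n := n) q (γ s) t, deriv (coordCurve (n := n) q (γ s)) t) e)
      (Q t (deriv (fun s => (coordCurve (n := n) q (γ s) t,
        deriv (coordCurve (n := n) q (γ s)) t)) 0) e) 0 := by
    intro t ht e
    have ht01 := hr01 ht
    have hq' : γ 0 t ∈ (extChartAt (𝓡 n) q).source := by
      rw [hγ t (Ioo_subset_Icc_self ht01)]; exact hsrc t ht
    have hz := hasDerivAt_state (u := fun s t => coordCurve (n := n) q (γ s) t)
      (hfam.contDiffAt_coord hε ht01 hq')
    have hy : deriv (coordCurve (n := n) q (γ 0)) t ≠ 0 := by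
      rw [(eventually_coordCurve_eq (n := n) (q := q) hγ ht01).deriv_eq]
      exact deriv_coordCurve_ne_zero hgeo.1 hreg ht01 (hsrc t ht)
    have hd : DifferentiableAt ℝ (fderiv ℝ L)
        (coordCurve (n := n) q (γ 0) t, deriv (coordCurve (n := n) q (γ 0)) t) :=
      (((F.isLocalFinsler q).contDiffAt_lagrangian p ((extChartAt (𝓡 n) q).map_source hq')
        hy).fderiv_right (m := ∞) (by simp)).differentiableAt (by simp)
    have := (HasFDerivAt.comp_hasDerivAt (f := fun s => (coordCurve (n := n) q (γ s) t,
      deriv (coordCurve (n := n) q (γ s)) t)) (0 : ℝ) hd.hasFDerivAt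
      hz.differentiableAt.hasDerivAt).clm_apply (hasDerivAt_const (0 : ℝ) e)
    simpa using this
  have hBd : ∀ t ∈ uIcc 0 b, HasDerivAt B (k t) t := by
    intro t ht
    rw [uIcc_of_le hb0.le] at ht
    by_cases htK : t ∈ K
    · have hd := hfam.hasDerivAt_momentum hε F p hX hgeo hreg hγ hvar (hr01 htK) (hsrc t htK)
        (η := fun _ t => v t) (hv.contDiffAt.comp (0, t) contDiffAt_snd)
      rw [(hDL t htK (v t, deriv v t)).deriv] at hd
      exact hd
    · have hv0 : v =ᶠ[𝓝 t] fun _ => 0 := by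
        filter_upwards [isClosed_Icc.isOpen_compl.mem_nhds htK] with r hr using hvK r hr
      have hk : k t = 0 := by
        simp only [k, hv0.deriv_eq, hv0.self_of_nhds, deriv_const]
        exact map_zero _
      rw [hk]
      refine (hasDerivAt_const t (0 : ℝ)).congr_of_eventuallyEq ?_
      filter_upwards [hv0] with r hr
      simp only [B, hr]
      have : ∀ z, fderiv ℝ L z ((0 : Vec n), (0 : Vec n)) = 0 := fun z => map_zero _
      simp only [this, deriv_const]
  have hB0 : B 0 = 0 := by
    have : ∀ z, fderiv ℝ L z ((0 : Vec n), (0 : Vec n)) = 0 := fun z => map_zero _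
    simp only [B, hvK 0 h0K, this, deriv_const]
  have hbK : b ∈ K := ⟨by linarith, by linarith⟩
  -- Since `ξ b = 0`, the variation of the state at `b` is purely vertical. The boundary value is
  -- thus minus the fibre Hessian on `ξ̇ b`.
  have hBb : B b < 0 := by
    have hq' : γ 0 b ∈ (extChartAt (𝓡 n) q).source := by
      rw [hγ b (Ioo_subset_Icc_self hb)]; exact hqb
    have hz := (hasDerivAt_state (u := fun s t => coordCurve (n := n) q (γ s) t)
      (hfam.contDiffAt_coord hε hb hq')).deriv
    have e1 := eventually_variation_eq hgeo.1.continuousOn hvar hb hqb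
    rw [e1.deriv_eq, (hvar q b (Ioo_subset_Icc_self hb) hqb).deriv] at hz
    have hy : deriv (coordCurve (n := n) q (γ 0)) b ≠ 0 := by
      rw [(eventually_coordCurve_eq (n := n) (q := q) hγ hb).deriv_eq]
      exact deriv_coordCurve_ne_zero hgeo.1 hreg hb hqb
    have hpos := (F.isLocalFinsler q).legendre_pos hp ((extChartAt (𝓡 n) q).map_source hq') hy hw
    have hBe : B b = Q b (ξ b, deriv ξ b) (0, w) := by
      rw [← hz, ← hvb]
      exact (hDL b hbK (0, v b)).deriv
    have hneg : ((0 : Vec n), w) = -(0, deriv ξ b) := by simp [w]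
    rw [hBe, hξb, hneg, map_neg]
    exact neg_lt_zero.2 hpos
  have hk : ∫ t in 0..b, k t = B b := by
    rw [intervalIntegral.integral_eq_sub_of_hasDerivAt hBd ik, hB0, sub_zero]
  -- a negative value of the second variation
  set Λ := (∫ t in 0..b, l t) + ∫ t in b..1, l' t
  have hQ : ∀ δ : ℝ, 0 ≤ 2 * δ * B b + δ ^ 2 * Λ := by
    intro δ
    have h3 := (hΓ δ).2.2
    rw [intervalIntegral.integral_congr_Ioo_of_le hb0.le (hL δ),
      intervalIntegral.integral_congr_Ioo_of_le hb1.le (hR δ),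
      intervalIntegral.integral_add iS ((ik.const_mul _).add (il.const_mul _)),
      intervalIntegral.integral_add (ik.const_mul _) (il.const_mul _),
      intervalIntegral.integral_const_mul, intervalIntegral.integral_const_mul,
      intervalIntegral.integral_const_mul, hS0, hk] at h3
    simp only [Λ]
    linarith
  have hΛ : 0 < |Λ| + 1 := by positivity
  -- This `δ` is positive, and small enough for the linear term to outweigh `δ² Λ` whatever the sign
  -- of `Λ`.
  have h1 := hQ (-B b / (|Λ| + 1))
  have h2 : 2 * (-B b / (|Λ| + 1)) * B b + (-B b / (|Λ| + 1)) ^ 2 * Λ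
      = (B b / (|Λ| + 1)) ^ 2 * (Λ - 2 * (|Λ| + 1)) := by
    field_simp
    ring
  rw [h2] at h1
  have h3 : Λ - 2 * (|Λ| + 1) < 0 := by linarith [le_abs_self Λ, abs_nonneg Λ]
  have h4 : 0 < (B b / (|Λ| + 1)) ^ 2 := by
    exact pow_two_pos_of_ne_zero (div_neg_of_neg_of_pos hBb hΛ).ne
  exact absurd h1 (not_le.2 (mul_neg_of_pos_of_neg h4 h3))

end

end Finsler
end

/-! ### Sign comparison and conclusion -/

noncomputable section

namespace Finsler

variable {n : ℕ} {M : Type*} [TopologicalSpace M] [ChartedSpace (Vec n) M]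

section

variable [IsManifold (𝓡 n) ∞ M]

variable {F : FinslerMetric n M} {p : ℝ} {x₀ x₁ : M} {c : ℝ → M}

/-- The second derivative of the Lagrangian `Fᵖ` in the direction of the velocity at a point of a
regular curve, and in a direction normal to it. -/
theorem exists_legendre_directions (F : FinslerMetric n M) (p : ℝ)
    (hc : c ∈ pathSpace (n := n) x₀ x₁) (hs : ContMDiffOn 𝓘(ℝ, ℝ) (𝓡 n) ∞ c (Icc 0 1)) :
    ∃ Q : Vec n → ℝ, (IsMinimum F p x₀ x₁ c → ∀ e, 0 ≤ Q e) ∧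
      (IsMaximum F p x₀ x₁ c → ∀ e, Q e ≤ 0) ∧
      (∃ e, ∃ a > 0, Q e = p * (p - 1) * a) ∧ (2 ≤ n → ∃ e, ∃ a > 0, Q e = p * a) := by
  have hb : (1 / 2 : ℝ) ∈ Ioo (0 : ℝ) 1 := by norm_num
  have hq : c (1 / 2) ∈ (extChartAt (𝓡 n) (c (1 / 2))).source :=
    mem_extChartAt_source (I := 𝓡 n) (c (1 / 2))
  have hx := (extChartAt (𝓡 n) (c (1 / 2))).map_source hq
  have hy := deriv_coordCurve_ne_zero hs
    (fun t ht => velocity_ne_zero_of_mem_pathSpace hc hs zero_lt_one le_rfl ht) hb hq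
  have hF := F.isLocalFinsler (c (1 / 2))
  refine ⟨_, fun h e => (legendre_condition F p hc hs hb e).1 h,
    fun h e => (legendre_condition F p hc hs hb e).2 h, ⟨_, _, ?_, hF.legendre_tangent p hx hy⟩,
    fun hn => ?_⟩
  · exact Real.rpow_pos_of_pos (hF.pos _ hx _ hy) p
  · obtain ⟨e, a, ha, he⟩ := hF.exists_legendre_normal p hn hx hy
    exact ⟨e, a, ha, he⟩

/-- The tangential Hessian has the sign of `p (p - 1)`, positive in both ranges of `p`. A
reparametrization already increases the energy to second order. -/
theorem not_isMaximum (hp : p < 0 ∨ 1 < p) (hc : c ∈ pathSpace (n := n) x₀ x₁)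
    (hs : ContMDiffOn 𝓘(ℝ, ℝ) (𝓡 n) ∞ c (Icc 0 1)) : ¬ IsMaximum F p x₀ x₁ c := by
  obtain ⟨Q, -, h, ⟨e, a, ha, he⟩, -⟩ := exists_legendre_directions F p hc hs
  intro hmax
  have h1 := h hmax e
  have h2 : 0 < p * (p - 1) := by rcases hp with hp | hp <;> nlinarith
  exact absurd h1 (not_le.2 (he ▸ mul_pos h2 ha))

theorem not_isMinimum (hp0 : 0 < p) (hp1 : p < 1) (hc : c ∈ pathSpace (n := n) x₀ x₁)
    (hs : ContMDiffOn 𝓘(ℝ, ℝ) (𝓡 n) ∞ c (Icc 0 1)) : ¬ IsMinimum F p x₀ x₁ c := by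
  obtain ⟨Q, h, -, ⟨e, a, ha, he⟩, -⟩ := exists_legendre_directions F p hc hs
  intro hmin
  have h1 := h hmin e
  have h2 : p * (p - 1) < 0 := by nlinarith
  exact absurd h1 (not_le.2 (he ▸ mul_neg_of_neg_of_pos h2 ha))

/-- For negative `p` the tangential direction is of no help; the Hessian is negative in directions
normal to the velocity. -/
theorem not_isMinimum_of_neg (hp : p < 0) (hn : 2 ≤ n) (hc : c ∈ pathSpace (n := n) x₀ x₁)
    (hs : ContMDiffOn 𝓘(ℝ, ℝ) (𝓡 n) ∞ c (Icc 0 1)) : ¬ IsMinimum F p x₀ x₁ c := by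
  obtain ⟨Q, h, -, -, h'⟩ := exists_legendre_directions F p hc hs
  obtain ⟨e, a, ha, he⟩ := h' hn
  exact fun hmin => absurd (h hmin e) (not_le.2 (he ▸ mul_neg_of_neg_of_pos hp ha))

theorem not_isMaximum_of_pos (hp : 0 < p) (hn : 2 ≤ n) (hc : c ∈ pathSpace (n := n) x₀ x₁)
    (hs : ContMDiffOn 𝓘(ℝ, ℝ) (𝓡 n) ∞ c (Icc 0 1)) : ¬ IsMaximum F p x₀ x₁ c := by
  obtain ⟨Q, -, h, -, h'⟩ := exists_legendre_directions F p hc hs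
  obtain ⟨e, a, ha, he⟩ := h' hn
  exact fun hmax => absurd (h hmax e) (not_le.2 (he ▸ mul_pos hp ha))

end

end Finsler
end

theorem mainTheorem5 {n : ℕ} {M : Type*} [TopologicalSpace M] [T2Space M] [ConnectedSpace M]
    [ChartedSpace (Finsler.Vec n) M] [IsManifold (𝓡 n) ∞ M]
    (F : Finsler.FinslerMetric n M) (p : ℝ) (hp0 : p ≠ 0) (hp1 : p ≠ 1) (x₀ x₁ : M) (c : ℝ → M)
    (hc : c ∈ Finsler.pathSpace (n := n) x₀ x₁) (hgeo : Finsler.IsGeodesic F c) :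
    (¬ Finsler.HasConjugatePoints F c →
      (p < 0 → (2 ≤ n → ¬ Finsler.IsMinimum F p x₀ x₁ c) ∧ ¬ Finsler.IsMaximum F p x₀ x₁ c) ∧
      (0 < p → p < 1 →
        ¬ Finsler.IsMinimum F p x₀ x₁ c ∧ (2 ≤ n → ¬ Finsler.IsMaximum F p x₀ x₁ c)) ∧
      (1 < p → ¬ Finsler.IsMaximum F p x₀ x₁ c)) ∧
    (Finsler.HasConjugatePoints F c →
      (p < 0 → ¬ Finsler.IsMaximum F p x₀ x₁ c) ∧
      (0 < p → p < 1 → ¬ Finsler.IsMinimum F p x₀ x₁ c) ∧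
      (1 < p → ¬ Finsler.IsMinimum F p x₀ x₁ c ∧ ¬ Finsler.IsMaximum F p x₀ x₁ c)) := by
  have hs := hgeo.1
  exact ⟨fun _ => ⟨fun hp => ⟨fun hn => Finsler.not_isMinimum_of_neg hp hn hc hs,
      Finsler.not_isMaximum (Or.inl hp) hc hs⟩,
    fun hp hp' => ⟨Finsler.not_isMinimum hp hp' hc hs,
      fun hn => Finsler.not_isMaximum_of_pos hp hn hc hs⟩,
    fun hp => Finsler.not_isMaximum (Or.inr hp) hc hs⟩,
  fun hconj => ⟨fun hp => Finsler.not_isMaximum (Or.inl hp) hc hs,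
    fun hp hp' => Finsler.not_isMinimum hp hp' hc hs,
    fun hp => ⟨Finsler.not_isMinimum_of_hasConjugatePoints hp hc hgeo hconj,
      Finsler.not_isMaximum (Or.inr hp) hc hs⟩⟩⟩
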